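/- Let $f_0:\mathbb R\to\mathbb R$ belong to $H^{s_0}(\mathbb R)$ with $s_0>\frac32$ ($f_0$ denotes its continuous, hence $C^1$, representative), and let $0<T_0\le+\infty$ be defined by $$\Big(\frac{2\pi}{T_0}\Big)^2=\max\Big\{0,\ \max_{c:\,f_0'(c)=0}\int_{\mathbb R}\frac{f_0'(v)}{v-c}\,dv\Big\}.$$ Let $0<T<T_0$, and let $(f(x,v,t),E(x,t))$ be a solution for $t\ge 0$ (in the sense of distributions in $(x,v)$, with $E$ continuous in time) of the linearized Vlasov--Poisson system $$\partial_t f+v\,\partial_x f-E\,f_0'(v)=0,\qquad \partial_x E=-\int_{\mathbb R} f\,dv,$$ with $f,E$ $T$-periodic in $x$, $\int_0^T\!\int_{\mathbb R} f\,dv\,dx=0$ and $\int_0^T E\,dx=0$. Put $g(x,v)=f(x,v,0)-\frac1T\int_0^T f(x,v,0)\,dx$. For $h(x,v)=\sum_{k\in\mathbb Z}e^{2\pi i kx/T}h_k(v)$ and $E(x)=\sum_{k\neq0}e^{2\pi i kx/T}E_k$ let $$\|h\|_{H^{a}_xH^{b}_v}=\Big(\sum_{k\neq 0}|k|^{2a}\|h_k\|_{H^{b}(\mathbb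 R)}^2\Big)^{1/2},\qquad \|E\|_{H^s}=\Big(\sum_{k\ne0}|k|^{2s}|E_k|^2\Big)^{1/2}.$$ Let $s_x,s_v,s_x',s_v'\in\mathbb R$ satisfy $s_v>-\frac12$, $s_v+s_v'\ge0$ and $\max\{|s_v|,|s_v'|\}\le s_0-1$. If $g\in H^{s_x}_xH^{s_v}_v$ and $vg\in H^{s_x'}_xH^{s_v'}_v$, then, with $s=\min\{\frac32+s_x+s_v,\ \frac12+s_x'+s_v'\}$, the norm $\|E(t)\|_{H^s}$ is finite for all large $t$ and $$\|E(t)\|_{H^s}=o\big(t^{-(s_v+s_v')/2}\big)\qquad\text{as }t\to\infty.$$ -/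

import Mathlib

open MeasureTheory Set Filter Topology Asymptotics
open scoped SchwartzMap ENNReal ContDiff

noncomputable section

namespace LinearVlasov

/-! ### Distributions that are periodic in `x` -/

/-- Smooth complex-valued `T`-periodic functions of `x`: the test functions on the circle
`ℝ / Tℤ`. -/
def PeriodicTest (T : ℝ) : Submodule ℂ (ℝ → ℂ) where
  carrier := {a | ContDiff ℝ ∞ a ∧ Function.Periodic a T}
  add_mem' ha hb := ⟨ha.1.add hb.1, ha.2.add hb.2⟩
  zero_mem' := ⟨contDiff_const, fun _ => rfl⟩
  smul_mem' c _ ha := ⟨contDiff_const.smul ha.1, fun x => by simp [ha.2 x]⟩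

namespace PeriodicTest

variable {T : ℝ}

/-- The derivative of a periodic test function. -/
def dx (a : PeriodicTest T) : PeriodicTest T :=
  ⟨deriv a.1, (contDiff_infty_iff_deriv.1 a.2.1).2, fun x => by
    have h : (fun y => a.1 (y + T)) = a.1 := funext a.2.2
    rw [← deriv_comp_add_const, h]⟩

/-- The constant test function `1`. -/
def one (T : ℝ) : PeriodicTest T :=
  ⟨fun _ => 1, contDiff_const, fun _ => rfl⟩

/-- The Fourier mode `x ↦ exp (2πikx / T)`. -/
def mode (T : ℝ) (k : ℤ) : PeriodicTest T :=
  ⟨fun x => Complex.exp (2 * Real.pi * Complex.I * k * ((x / T : ℝ) : ℂ)), by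
    constructor
    · have h : ContDiff ℝ ∞ (fun x : ℝ => ((x / T : ℝ) : ℂ)) :=
        Complex.ofRealCLM.contDiff.comp (contDiff_id.div_const T)
      exact (contDiff_const.mul h).cexp
    · intro x
      by_cases hT : T = 0
      · simp [hT]
      · have h : ((x + T) / T : ℝ) = x / T + 1 := by field_simp
        simp only [h]
        rw [Complex.exp_eq_exp_iff_exists_int]
        exact ⟨k, by push_cast; ring⟩⟩

end PeriodicTest

/-- Distributions in `x ∈ ℝ / Tℤ` with values in `V`: the linear maps from the smooth periodic
functions to `V` that are (sequentially) continuous for the `C^∞` topology.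
With `V = ℂ` these are the `T`-periodic distributions `E(x)`. With `V = 𝓢'(ℝ, ℂ)` these are the
distributions `h(x, v)` that are `T`-periodic in `x` and tempered in `v`, and `h a ψ` is the pairing
of `h` with `a(x) ψ(v)`, which is `∫₀ᵀ ∫ h(x, v) a(x) ψ(v) dv dx` when `h` is a function. -/
structure PeriodicDistribution (T : ℝ) (V : Type*) [AddCommGroup V] [Module ℂ V]
    [TopologicalSpace V] where
  toLin : PeriodicTest T →ₗ[ℂ] V
  seq_continuous : ∀ a : ℕ → PeriodicTest T,
    (∀ j : ℕ, TendstoUniformly (fun n x => iteratedDeriv j (a n).1 x) (fun _ => 0) atTop) →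
    Tendsto (fun n => toLin (a n)) atTop (𝓝 0)

namespace PeriodicDistribution

variable {T : ℝ} {V : Type*} [AddCommGroup V] [Module ℂ V] [TopologicalSpace V]

instance : CoeFun (PeriodicDistribution T V) (fun _ => PeriodicTest T → V) :=
  ⟨fun u => u.toLin⟩

/-- The distributional derivative `∂ₓ u`, that is `a ↦ -⟨u, a'⟩`. -/
def dx [IsTopologicalAddGroup V] (u : PeriodicDistribution T V) : PeriodicDistribution T V where
  toLin :=
    { toFun := fun a => -u (PeriodicTest.dx a)
      map_add' := fun a b => by
        have h : PeriodicTest.dx (a + b) = PeriodicTest.dx a + PeriodicTest.dx b := by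
          apply Subtype.ext
          funext x
          exact deriv_add (a.2.1.differentiable (by simp) x) (b.2.1.differentiable (by simp) x)
        rw [h, map_add, neg_add]
      map_smul' := fun c a => by
        have h : PeriodicTest.dx (c • a) = c • PeriodicTest.dx a := by
          apply Subtype.ext
          funext x
          exact deriv_const_smul c (a.2.1.differentiable (by simp) x)
        rw [h, map_smul, RingHom.id_apply, smul_neg] }
  seq_continuous := fun a ha => by
    have h := u.seq_continuous (fun n => PeriodicTest.dx (a n)) (fun j => by
      have := ha (j + 1)
      simp only [iteratedDeriv_succ'] at this
      exact this)
    simpa using h.neg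

/-- Apply a continuous linear operator (acting in the variable `v` only) to the values. -/
def map {W : Type*} [AddCommGroup W] [Module ℂ W] [TopologicalSpace W]
    (L : V →L[ℂ] W) (u : PeriodicDistribution T V) : PeriodicDistribution T W where
  toLin := L.toLinearMap ∘ₗ u.toLin
  seq_continuous := fun a ha => by
    have h := (L.continuous.tendsto 0).comp (u.seq_continuous a ha)
    rw [map_zero] at h
    exact h

/-- The Fourier coefficient `u_k = (1/T) ∫₀ᵀ u(x) exp (-2πikx / T) dx`. -/
def coeff (u : PeriodicDistribution T V) (k : ℤ) : V :=
  ((T : ℂ)⁻¹) • u (PeriodicTest.mode T (-k))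

end PeriodicDistribution

/-- Multiplication of `h(x, v)` by `v`. -/
def vMul {T : ℝ} (h : PeriodicDistribution T 𝓢'(ℝ, ℂ)) : PeriodicDistribution T 𝓢'(ℝ, ℂ) :=
  h.map (TemperedDistribution.smulLeftCLM ℂ (fun v : ℝ => (v : ℂ)))

/-! ### Sobolev norms -/

/-- The `H^s(ℝ)` norm of a tempered distribution: the `L²` norm of its Bessel potential of order
`s` if that is an `L²` function, and `∞` otherwise. -/
def sobolevNorm (s : ℝ) (u : 𝓢'(ℝ, ℂ)) : ℝ≥0∞ :=
  ⨅ (w : Lp ℂ 2 (volume : Measure ℝ))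
    (_ : TemperedDistribution.besselPotential ℝ ℂ s u = (w : 𝓢'(ℝ, ℂ))), ‖w‖ₑ

/-- The norm of `H^{s_x}_x H^{s_v}_v`, namely `(∑_{k ≠ 0} |k|^{2 s_x} ‖h_k‖_{H^{s_v}}²)^{1/2}`. -/
def mixedSobolevNorm {T : ℝ} (sx sv : ℝ) (h : PeriodicDistribution T 𝓢'(ℝ, ℂ)) : ℝ≥0∞ :=
  (∑' k : {k : ℤ // k ≠ 0},
    ENNReal.ofReal (|((k : ℤ) : ℝ)| ^ (2 * sx)) * sobolevNorm sv (h.coeff k) ^ 2) ^ (1 / 2 : ℝ)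

/-- The `H^s` norm `(∑_{k ≠ 0} |k|^{2s} |E_k|²)^{1/2}` of a mean-zero periodic distribution. -/
def periodicSobolevNorm {T : ℝ} (s : ℝ) (E : PeriodicDistribution T ℂ) : ℝ≥0∞ :=
  (∑' k : {k : ℤ // k ≠ 0},
    ENNReal.ofReal (|((k : ℤ) : ℝ)| ^ (2 * s)) * ‖E.coeff k‖ₑ ^ 2) ^ (1 / 2 : ℝ)

/-- The function `f₀` belongs to `H^s(ℝ)`, for `s ≥ 0`. -/
def MemHs (s : ℝ) (f₀ : ℝ → ℝ) : Prop :=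
  ∃ h : MemLp (fun v => (f₀ v : ℂ)) 2 volume,
    TemperedDistribution.MemSobolev s 2 ((h.toLp _ : Lp ℂ 2 (volume : Measure ℝ)) : 𝓢'(ℝ, ℂ))

/-! ### The critical period -/

/-- `T₀ ∈ [0, ∞]`, defined by `(2π / T₀)² = max {0, sup ∫ f₀'(v) / (v - c) dv}` with the supremum
over the critical points `c` of `f₀` (`ENNReal.ofReal` takes the maximum with `0`). -/
def criticalPeriod (f₀ : ℝ → ℝ) : ℝ≥0∞ :=
  ENNReal.ofReal (2 * Real.pi) /
    (⨆ (c : ℝ) (_ : deriv f₀ c = 0), ENNReal.ofReal (∫ v, deriv f₀ v / (v - c))) ^ (1 / 2 : ℝ)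

/-! ### The linearized Vlasov-Poisson system -/

/-- The dilated function `v ↦ χ (v / R)`, for `R ≠ 0`. -/
def dilate (R : ℝˣ) (χ : 𝓢(ℝ, ℂ)) : 𝓢(ℝ, ℂ) :=
  SchwartzMap.compCLMOfContinuousLinearEquiv ℂ (ContinuousLinearEquiv.unitsEquivAut ℝ R⁻¹) χ

/-- The tempered distribution `u(v)` has the integral `∫ u dv = c`: the pairings of `u` with the
cut-offs `χ (v / n)` tend to `c` for every Schwartz function `χ` with `χ 0 = 1`. -/
def HasIntegral (u : 𝓢'(ℝ, ℂ)) (c : ℂ) : Prop :=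
  ∀ χ : 𝓢(ℝ, ℂ), χ 0 = 1 →
    Tendsto (fun n : ℕ => u (dilate (Units.mk0 ((n : ℝ) + 1) (by positivity)) χ)) atTop (𝓝 c)

/-- `(f, E)` is a solution for `t ≥ 0`, in the sense of distributions in `(x, v)`, with period `T`
in `x`, of the Vlasov-Poisson system linearized at the homogeneous state `(f₀, 0)`. -/
structure IsSolution (f₀ : ℝ → ℝ) {T : ℝ} (f : ℝ → PeriodicDistribution T 𝓢'(ℝ, ℂ))
    (E : ℝ → PeriodicDistribution T ℂ) : Prop where
  /-- `∂ₜ f + v ∂ₓ f - E f₀' = 0` -/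
  vlasov : ∀ (a : PeriodicTest T) (ψ : 𝓢(ℝ, ℂ)), ∀ t ∈ Ici (0 : ℝ),
    HasDerivWithinAt (fun τ => f τ a ψ)
      (-((vMul (f t)).dx a ψ) + E t a * ∫ v, ((deriv f₀ v : ℝ) : ℂ) * ψ v) (Ici 0) t
  /-- `∂ₓ E = -∫ f dv`; for a constant `a` this is the neutrality `∫₀ᵀ ∫ f dv dx = 0`. -/
  poisson : ∀ (a : PeriodicTest T), ∀ t ∈ Ici (0 : ℝ), HasIntegral (f t a) (-((E t).dx a))
  /-- `∫₀ᵀ E dx = 0` -/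
  mean_zero : ∀ t ∈ Ici (0 : ℝ), E t (PeriodicTest.one T) = 0
  /-- `E` is continuous in time with values in the distributions. -/
  continuous_field : ∀ a : PeriodicTest T, ContinuousOn (fun t => E t a) (Ici 0)

end LinearVlasov

end

open scoped FourierTransform NNReal

/-! After a Fourier transform in x and v, free transport of the k-th mode is a translation in the
variable dual to v. Duhamel's formula then gives the transform of that mode explicitly, and
Poisson's equation evaluates it at the origin. This yields a scalar Volterra equation for the k-th
coefficient of the field (`IsSolution.volterra`). In the time y = |k|t/T it reads e = G + l K * e on
the half-line (`IsSolution.rescaled_volterra`), with l = T²/k² in [0, T²]. The kernel K depends on k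
only through its sign: it is a constant times the Fourier transform φ of f₀' on one half-line. The
source G is a multiple, of order 1/|k|, of the transform of the k-th mode of g. Every estimate
therefore has to be uniform in l in [0, T²], and nothing else depends on k.

Sobolev regularity in v is a polynomial weight on the dual side. Thus K lies in L² with weight
(1+y)^m, m = s₀ - 1 > 1/2, while G and its derivative H lie in L² with weights of exponents r = s_v
and r' = s_v'.

The core is a uniform weighted L² bound for the Volterra equation (`exists_volterra_solution`).
Without weight, Plancherel bounds 1 - lK* from below as soon as |1 - l K̂| is bounded below on the
real line. A zero of 1 - l K̂ would force f₀'(c) = 0 and l ∫ f₀'(v)/(v-c) dv = (2π)² for some c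
(`penrose_ne_zero`), which T < T₀ excludes for l ≤ T² (`mul_integral_ne_of_lt_criticalPeriod`); the
Riemann-Lebesgue lemma and compactness make the bound uniform. The lower bound holds along the whole
segment of l, so invertibility on the half-line propagates from l = 0 by continuity, and no analysis
of K̂ off the real axis is needed. The weight (1+δx)^s, equivalent to (1+x)^s, conjugates the
operator into a small perturbation of itself when δ is small (`exists_kernelBound_sub`).

Decay follows in `exists_decay_bound`. The solution e lies in the weighted space of exponent r. Its
derivative solves the same equation with source H + l G(0) K, so it is the sum of a part with weight
r' and a part with weight m. Integrating (|e|²)' gives |e(y)|² ≤ 2 ∫_y^∞ |e||e'|; the condition on r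
rules out a positive lower bound for |e| at infinity. Cauchy-Schwarz bounds the right side by
(1+y)^{-(r+r')} times the tail of the weighted norm of e, up to the better-behaved second part. That
tail tends to zero, which is where the little-o comes from.

Back in the original time, the rate gains powers of |k|, and these match the exponent s
(`power_weights_le`). The squared sum is dominated by the two given norms, and dominated convergence
over the modes concludes. -/

namespace LinearVlasov

/-! ### The Fourier transform on L¹ ∩ L² -/

/-- Locally integrable functions with the same pairings against compactly supported Schwartz
functions agree almost everywhere. -/
theorem ae_eq_of_schwartz_pairing {f g : ℝ → ℂ} (hf : LocallyIntegrable f)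
    (hg : LocallyIntegrable g)
    (h : ∀ θ : 𝓢(ℝ, ℂ), HasCompactSupport θ → ∫ x, θ x * f x = ∫ x, θ x * g x) :
    f =ᵐ[volume] g := by
  have key : ∀ᵐ x, (f - g) x = 0 := by
    refine ae_eq_zero_of_integral_contDiff_smul_eq_zero (hf.sub hg) ?_
    intro ρ hρ hρc
    have hc : HasCompactSupport (fun x => (ρ x : ℂ)) :=
      HasCompactSupport.comp_left (g := fun r : ℝ => (r : ℂ)) hρc Complex.ofReal_zero
    have hs : ContDiff ℝ ∞ (fun x => (ρ x : ℂ)) := Complex.ofRealCLM.contDiff.comp hρ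
    have h1 := h (hc.toSchwartzMap hs) hc
    have i1 : Integrable (fun x => ρ x • f x) :=
      hf.integrable_smul_left_of_hasCompactSupport hρ.continuous hρc
    have i2 : Integrable (fun x => ρ x • g x) :=
      hg.integrable_smul_left_of_hasCompactSupport hρ.continuous hρc
    simp only [Pi.sub_apply, smul_sub]
    rw [integral_sub i1 i2, sub_eq_zero]
    simpa [Complex.real_smul] using h1
  filter_upwards [key] with x hx
  simpa [sub_eq_zero] using hx

theorem integral_fourier_mul_eq {f g : ℝ → ℂ} (hf : Integrable f) (hg : Integrable g) :
    ∫ x, 𝓕 f x * g x = ∫ x, f x * 𝓕 g x := by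
  have := VectorFourier.integral_fourierIntegral_smul_eq_flip (𝕜 := ℝ) (V := ℝ) (W := ℝ)
    (L := innerₗ ℝ) (e := Real.fourierChar) (μ := volume) (ν := volume)
    Real.continuous_fourierChar continuous_inner hf hg
  simp only [flip_innerₗ] at this
  exact this

theorem integral_fourierInv_mul_eq {f g : ℝ → ℂ} (hf : Integrable f) (hg : Integrable g) :
    ∫ x, 𝓕⁻ f x * g x = ∫ x, f x * 𝓕⁻ g x := by
  have h := integral_fourier_mul_eq hf.comp_neg hg
  have h1 : ∀ x, 𝓕 (fun y => f (-y)) x = 𝓕⁻ f x := fun x => by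
    rw [Real.fourierInv_eq_fourier_comp_neg]
  have h2 : ∀ x, 𝓕 g (-x) = 𝓕⁻ g x := fun x => by
    rw [Real.fourierInv_eq_fourier_neg]
  rw [← integral_neg_eq_self (fun x => f (-x) * 𝓕 g x)] at h
  simpa [h1, h2] using h

theorem continuous_fourier {f : ℝ → ℂ} (hf : Integrable f) : Continuous (𝓕 f) :=
  VectorFourier.fourierIntegral_continuous Real.continuous_fourierChar
    (by exact continuous_inner) hf

/-- The `L²` Fourier transform is given by the Fourier integral on `L¹ ∩ L²`. -/
theorem coeFn_fourier_toLp {f : ℝ → ℂ} (h1 : Integrable f) (h2 : MemLp f 2) :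
    (𝓕 (h2.toLp f) : Lp ℂ 2 (volume : Measure ℝ)) =ᵐ[volume] 𝓕 f := by
  refine ae_eq_of_schwartz_pairing ?_ (continuous_fourier h1).locallyIntegrable ?_
  · exact (Lp.memLp _).locallyIntegrable (by norm_num)
  intro θ _
  have e := congrArg (fun u : 𝓢'(ℝ, ℂ) => u θ) (Lp.fourier_toTemperedDistribution_eq (h2.toLp f))
  simp only [TemperedDistribution.fourier_apply, Lp.toTemperedDistribution_apply,
    smul_eq_mul] at e
  rw [← e, ← integral_fourier_mul_eq θ.integrable h1]
  refine integral_congr_ae ?_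
  filter_upwards [h2.coeFn_toLp] with x hx
  rw [hx, SchwartzMap.fourier_coe]

theorem memLp_fourier {f : ℝ → ℂ} (h1 : Integrable f) (h2 : MemLp f 2) : MemLp (𝓕 f) 2 :=
  (memLp_congr_ae (coeFn_fourier_toLp h1 h2)).1 (Lp.memLp _)

/-- Plancherel's theorem on `L¹ ∩ L²`. -/
theorem eLpNorm_fourier {f : ℝ → ℂ} (h1 : Integrable f) (h2 : MemLp f 2) :
    eLpNorm (𝓕 f) 2 volume = eLpNorm f 2 volume := by
  rw [← eLpNorm_congr_ae (coeFn_fourier_toLp h1 h2), ← eLpNorm_congr_ae h2.coeFn_toLp,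
    ← Lp.enorm_def, ← Lp.enorm_def, ← ofReal_norm, ← ofReal_norm, Lp.norm_fourier_eq]

/-! ### Integral operators on L² with absolutely bounded kernels -/

section Kernel

variable {α : Type*} [MeasurableSpace α] {μ : Measure α}

theorem eLpNorm_two_sq {E : Type*} [NormedAddCommGroup E] (f : α → E) :
    eLpNorm f 2 μ ^ 2 = ∫⁻ x, ‖f x‖ₑ ^ 2 ∂μ := by
  rw [eLpNorm_eq_lintegral_rpow_enorm_toReal (by norm_num) (by norm_num), ← ENNReal.rpow_natCast,
    ← ENNReal.rpow_mul]
  simp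

theorem lintegral_mul_sq_le {f g : α → ℝ≥0∞} (hf : AEMeasurable f μ) (hg : AEMeasurable g μ) :
    (∫⁻ x, f x * g x ∂μ) ^ 2 ≤ (∫⁻ x, f x ^ 2 ∂μ) * ∫⁻ x, g x ^ 2 ∂μ := by
  have h := ENNReal.lintegral_mul_le_Lp_mul_Lq μ Real.HolderConjugate.two_two hf hg
  simp only [Pi.mul_apply, ENNReal.rpow_two] at h
  calc _ ≤ ((∫⁻ x, f x ^ 2 ∂μ) ^ (1 / 2 : ℝ) * (∫⁻ x, g x ^ 2 ∂μ) ^ (1 / 2 : ℝ)) ^ 2 := by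
        gcongr
    _ = _ := by
        rw [mul_pow, ← ENNReal.rpow_natCast, ← ENNReal.rpow_mul, ← ENNReal.rpow_natCast,
          ← ENNReal.rpow_mul]
        simp

/-- The integral operator with the nonnegative kernel `a` is bounded by `C` on `L²`. -/
def KernelBound (μ : Measure α) (a : α → α → ℝ≥0∞) (C : ℝ≥0∞) : Prop :=
  ∀ u : α → ℝ≥0∞, Measurable u →
    ∫⁻ x, (∫⁻ y, a x y * u y ∂μ) ^ 2 ∂μ ≤ C ^ 2 * ∫⁻ y, u y ^ 2 ∂μ

theorem KernelBound.mono {a b : α → α → ℝ≥0∞} {C : ℝ≥0∞} (hb : KernelBound μ b C)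
    (h : ∀ᵐ x ∂μ, ∀ᵐ y ∂μ, a x y ≤ b x y) : KernelBound μ a C := by
  intro u hu
  refine le_trans (lintegral_mono_ae ?_) (hb u hu)
  filter_upwards [h] with x hx
  gcongr ?_ ^ 2
  refine lintegral_mono_ae ?_
  filter_upwards [hx] with y hy
  gcongr

theorem KernelBound.mono_const {a : α → α → ℝ≥0∞} {C D : ℝ≥0∞} (h : KernelBound μ a C)
    (hCD : C ≤ D) : KernelBound μ a D := fun u hu =>
  (h u hu).trans (by gcongr)

theorem KernelBound.add [SFinite μ] {a b : α → α → ℝ≥0∞} {C D : ℝ≥0∞}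
    (ha : Measurable (Function.uncurry a)) (hb : Measurable (Function.uncurry b))
    (hC : KernelBound μ a C) (hD : KernelBound μ b D) :
    KernelBound μ (fun x y => a x y + b x y) (C + D) := by
  intro u hu
  have ma : Measurable (fun x => ∫⁻ y, a x y * u y ∂μ) :=
    (ha.mul (hu.comp measurable_snd)).lintegral_prod_right'
  have mb : Measurable (fun x => ∫⁻ y, b x y * u y ∂μ) :=
    (hb.mul (hu.comp measurable_snd)).lintegral_prod_right'
  have h1 : ∀ x, ∫⁻ y, (a x y + b x y) * u y ∂μ =
      ∫⁻ y, a x y * u y ∂μ + ∫⁻ y, b x y * u y ∂μ := fun x => by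
    simp only [add_mul]
    exact lintegral_add_left ((ha.comp measurable_prodMk_left).mul hu) _
  simp only [h1]
  have h := ENNReal.lintegral_Lp_add_le (μ := μ) ma.aemeasurable mb.aemeasurable
    (p := 2) (by norm_num)
  simp only [Pi.add_apply, ENNReal.rpow_two] at h
  have root : ∀ {X U F : ℝ≥0∞}, X ≤ F ^ 2 * U → X ^ (1 / 2 : ℝ) ≤ F * U ^ (1 / 2 : ℝ) := by
    intro X U F hX
    calc X ^ (1 / 2 : ℝ) ≤ (F ^ 2 * U) ^ (1 / 2 : ℝ) := by gcongr
      _ = _ := by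
        rw [ENNReal.mul_rpow_of_nonneg _ _ (by norm_num), ← ENNReal.rpow_natCast,
          ← ENNReal.rpow_mul]
        simp
  have h2 := h.trans (add_le_add (root (hC u hu)) (root (hD u hu)))
  rw [← add_mul] at h2
  have sq : ∀ {X : ℝ≥0∞}, (X ^ (1 / 2 : ℝ)) ^ 2 = X := by
    intro X
    rw [← ENNReal.rpow_natCast, ← ENNReal.rpow_mul]
    simp
  calc _ = ((∫⁻ x, (∫⁻ y, a x y * u y ∂μ + ∫⁻ y, b x y * u y ∂μ) ^ 2 ∂μ) ^ (1 / 2 : ℝ)) ^ 2 :=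
        sq.symm
    _ ≤ ((C + D) * (∫⁻ y, u y ^ 2 ∂μ) ^ (1 / 2 : ℝ)) ^ 2 := by gcongr
    _ = _ := by rw [mul_pow, sq]

/-- Schur's test. -/
theorem KernelBound.schur [SFinite μ] {a : α → α → ℝ≥0∞} {C : ℝ≥0∞}
    (ha : Measurable (Function.uncurry a))
    (h1 : ∀ x, ∫⁻ y, a x y ∂μ ≤ C) (h2 : ∀ y, ∫⁻ x, a x y ∂μ ≤ C) : KernelBound μ a C := by
  intro u hu
  have hm : Measurable (Function.uncurry fun x y => a x y * u y ^ 2) :=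
    ha.mul ((hu.comp measurable_snd).pow_const 2)
  have step : ∀ x, (∫⁻ y, a x y * u y ∂μ) ^ 2 ≤ C * ∫⁻ y, a x y * u y ^ 2 ∂μ := by
    intro x
    have hax : Measurable (a x) := ha.comp measurable_prodMk_left
    have hs : ∀ y, (a x y ^ (1 / 2 : ℝ)) ^ 2 = a x y := fun y => by
      rw [← ENNReal.rpow_natCast, ← ENNReal.rpow_mul]; simp
    -- Splitting a = a^{1/2} · a^{1/2} lets the row integrals control one factor here; the column
    -- integrals control the other one after Tonelli.
    have := lintegral_mul_sq_le (μ := μ) (f := fun y => a x y ^ (1 / 2 : ℝ))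
      (g := fun y => a x y ^ (1 / 2 : ℝ) * u y) (hax.pow_const _).aemeasurable
      ((hax.pow_const _).mul hu).aemeasurable
    simp only [mul_pow, hs, ← mul_assoc, ← pow_two] at this
    exact this.trans (by gcongr; exact h1 x)
  calc _ ≤ ∫⁻ x, C * ∫⁻ y, a x y * u y ^ 2 ∂μ ∂μ := lintegral_mono step
    _ = C * ∫⁻ x, ∫⁻ y, a x y * u y ^ 2 ∂μ ∂μ :=
        lintegral_const_mul _ hm.lintegral_prod_right'
    _ = C * ∫⁻ y, ∫⁻ x, a x y * u y ^ 2 ∂μ ∂μ := by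
        rw [lintegral_lintegral_swap hm.aemeasurable]
    _ = C * ∫⁻ y, (∫⁻ x, a x y ∂μ) * u y ^ 2 ∂μ := by
        congr 1
        refine lintegral_congr fun y => ?_
        exact lintegral_mul_const _ (ha.comp measurable_prodMk_right)
    _ ≤ C * ∫⁻ y, C * u y ^ 2 ∂μ := by
        gcongr with y
        exact h2 y
    _ = _ := by
        rw [lintegral_const_mul _ (hu.pow_const 2), pow_two, mul_assoc]

/-- The Hilbert-Schmidt bound. -/
theorem KernelBound.hilbertSchmidt [SFinite μ] {a : α → α → ℝ≥0∞} {C : ℝ≥0∞}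
    (ha : Measurable (Function.uncurry a))
    (h : ∫⁻ x, ∫⁻ y, a x y ^ 2 ∂μ ∂μ ≤ C ^ 2) : KernelBound μ a C := by
  intro u hu
  calc _ ≤ ∫⁻ x, (∫⁻ y, a x y ^ 2 ∂μ) * ∫⁻ y, u y ^ 2 ∂μ ∂μ :=
        lintegral_mono fun x => lintegral_mul_sq_le
          (ha.comp measurable_prodMk_left).aemeasurable hu.aemeasurable
    _ ≤ (∫⁻ x, ∫⁻ y, a x y ^ 2 ∂μ ∂μ) * ∫⁻ y, u y ^ 2 ∂μ := by
        exact (lintegral_mul_const _ (Measurable.lintegral_prod_right'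
          (f := fun p : α × α => a p.1 p.2 ^ 2) (ha.pow_const 2))).le
    _ ≤ _ := by gcongr

theorem KernelBound.enorm_integral_le {k : α → α → ℂ} {C : ℝ≥0∞}
    (h : KernelBound μ (fun x y => ‖k x y‖ₑ) C) {u : α → ℂ} (hu : Measurable u) :
    eLpNorm (fun x => ∫ y, k x y * u y ∂μ) 2 μ ≤ C * eLpNorm u 2 μ := by
  have h1 : eLpNorm (fun x => ∫ y, k x y * u y ∂μ) 2 μ ^ 2 ≤ (C * eLpNorm u 2 μ) ^ 2 := by
    rw [mul_pow, eLpNorm_two_sq, eLpNorm_two_sq]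
    refine le_trans (lintegral_mono fun x => ?_) (h _ hu.enorm)
    gcongr
    refine (enorm_integral_le_lintegral_enorm _).trans (le_of_eq ?_)
    simp [enorm_mul]
  exact (ENNReal.pow_right_strictMono two_ne_zero).le_iff_le.1 h1

theorem KernelBound.ae_integrable [SFinite μ] {k : α → α → ℂ} {C : ℝ≥0∞}
    (hk : Measurable (Function.uncurry k)) (hC : C ≠ ⊤)
    (h : KernelBound μ (fun x y => ‖k x y‖ₑ) C) {u : α → ℂ} (hu : Measurable u)
    (hu2 : eLpNorm u 2 μ ≠ ⊤) : ∀ᵐ x ∂μ, Integrable (fun y => k x y * u y) μ := by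
  have hm : Measurable (fun x => (∫⁻ y, ‖k x y‖ₑ * ‖u y‖ₑ ∂μ) ^ 2) :=
    (Measurable.lintegral_prod_right' (f := fun p : α × α => ‖k p.1 p.2‖ₑ * ‖u p.2‖ₑ)
      (hk.enorm.mul (hu.enorm.comp measurable_snd))).pow_const 2
  have h1 : ∫⁻ x, (∫⁻ y, ‖k x y‖ₑ * ‖u y‖ₑ ∂μ) ^ 2 ∂μ ≠ ⊤ := by
    refine ne_top_of_le_ne_top ?_ (h _ hu.enorm)
    rw [← eLpNorm_two_sq]
    finiteness
  filter_upwards [ae_lt_top hm h1] with x hx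
  refine ⟨((hk.comp measurable_prodMk_left).mul hu).aestronglyMeasurable, ?_⟩
  rw [hasFiniteIntegral_iff_enorm]
  simp only [enorm_mul]
  contrapose! hx
  simp [top_le_iff.1 hx]

theorem KernelBound.memLp [SFinite μ] {k : α → α → ℂ} {C : ℝ≥0∞}
    (hk : Measurable (Function.uncurry k)) (hC : C ≠ ⊤)
    (h : KernelBound μ (fun x y => ‖k x y‖ₑ) C) (u : Lp ℂ 2 μ) :
    MemLp (fun x => ∫ y, k x y * u y ∂μ) 2 μ := by
  have hu : Measurable u := (Lp.stronglyMeasurable u).measurable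
  refine ⟨?_, (h.enorm_integral_le hu).trans_lt ?_⟩
  · exact (StronglyMeasurable.integral_prod_right' (f := fun p : α × α => k p.1 p.2 * u p.2)
      (hk.mul (hu.comp measurable_snd)).stronglyMeasurable).aestronglyMeasurable
  · exact ENNReal.mul_lt_top hC.lt_top (Lp.eLpNorm_lt_top u)

/-- The integral operator on `L²` with kernel `k`. -/
noncomputable def kernelOp [SFinite μ] (k : α → α → ℂ) (C : ℝ≥0∞)
    (hk : Measurable (Function.uncurry k)) (hC : C ≠ ⊤)
    (h : KernelBound μ (fun x y => ‖k x y‖ₑ) C) : Lp ℂ 2 μ →L[ℂ] Lp ℂ 2 μ :=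
  LinearMap.mkContinuous
    { toFun := fun u => (h.memLp hk hC u).toLp _
      map_add' := fun u v => by
        have hu : Measurable u := (Lp.stronglyMeasurable u).measurable
        have hv : Measurable v := (Lp.stronglyMeasurable v).measurable
        rw [← MemLp.toLp_add]
        refine MemLp.toLp_congr _ _ ?_
        filter_upwards [h.ae_integrable hk hC hu (Lp.eLpNorm_ne_top u),
          h.ae_integrable hk hC hv (Lp.eLpNorm_ne_top v)] with x h1 h2
        rw [Pi.add_apply, ← integral_add h1 h2]
        refine integral_congr_ae ?_
        filter_upwards [Lp.coeFn_add u v] with y hy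
        rw [hy, Pi.add_apply, mul_add]
      map_smul' := fun c u => by
        rw [← MemLp.toLp_const_smul]
        refine MemLp.toLp_congr _ _ (Eventually.of_forall fun x => ?_)
        simp only [Pi.smul_apply, smul_eq_mul, RingHom.id_apply]
        rw [← integral_const_mul]
        refine integral_congr_ae ?_
        filter_upwards [Lp.coeFn_smul c u] with y hy
        rw [hy, Pi.smul_apply, smul_eq_mul]
        ring }
    C.toReal fun u => by
      have hu : Measurable u := (Lp.stronglyMeasurable u).measurable
      simp only [LinearMap.coe_mk, AddHom.coe_mk]
      rw [Lp.norm_toLp, Lp.norm_def, ← ENNReal.toReal_mul]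
      exact ENNReal.toReal_mono (ENNReal.mul_ne_top hC (Lp.eLpNorm_ne_top u))
        (h.enorm_integral_le hu)

variable [SFinite μ] {k : α → α → ℂ} {C : ℝ≥0∞} (hk : Measurable (Function.uncurry k))
    (hC : C ≠ ⊤) (h : KernelBound μ (fun x y => ‖k x y‖ₑ) C)

theorem kernelOp_coeFn (u : Lp ℂ 2 μ) :
    kernelOp k C hk hC h u =ᵐ[μ] fun x => ∫ y, k x y * u y ∂μ :=
  MemLp.coeFn_toLp (h.memLp hk hC u)

theorem norm_kernelOp_le (u : Lp ℂ 2 μ) : ‖kernelOp k C hk hC h u‖ ≤ C.toReal * ‖u‖ := by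
  refine ((kernelOp k C hk hC h).le_opNorm u).trans ?_
  gcongr
  exact LinearMap.mkContinuous_norm_le _ ENNReal.toReal_nonneg _

/-- The perturbation argument compares the weighted and unweighted Volterra operators only through
the difference of their kernels, which is small although each kernel is not. -/
theorem kernelOp_sub {k' : α → α → ℂ} {C' D : ℝ≥0∞} (hk' : Measurable (Function.uncurry k'))
    (hC' : C' ≠ ⊤) (h' : KernelBound μ (fun x y => ‖k' x y‖ₑ) C') (hD : D ≠ ⊤)
    (hd : KernelBound μ (fun x y => ‖k x y - k' x y‖ₑ) D) (u : Lp ℂ 2 μ) :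
    ‖kernelOp k C hk hC h u - kernelOp k' C' hk' hC' h' u‖ ≤ D.toReal * ‖u‖ := by
  have hu : Measurable u := (Lp.stronglyMeasurable u).measurable
  have e : kernelOp k C hk hC h u - kernelOp k' C' hk' hC' h' u =
      kernelOp (fun x y => k x y - k' x y) D (hk.sub hk') hD hd u := by
    refine Lp.ext ?_
    filter_upwards [kernelOp_coeFn hk hC h u, kernelOp_coeFn hk' hC' h' u,
      kernelOp_coeFn (hk.sub hk') hD hd u, h.ae_integrable hk hC hu (Lp.eLpNorm_ne_top u),
      h'.ae_integrable hk' hC' hu (Lp.eLpNorm_ne_top u),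
      Lp.coeFn_sub (kernelOp k C hk hC h u) (kernelOp k' C' hk' hC' h' u)]
      with x h1 h2 h3 h4 h5 h6
    rw [h6, Pi.sub_apply, h1, h2, h3, ← integral_sub h4 h5]
    simp only [sub_mul]
  rw [e]
  exact norm_kernelOp_le _ hD hd u

end Kernel

/-! ### Continuity method and lower bound of the symbol -/

/-- The method of continuity for `λ ↦ 1 - λ B`. -/
theorem surjective_of_bounded_below {X : Type*} [NormedAddCommGroup X] [NormedSpace ℂ X]
    [CompleteSpace X] (B : X →L[ℂ] X) {c Λ : ℝ} (hc : 0 < c)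
    (h : ∀ l ∈ Icc 0 Λ, ∀ u : X, c * ‖u‖ ≤ ‖u - (l : ℂ) • B u‖) :
    ∀ l ∈ Icc 0 Λ, ∀ v : X, ∃ u : X, u - (l : ℂ) • B u = v := by
  set S : ℝ → X →L[ℂ] X := fun l => 1 - (l : ℂ) • B with hS
  have hSa : ∀ l u, S l u = u - (l : ℂ) • B u := fun l u => by simp [hS]
  -- The way from 0 to l is cut into N + 1 equal steps, each changing the operator by less than c.
  -- Since every inverse met on the way has norm at most 1/c, invertibility survives each step.
  obtain ⟨N, hN⟩ : ∃ N : ℕ, Λ * ‖B‖ < c * (N + 1) := by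
    obtain ⟨N, hN⟩ := exists_nat_gt (Λ * ‖B‖ / c)
    exact ⟨N, by rw [div_lt_iff₀ hc] at hN; nlinarith⟩
  intro l hl
  have step : ∀ j : ℕ, j ≤ N + 1 → IsUnit (S (l * (j / (N + 1)))) := by
    intro j
    induction j with
    | zero => intro _; simp [hS]
    | succ j ih =>
      intro hj
      obtain ⟨V, hV⟩ := ih (by omega)
      set l' := l * (j / ((N : ℝ) + 1)) with hl'
      have hl'mem : l' ∈ Icc 0 Λ := by
        have h1 : (j : ℝ) / ((N : ℝ) + 1) ≤ 1 := by
          rw [div_le_one (by positivity)]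
          exact_mod_cast (by omega : j ≤ N + 1)
        exact ⟨mul_nonneg hl.1 (by positivity), (mul_le_of_le_one_right hl.1 h1).trans hl.2⟩
      have hinv : ‖(↑V⁻¹ : X →L[ℂ] X)‖ ≤ c⁻¹ := by
        refine ContinuousLinearMap.opNorm_le_bound _ (by positivity) fun u => ?_
        have h1 := h l' hl'mem ((↑V⁻¹ : X →L[ℂ] X) u)
        rw [← hSa, ← hV, ← mul_apply_eq_comp, Units.mul_inv,
          one_apply_eq_self] at h1
        rwa [inv_mul_eq_div, le_div_iff₀ hc, mul_comm]
      -- The neighbourhood of a unit has radius ‖V⁻¹‖⁻¹, and this is at least c only if V⁻¹ is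
      -- nonzero, which fails on the zero space.
      rcases subsingleton_or_nontrivial X with hX | hX
      · have : Subsingleton (X →L[ℂ] X) := inferInstance
        exact isUnit_of_subsingleton _
      refine ⟨V.ofNearby (S (l * ((j + 1 : ℕ) / (N + 1)))) ?_, rfl⟩
      rw [hV]
      have e : S (l * ((j + 1 : ℕ) / ((N : ℝ) + 1))) - S l' =
          ((-(l / (N + 1)) : ℝ) : ℂ) • B := by
        simp only [hS, hl']
        rw [sub_sub_sub_cancel_left, ← sub_smul]
        congr 1
        push_cast
        ring
      rw [e, norm_smul, Complex.norm_real, norm_neg, Real.norm_of_nonneg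
        (div_nonneg hl.1 (by positivity))]
      have h2 : c ≤ ‖(↑V⁻¹ : X →L[ℂ] X)‖⁻¹ := by
        rw [le_inv_comm₀ hc (norm_pos_iff.2 V⁻¹.ne_zero)]
        exact hinv
      refine lt_of_lt_of_le ?_ h2
      rw [div_mul_eq_mul_div, div_lt_iff₀ (by positivity)]
      refine lt_of_le_of_lt ?_ hN
      gcongr
      exact hl.2
  have h1 := step (N + 1) le_rfl
  have e : l * (((N + 1 : ℕ) : ℝ) / (N + 1)) = l := by
    push_cast
    field_simp
  rw [e] at h1
  obtain ⟨V, hV⟩ := h1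
  intro v
  refine ⟨(↑V⁻¹ : X →L[ℂ] X) v, ?_⟩
  rw [← hSa, ← hV, ← mul_apply_eq_comp, Units.mul_inv, one_apply_eq_self]

/-- By the Riemann-Lebesgue lemma l 𝓕F is at most 1/2 in modulus outside a compact set of
frequencies, uniformly for l in the bounded interval. On the remaining compact product a continuous
nonvanishing function attains a positive minimum. -/
theorem exists_pos_le_norm_one_sub_fourier {F : ℝ → ℂ} (hF : Integrable F) {Λ : ℝ}
    (h : ∀ l ∈ Icc 0 Λ, ∀ η : ℝ, 1 - (l : ℂ) * 𝓕 F η ≠ 0) :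
    ∃ c > 0, ∀ l ∈ Icc 0 Λ, ∀ η : ℝ, c ≤ ‖1 - (l : ℂ) * 𝓕 F η‖ := by
  have h0 : Tendsto (𝓕 F) (cocompact ℝ) (𝓝 0) := by
    have := Real.tendsto_integral_exp_smul_cocompact F
    refine this.congr fun w => ?_
    rw [Real.fourier_eq]
    simp [mul_comm]
  have h1 : ∀ᶠ η in cocompact ℝ, ‖𝓕 F η‖ < 1 / (2 * (|Λ| + 1)) := by
    have := h0.norm
    rw [norm_zero] at this
    exact this.eventually_lt_const (by positivity)
  obtain ⟨s, hs, hsub⟩ := mem_cocompact.1 h1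
  set φ : ℝ × ℝ → ℝ := fun p => ‖1 - (p.1 : ℂ) * 𝓕 F p.2‖ with hφ
  have hcont : Continuous φ := by
    have := continuous_fourier hF
    fun_prop
  have hK : IsCompact (Icc 0 Λ ×ˢ s) := isCompact_Icc.prod hs
  have outside : ∀ l ∈ Icc 0 Λ, ∀ η ∉ s, 1 / 2 ≤ ‖1 - (l : ℂ) * 𝓕 F η‖ := by
    intro l hl η hη
    have h2 : ‖𝓕 F η‖ < 1 / (2 * (|Λ| + 1)) := hsub hη
    have h3 : ‖(l : ℂ) * 𝓕 F η‖ ≤ 1 / 2 := by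
      rw [norm_mul, Complex.norm_real, Real.norm_of_nonneg hl.1]
      have h4 : l ≤ |Λ| + 1 := hl.2.trans ((le_abs_self Λ).trans (by linarith))
      calc l * ‖𝓕 F η‖ ≤ (|Λ| + 1) * (1 / (2 * (|Λ| + 1))) := by gcongr
        _ = 1 / 2 := by field_simp
    have := norm_sub_norm_le (1 : ℂ) ((l : ℂ) * 𝓕 F η)
    rw [norm_one] at this
    linarith
  rcases (Icc 0 Λ ×ˢ s).eq_empty_or_nonempty with he | hne
  · refine ⟨1 / 2, by norm_num, fun l hl η => outside l hl η fun hη => ?_⟩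
    have : (l, η) ∈ Icc 0 Λ ×ˢ s := ⟨hl, hη⟩
    rw [he] at this
    exact this
  · obtain ⟨q, hq, hmin⟩ := hK.exists_isMinOn hne hcont.continuousOn
    refine ⟨min (1 / 2) (φ q), lt_min (by norm_num) (norm_pos_iff.2 (h _ hq.1 _)),
      fun l hl η => ?_⟩
    by_cases hη : η ∈ s
    · exact (min_le_right _ _).trans (hmin (show (l, η) ∈ Icc 0 Λ ×ˢ s from ⟨hl, hη⟩))
    · exact (min_le_left _ _).trans (outside l hl η hη)

/-! ### Volterra kernels conjugated with polynomial weights -/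

/-- Lebesgue measure on the half-line. -/
noncomputable abbrev halfLine : Measure ℝ := volume.restrict (Ioi 0)

/-- Young's inequality as a case of Schur's test: restricting to the half-line only decreases the
row and column integrals. -/
theorem KernelBound.conv {N : ℝ → ℝ≥0∞} (hN : Measurable N) :
    KernelBound halfLine (fun x y => N (x - y)) (∫⁻ u, N u) := by
  refine KernelBound.schur (hN.comp (measurable_fst.sub measurable_snd)) (fun x => ?_)
    fun y => ?_
  · exact (lintegral_mono' Measure.restrict_le_self le_rfl).trans
      (lintegral_sub_left_eq_self N x).le
  · exact (lintegral_mono' Measure.restrict_le_self le_rfl).trans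
      (lintegral_sub_right_eq_self N y).le

/-- The Hilbert-Schmidt norm of such a kernel factors. This serves the part of the kernel difference
whose factor in x - y is only square integrable, so that Young's inequality is not available. -/
theorem KernelBound.conv_mul {N M : ℝ → ℝ≥0∞} (hN : Measurable N) (hM : Measurable M)
    {C : ℝ≥0∞} (h : (∫⁻ u, N u ^ 2) * (∫⁻ y, M y ^ 2 ∂halfLine) ≤ C ^ 2) :
    KernelBound halfLine (fun x y => N (x - y) * M y) C := by
  have hm : Measurable (Function.uncurry fun x y => N (x - y) * M y) :=
    (hN.comp (measurable_fst.sub measurable_snd)).mul (hM.comp measurable_snd)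
  refine KernelBound.hilbertSchmidt hm (le_trans ?_ h)
  rw [lintegral_lintegral_swap (hm.pow_const 2).aemeasurable]
  rw [← lintegral_const_mul _ (hM.pow_const 2)]
  refine lintegral_mono fun y => ?_
  simp only [mul_pow]
  have hNy : Measurable fun x => N (x - y) ^ 2 :=
    (hN.comp (measurable_id.sub_const y)).pow_const 2
  rw [lintegral_mul_const _ hNy]
  have h3 : ∫⁻ x, N (x - y) ^ 2 ∂halfLine ≤ ∫⁻ u, N u ^ 2 :=
    (lintegral_mono' Measure.restrict_le_self le_rfl).trans
      (lintegral_sub_right_eq_self (μ := volume) (fun u => N u ^ 2) y).le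
  gcongr

/-- For `s ≤ m` and `r = (1 + δx) / (1 + δy) ≥ 1`, the deviation of `r ^ s` from `1` is controlled
by a bounded function of `δ(x - y)` and a product. -/
theorem exists_abs_rpow_sub_one_le {s m : ℝ} (hsm : s ≤ m) (hm : 0 ≤ m) :
    ∃ C > 0, ∀ δ > 0, ∀ x y : ℝ, 0 < y → y < x →
      |((1 + δ * x) / (1 + δ * y)) ^ s - 1| ≤ C * min 1 (δ * (x - y)) +
        2 ^ m * (δ * (x - y)) ^ m * (1 + δ * y) ^ (-m) := by
  obtain ⟨C, hC, hlip⟩ : ∃ C > 0, ∀ r ∈ Icc (1 : ℝ) 2, |r ^ s - 1| ≤ C * (r - 1) := by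
    refine ⟨|s| * 2 ^ |s - 1| + 1, by positivity, fun r hr => ?_⟩
    have := (convex_Icc (1 : ℝ) 2).norm_image_sub_le_of_norm_hasDerivWithin_le
      (f := fun r => r ^ s) (f' := fun r => s * r ^ (s - 1)) (C := |s| * 2 ^ |s - 1| + 1)
      (fun z hz => (Real.hasDerivAt_rpow_const (Or.inl (by linarith [hz.1]))).hasDerivWithinAt)
      (fun z hz => by
        rw [norm_mul, Real.norm_eq_abs, Real.norm_of_nonneg (Real.rpow_nonneg (by linarith [hz.1]) _)]
        have : z ^ (s - 1) ≤ 2 ^ |s - 1| := by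
          calc z ^ (s - 1) ≤ z ^ |s - 1| :=
                Real.rpow_le_rpow_of_exponent_le hz.1 (le_abs_self _)
            _ ≤ 2 ^ |s - 1| := Real.rpow_le_rpow (by linarith [hz.1]) hz.2 (abs_nonneg _)
        nlinarith [abs_nonneg s]) (left_mem_Icc.2 one_le_two) hr
    simpa [Real.norm_eq_abs, abs_of_nonneg (sub_nonneg.2 hr.1)] using this
  refine ⟨C, hC, fun δ hδ x y hy hxy => ?_⟩
  set r := (1 + δ * x) / (1 + δ * y) with hr
  have hy1 : 0 < 1 + δ * y := by positivity
  have hu : 0 < δ * (x - y) := mul_pos hδ (sub_pos.2 hxy)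
  have hr1 : r = 1 + δ * (x - y) / (1 + δ * y) := by
    rw [hr]; field_simp; ring
  have hq : 0 < δ * (x - y) / (1 + δ * y) := by positivity
  have hq' : δ * (x - y) / (1 + δ * y) ≤ δ * (x - y) :=
    div_le_self hu.le (by nlinarith [mul_pos hδ hy])
  have hr0 : 1 ≤ r := by linarith
  have hlast : 0 ≤ 2 ^ m * (δ * (x - y)) ^ m * (1 + δ * y) ^ (-m) := by positivity
  -- For r ≤ 2 the power is Lipschitz and r - 1 is at most both 1 and δ(x - y). For r > 2 one has r
  -- ≤ 2(r - 1) = 2δ(x - y)/(1 + δy), which produces the product term.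
  by_cases h2 : r ≤ 2
  · have h3 : r - 1 ≤ min 1 (δ * (x - y)) := le_min (by linarith) (by linarith)
    nlinarith [hlip r ⟨hr0, h2⟩]
  · have h3 : |r ^ s - 1| ≤ r ^ m := by
      rw [abs_le]
      have h4 : r ^ s ≤ r ^ m := Real.rpow_le_rpow_of_exponent_le hr0 hsm
      have h5 : 1 ≤ r ^ m := Real.one_le_rpow hr0 hm
      have h6 : 0 ≤ r ^ s := by positivity
      constructor <;> linarith
    have h4 : r ≤ 2 * (δ * (x - y)) * (1 + δ * y)⁻¹ := by
      rw [mul_assoc, ← div_eq_mul_inv]; linarith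
    have h5 : r ^ m ≤ 2 ^ m * (δ * (x - y)) ^ m * (1 + δ * y) ^ (-m) := by
      rw [Real.rpow_neg hy1.le, ← Real.inv_rpow hy1.le, ← Real.mul_rpow (by positivity) hu.le,
        ← Real.mul_rpow (by positivity) (by positivity)]
      exact Real.rpow_le_rpow (by linarith) h4 hm
    have : 0 ≤ C * min 1 (δ * (x - y)) := by positivity
    linarith

/-- The kernel of the Volterra convolution operator conjugated with the weight
`(1 + δx) ^ s`. -/
noncomputable def volterraKernel (K : ℝ → ℂ) (δ s : ℝ) (x y : ℝ) : ℂ :=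
  if y < x then K (x - y) * ((((1 + δ * x) / (1 + δ * y)) ^ s : ℝ) : ℂ) else 0

theorem measurable_volterraKernel {K : ℝ → ℂ} (hK : Measurable K) (δ s : ℝ) :
    Measurable (Function.uncurry (volterraKernel K δ s)) := by
  unfold volterraKernel Function.uncurry
  refine Measurable.ite (measurableSet_lt measurable_snd measurable_fst) ?_ measurable_const
  have := hK.comp (measurable_fst.sub measurable_snd : Measurable fun p : ℝ × ℝ => p.1 - p.2)
  refine this.mul (Complex.measurable_ofReal.comp ?_)
  fun_prop

/-- The blow-up is only like 1/δ, and it is later beaten by a factor δ^{2m}; this is where m > 1/2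
is decisive. -/
theorem lintegral_one_add_mul_rpow {m δ : ℝ} (hm : 1 / 2 < m) (hδ : 0 < δ) :
    ∫⁻ y, ENNReal.ofReal ((1 + δ * y) ^ (-m)) ^ 2 ∂halfLine =
      ENNReal.ofReal (1 / (2 * m - 1) / δ) := by
  have hpos : ∀ y ∈ Ioi (0 : ℝ), 0 < 1 + δ * y := fun y hy => by
    have : 0 < δ * y := mul_pos hδ hy
    linarith
  have hd : ∀ y ∈ Ici (0 : ℝ), HasDerivAt
      (fun y => -(1 / (2 * m - 1) / δ) * (1 + δ * y) ^ (-(2 * m - 1)))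
      ((1 + δ * y) ^ (-(2 * m))) y := by
    intro y hy
    have hy0 : 0 < 1 + δ * y := by
      have : 0 ≤ δ * y := mul_nonneg hδ.le hy
      linarith
    have h1 : HasDerivAt (fun y => 1 + δ * y) δ y := by
      simpa using ((hasDerivAt_id y).const_mul δ).const_add 1
    have h2 := ((h1.rpow_const (p := -(2 * m - 1)) (Or.inl hy0.ne')).const_mul
      (-(1 / (2 * m - 1) / δ)))
    refine h2.congr_deriv ?_
    have : 2 * m - 1 ≠ 0 := by linarith
    rw [show -(2 * m - 1) - 1 = -(2 * m) by ring]
    field_simp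
  have hlim : Tendsto (fun y => -(1 / (2 * m - 1) / δ) * (1 + δ * y) ^ (-(2 * m - 1))) atTop
      (𝓝 (-(1 / (2 * m - 1) / δ) * 0)) := by
    refine ((tendsto_rpow_neg_atTop (by linarith : 0 < 2 * m - 1)).comp ?_).const_mul _
    exact tendsto_atTop_add_const_left _ _ (tendsto_id.const_mul_atTop hδ)
  have hnn : ∀ y ∈ Ioi (0 : ℝ), 0 ≤ (1 + δ * y) ^ (-(2 * m)) := fun y hy =>
    Real.rpow_nonneg (hpos y hy).le _
  have hint := integrableOn_Ioi_deriv_of_nonneg' (a := 0) hd hnn hlim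
  have hval := integral_Ioi_of_hasDerivAt_of_nonneg' (a := 0) hd hnn hlim
  have : ∫⁻ y, ENNReal.ofReal ((1 + δ * y) ^ (-m)) ^ 2 ∂halfLine =
      ∫⁻ y in Ioi 0, ENNReal.ofReal ((1 + δ * y) ^ (-(2 * m))) := by
    refine setLIntegral_congr_fun measurableSet_Ioi fun y hy => ?_
    rw [← ENNReal.ofReal_pow (Real.rpow_nonneg (hpos y hy).le _), ← Real.rpow_natCast,
      ← Real.rpow_mul (hpos y hy).le]
    congr 2
    push_cast; ring
  rw [this, ← ofReal_integral_eq_lintegral_ofReal hint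
    ((ae_restrict_iff' measurableSet_Ioi).2 (Eventually.of_forall hnn)), hval]
  simp

section Weighted

variable {K : ℝ → ℂ} {m : ℝ}

theorem enorm_ofReal_rpow_mul {x : ℝ} (hx : 0 < x) (s : ℝ) (z : ℂ) :
    ‖(((1 + x) ^ s : ℝ) : ℂ) * z‖ₑ = ENNReal.ofReal ((1 + x) ^ s) * ‖z‖ₑ := by
  rw [enorm_mul, ← ofReal_norm, Complex.norm_real,
    Real.norm_of_nonneg (Real.rpow_nonneg (by linarith) _)]

/-- Cauchy-Schwarz against (1 + x)^{-m}, which is square integrable because m > 1/2. -/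
theorem lintegral_enorm_lt_top_of_weighted (hm : 1 / 2 < m)
    (hK : MemLp (fun x => (((1 + x) ^ m : ℝ) : ℂ) * K x) 2 halfLine) :
    ∫⁻ x, ‖K x‖ₑ ∂halfLine < ⊤ := by
  have h1 : ∫⁻ x, ‖K x‖ₑ ∂halfLine = ∫⁻ x, ENNReal.ofReal ((1 + 1 * x) ^ (-m)) *
      ‖(((1 + x) ^ m : ℝ) : ℂ) * K x‖ₑ ∂halfLine := by
    refine setLIntegral_congr_fun measurableSet_Ioi fun x hx => ?_
    have hx0 : 0 < 1 + x := by linarith [mem_Ioi.1 hx]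
    rw [enorm_ofReal_rpow_mul hx, one_mul, ← mul_assoc, ← ENNReal.ofReal_mul (by positivity),
      ← Real.rpow_add hx0]
    simp
  have h2 := lintegral_mul_sq_le (μ := halfLine)
    (f := fun x => ENNReal.ofReal ((1 + 1 * x) ^ (-m)))
    (g := fun x => ‖(((1 + x) ^ m : ℝ) : ℂ) * K x‖ₑ)
    (by fun_prop) hK.1.enorm
  rw [lintegral_one_add_mul_rpow hm one_pos, ← h1, ← eLpNorm_two_sq] at h2
  have h3 : (∫⁻ x, ‖K x‖ₑ ∂halfLine) ^ 2 < ⊤ :=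
    h2.trans_lt (ENNReal.mul_lt_top ENNReal.ofReal_lt_top (ENNReal.pow_lt_top hK.2))
  contrapose! h3
  simp [top_le_iff.1 h3]

theorem kernelBound_volterraKernel_zero (hKm : Measurable K) :
    KernelBound halfLine (fun x y => ‖volterraKernel K 0 0 x y‖ₑ) (∫⁻ x, ‖K x‖ₑ ∂halfLine) := by
  have hN : Measurable ((Ioi (0 : ℝ)).indicator fun u => ‖K u‖ₑ) :=
    hKm.enorm.indicator measurableSet_Ioi
  have h := KernelBound.conv hN
  rw [lintegral_indicator measurableSet_Ioi] at h
  refine h.mono (Eventually.of_forall fun x => Eventually.of_forall fun y => ?_)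
  unfold volterraKernel
  split_ifs with hxy
  · simp [indicator_of_mem (show x - y ∈ Ioi (0 : ℝ) from sub_pos.2 hxy)]
  · simp

/-- The pointwise bound on r^s - 1 splits the difference of the kernels in two. The first part is a
convolution with |K(u)| · C min(1, δu), whose L¹ norm tends to 0 with δ by dominated convergence.
The second is N₂(x - y) M(y), with squared Hilbert-Schmidt norm O(δ^{2m} · δ⁻¹), which also tends to
0. The commutator of the slow weight (1 + δx)^s with the convolution is therefore as small as
desired. -/
theorem exists_kernelBound_sub (hm : 1 / 2 < m) (hKm : Measurable K)
    (hK : MemLp (fun x => (((1 + x) ^ m : ℝ) : ℂ) * K x) 2 halfLine) {s : ℝ} (hs : s ≤ m)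
    {η : ℝ} (hη : 0 < η) :
    ∃ δ > 0, δ ≤ 1 ∧ KernelBound halfLine
      (fun x y => ‖volterraKernel K δ s x y - volterraKernel K 0 0 x y‖ₑ)
      (ENNReal.ofReal η) := by
  obtain ⟨C, hC, hlip⟩ := exists_abs_rpow_sub_one_le hs (by linarith : (0 : ℝ) ≤ m)
  set N₁ : ℝ → ℝ → ℝ≥0∞ := fun δ => (Ioi (0 : ℝ)).indicator fun u =>
    ‖K u‖ₑ * ENNReal.ofReal (C * min 1 (δ * u)) with hN₁
  set N₂ : ℝ → ℝ → ℝ≥0∞ := fun δ => (Ioi (0 : ℝ)).indicator fun u =>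
    ‖K u‖ₑ * ENNReal.ofReal (2 ^ m * (δ * u) ^ m) with hN₂
  set M : ℝ → ℝ → ℝ≥0∞ := fun δ y => ENNReal.ofReal ((1 + δ * y) ^ (-m)) with hM
  have mN₁ : ∀ δ, Measurable (N₁ δ) := fun δ =>
    (hKm.enorm.mul (by fun_prop)).indicator measurableSet_Ioi
  have mN₂ : ∀ δ, Measurable (N₂ δ) := fun δ =>
    (hKm.enorm.mul (by fun_prop)).indicator measurableSet_Ioi
  have mM : ∀ δ, Measurable (M δ) := fun δ => by fun_prop
  have hK1 := lintegral_enorm_lt_top_of_weighted hm hK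
  have lim₁ : Tendsto (fun n : ℕ => ∫⁻ u, N₁ (1 / ((n : ℝ) + 1)) u) atTop (𝓝 0) := by
    have := tendsto_lintegral_of_dominated_convergence (μ := halfLine)
      (F := fun (n : ℕ) u => ‖K u‖ₑ * ENNReal.ofReal (C * min 1 (1 / ((n : ℝ) + 1) * u)))
      (f := fun _ => 0) (fun u => ‖K u‖ₑ * ENNReal.ofReal C)
      (fun n => hKm.enorm.mul (by fun_prop))
      (fun n => Eventually.of_forall fun u => by
        simp only
        gcongr
        exact mul_le_of_le_one_right hC.le (min_le_left _ _))
      (by rw [lintegral_mul_const _ hKm.enorm]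
          exact (ENNReal.mul_lt_top hK1 ENNReal.ofReal_lt_top).ne)
      (Eventually.of_forall fun u => by
        have h1 : Tendsto (fun n : ℕ => C * min 1 (1 / ((n : ℝ) + 1) * u)) atTop
            (𝓝 (C * min 1 (0 * u))) :=
          (tendsto_const_nhds.min (tendsto_one_div_add_atTop_nhds_zero_nat.mul_const u)).const_mul C
        have h2 := ENNReal.Tendsto.const_mul (ENNReal.tendsto_ofReal h1)
          (Or.inr (enorm_ne_top (x := K u)))
        simpa using h2)
    simp only [lintegral_zero] at this
    refine this.congr fun n => ?_
    rw [hN₁, lintegral_indicator measurableSet_Ioi]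
  have est₂ : ∀ δ > 0, (∫⁻ u, N₂ δ u ^ 2) * (∫⁻ y, M δ y ^ 2 ∂halfLine) ≤
      ENNReal.ofReal (4 ^ m / (2 * m - 1) * δ ^ (2 * m - 1)) *
        eLpNorm (fun x => (((1 + x) ^ m : ℝ) : ℂ) * K x) 2 halfLine ^ 2 := by
    intro δ hδ
    have h1 : ∫⁻ u, N₂ δ u ^ 2 ≤ ENNReal.ofReal (4 ^ m * δ ^ (2 * m)) *
        eLpNorm (fun x => (((1 + x) ^ m : ℝ) : ℂ) * K x) 2 halfLine ^ 2 := by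
      rw [eLpNorm_two_sq, ← lintegral_const_mul' _ _ ENNReal.ofReal_ne_top]
      have : ∀ u, N₂ δ u ^ 2 = (Ioi (0 : ℝ)).indicator (fun u =>
          (‖K u‖ₑ * ENNReal.ofReal (2 ^ m * (δ * u) ^ m)) ^ 2) u := fun u => by
        by_cases hu : u ∈ Ioi (0 : ℝ)
        · simp only [hN₂, indicator_of_mem hu]
        · simp only [hN₂, indicator_of_notMem hu]; simp
      simp only [this]
      rw [lintegral_indicator measurableSet_Ioi]
      refine setLIntegral_mono_ae' measurableSet_Ioi (Eventually.of_forall fun u hu => ?_)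
      have hu0 : 0 < u := hu
      rw [enorm_ofReal_rpow_mul hu0]
      -- Once the square is taken outside, the comparison reduces to u^m ≤ (1 + u)^m.
      have e1 : ENNReal.ofReal (4 ^ m * δ ^ (2 * m)) = ENNReal.ofReal (2 ^ m * δ ^ m) ^ 2 := by
        rw [← ENNReal.ofReal_pow (by positivity)]
        congr 1
        rw [mul_pow, ← Real.rpow_natCast, ← Real.rpow_natCast, ← Real.rpow_mul (by norm_num),
          ← Real.rpow_mul hδ.le, mul_comm m, Real.rpow_mul (by norm_num : (0 : ℝ) ≤ 2)]
        norm_num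
      rw [e1, ← mul_pow, mul_comm ‖K u‖ₑ, ← mul_assoc, ← ENNReal.ofReal_mul (by positivity)]
      gcongr ?_ ^ 2
      gcongr ?_ * _
      refine ENNReal.ofReal_le_ofReal ?_
      rw [Real.mul_rpow hδ.le hu0.le, ← mul_assoc]
      gcongr
      linarith
    rw [lintegral_one_add_mul_rpow hm hδ]
    refine (mul_le_mul_left h1 _).trans (le_of_eq ?_)
    rw [mul_right_comm, ← ENNReal.ofReal_mul (by positivity)]
    congr 2
    rw [Real.rpow_sub_one hδ.ne']
    field_simp
  have lim₂ : Tendsto (fun n : ℕ => (∫⁻ u, N₂ (1 / ((n : ℝ) + 1)) u ^ 2) *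
      (∫⁻ y, M (1 / ((n : ℝ) + 1)) y ^ 2 ∂halfLine)) atTop (𝓝 0) := by
    refine tendsto_of_tendsto_of_tendsto_of_le_of_le tendsto_const_nhds ?_ (fun _ => zero_le)
      (fun n => est₂ _ (by positivity))
    have h1 : Tendsto (fun n : ℕ => (1 / ((n : ℝ) + 1)) ^ (2 * m - 1)) atTop (𝓝 0) := by
      have := (tendsto_one_div_add_atTop_nhds_zero_nat (𝕜 := ℝ)).rpow_const
        (p := 2 * m - 1) (Or.inr (by linarith))
      rwa [Real.zero_rpow (by linarith)] at this
    have h2 := ENNReal.Tendsto.mul_const (ENNReal.tendsto_ofReal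
      (h1.const_mul (4 ^ m / (2 * m - 1)))) (Or.inr (ENNReal.pow_ne_top (n := 2) hK.2.ne))
    simpa using h2
  have hη2 : 0 < ENNReal.ofReal (η / 2) := ENNReal.ofReal_pos.2 (by linarith)
  obtain ⟨n, hn1, hn2⟩ := ((lim₁.eventually_le_const hη2).and
    (lim₂.eventually_le_const (ENNReal.pow_pos hη2 2))).exists
  set δ : ℝ := 1 / ((n : ℝ) + 1) with hδ
  have hδ0 : 0 < δ := by positivity
  refine ⟨δ, hδ0, ?_, ?_⟩
  · rw [hδ, div_le_one (by positivity)]; linarith [(Nat.cast_nonneg n : (0 : ℝ) ≤ n)]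
  have b1 := KernelBound.conv (mN₁ δ)
  have b2 := KernelBound.conv_mul (mN₂ δ) (mM δ) hn2
  have b := KernelBound.add (a := fun x y => N₁ δ (x - y)) (b := fun x y => N₂ δ (x - y) * M δ y)
    ((mN₁ δ).comp (measurable_fst.sub measurable_snd))
    (((mN₂ δ).comp (measurable_fst.sub measurable_snd)).mul ((mM δ).comp measurable_snd)) b1 b2
  have hle : (∫⁻ u, N₁ δ u) + ENNReal.ofReal (η / 2) ≤ ENNReal.ofReal η := by
    calc _ ≤ ENNReal.ofReal (η / 2) + ENNReal.ofReal (η / 2) := by gcongr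
      _ = _ := by rw [← ENNReal.ofReal_add (by linarith) (by linarith), add_halves]
  refine (b.mono_const hle).mono (Eventually.of_forall fun x => ?_)
  refine (ae_restrict_iff' measurableSet_Ioi).2 (Eventually.of_forall fun y hy => ?_)
  have hy0 : 0 < y := hy
  unfold volterraKernel
  split_ifs with hxy
  · have hu : x - y ∈ Ioi (0 : ℝ) := sub_pos.2 hxy
    have hu0 : 0 < x - y := hu
    simp only [hN₁, hN₂, hM, indicator_of_mem hu]
    have e : K (x - y) * ((((1 + δ * x) / (1 + δ * y)) ^ s : ℝ) : ℂ) -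
        K (x - y) * ((((1 + 0 * x) / (1 + 0 * y)) ^ (0 : ℝ) : ℝ) : ℂ) =
        K (x - y) * ((((1 + δ * x) / (1 + δ * y)) ^ s - 1 : ℝ) : ℂ) := by
      simp [mul_sub]
    rw [e, enorm_mul, mul_assoc, ← mul_add, ← ENNReal.ofReal_mul (by positivity),
      ← ENNReal.ofReal_add (by positivity) (by positivity)]
    gcongr
    rw [← ofReal_norm, Complex.norm_real, Real.norm_eq_abs]
    exact ENNReal.ofReal_le_ofReal (hlip δ hδ0 x y hy0 hxy)
  · simp

end Weighted

/-! ### Solvability and uniqueness for Volterra equations -/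

/-- The function `h` multiplied by the weight `(1 + x) ^ s`. -/
noncomputable abbrev weighted (s : ℝ) (h : ℝ → ℂ) : ℝ → ℂ :=
  fun x => (((1 + x) ^ s : ℝ) : ℂ) * h x

theorem volterraKernel_zero (K : ℝ → ℂ) (x y : ℝ) :
    volterraKernel K 0 0 x y = if y < x then K (x - y) else 0 := by
  simp [volterraKernel]

theorem setIntegral_volterraKernel (K g : ℝ → ℂ) (x : ℝ) :
    ∫ y, volterraKernel K 0 0 x y * g y ∂halfLine = ∫ y in Ioo 0 x, K (x - y) * g y := by
  simp only [volterraKernel_zero, ite_mul, zero_mul]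
  rw [← integral_indicator measurableSet_Ioi, ← integral_indicator measurableSet_Ioo]
  congr 1
  ext y
  by_cases h1 : 0 < y <;> by_cases h2 : y < x <;> simp [indicator, h1, h2]

/-- Extension by zero turns the Volterra operator into a convolution on the whole line, supported
again in the half-line, so that the Fourier transform applies to it. -/
theorem convolution_indicator (K g : ℝ → ℂ) :
    convolution ((Ioi 0).indicator g) ((Ioi 0).indicator K) (ContinuousLinearMap.mul ℂ ℂ) volume =
      (Ioi 0).indicator fun x => ∫ y, volterraKernel K 0 0 x y * g y ∂halfLine := by
  ext x
  rw [convolution_def]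
  simp only [ContinuousLinearMap.mul_apply']
  by_cases hx : x ∈ Ioi (0 : ℝ)
  · rw [indicator_of_mem hx, setIntegral_volterraKernel, ← integral_indicator measurableSet_Ioo]
    congr 1
    ext y
    by_cases h1 : 0 < y <;> by_cases h2 : y < x <;> simp [indicator, h1, h2, mul_comm]
  · rw [indicator_of_notMem hx, ← integral_zero ℝ ℂ (μ := volume)]
    congr 1
    ext y
    by_cases h1 : 0 < y
    · have : ¬ (x - y) ∈ Ioi (0 : ℝ) := by
        simp only [mem_Ioi] at *
        linarith
      rw [indicator_of_notMem this, mul_zero]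
    · rw [indicator_of_notMem (by simpa using h1), zero_mul]

section

variable {K : ℝ → ℂ} {c l : ℝ}

/-- The transform of G - l F * G is (1 - l 𝓕F) 𝓕G, so a pointwise lower bound on the symbol becomes
an L² lower bound by Plancherel. Integrability of g makes all transforms honest integrals. -/
theorem le_eLpNorm_sub_volterra (hKm : Measurable K) (hK : Integrable ((Ioi 0).indicator K))
    (hc : 0 ≤ c) (h : ∀ η : ℝ, c ≤ ‖1 - (l : ℂ) * 𝓕 ((Ioi 0).indicator K) η‖)
    {g : ℝ → ℂ} (hgm : Measurable g) (hg1 : Integrable g halfLine) (hg2 : MemLp g 2 halfLine) :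
    ENNReal.ofReal c * eLpNorm g 2 halfLine ≤
      eLpNorm (fun x => g x - (l : ℂ) * ∫ y, volterraKernel K 0 0 x y * g y ∂halfLine) 2
        halfLine := by
  set F := (Ioi (0 : ℝ)).indicator K with hF
  set G := (Ioi (0 : ℝ)).indicator g with hG
  set W : ℝ → ℂ := fun x => ∫ y, volterraKernel K 0 0 x y * g y ∂halfLine with hW
  have hC : ∫⁻ x, ‖K x‖ₑ ∂halfLine ≠ ⊤ := by
    have := (integrable_indicator_iff measurableSet_Ioi).1 hK
    exact this.2.ne
  have hW2 : MemLp W 2 halfLine := by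
    have h1 := kernelBound_volterraKernel_zero hKm
    refine ⟨?_, (h1.enorm_integral_le hgm).trans_lt (ENNReal.mul_lt_top hC.lt_top hg2.2)⟩
    exact (StronglyMeasurable.integral_prod_right'
      (f := fun p : ℝ × ℝ => volterraKernel K 0 0 p.1 p.2 * g p.2)
      ((measurable_volterraKernel hKm 0 0).mul
        (hgm.comp measurable_snd)).stronglyMeasurable).aestronglyMeasurable
  have hGi : Integrable G := (integrable_indicator_iff measurableSet_Ioi).2 hg1
  have hG2 : MemLp G 2 := (memLp_indicator_iff_restrict measurableSet_Ioi).2 hg2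
  have hconv := convolution_indicator K g
  have hconvi : Integrable (convolution G F (ContinuousLinearMap.mul ℂ ℂ) volume) :=
    hGi.integrable_convolution _ hK
  set v : ℝ → ℂ := fun x => G x - (l : ℂ) *
    convolution G F (ContinuousLinearMap.mul ℂ ℂ) volume x with hv
  have hvi : Integrable v := hGi.sub (hconvi.const_mul _)
  have hv_eq : v = (Ioi (0 : ℝ)).indicator (fun x => g x - (l : ℂ) * W x) := by
    ext x
    rw [hv]
    simp only
    rw [hconv]
    by_cases hx : x ∈ Ioi (0 : ℝ)
    · simp only [hG, indicator_of_mem hx, hW]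
    · simp only [hG, indicator_of_notMem hx, mul_zero, sub_zero]
  have hv2 : MemLp v 2 := by
    rw [hv_eq]
    exact (memLp_indicator_iff_restrict measurableSet_Ioi).2 (hg2.sub (hW2.const_mul _))
  have hFv : ∀ η, 𝓕 v η = (1 - (l : ℂ) * 𝓕 F η) * 𝓕 G η := by
    intro η
    have h1 := Real.fourier_mul_convolution_eq hGi hK η
    have h2 : 𝓕 v η = 𝓕 G η - (l : ℂ) *
        𝓕 (convolution G F (ContinuousLinearMap.mul ℂ ℂ) volume) η := by
      simp only [Real.fourier_eq]
      rw [← integral_const_mul, ← integral_sub]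
      · congr 1
        ext x
        simp only [hv, Circle.smul_def, smul_eq_mul]
        ring
      · exact (Real.fourierIntegral_convergent_iff η).2 hGi
      · exact ((Real.fourierIntegral_convergent_iff η).2 hconvi).const_mul _
    rw [h2, h1]
    ring
  calc ENNReal.ofReal c * eLpNorm g 2 halfLine = ENNReal.ofReal c * eLpNorm (𝓕 G) 2 volume := by
        rw [eLpNorm_fourier hGi hG2, hG, eLpNorm_indicator_eq_eLpNorm_restrict measurableSet_Ioi]
    _ = eLpNorm ((c : ℂ) • 𝓕 G) 2 volume := by
        rw [eLpNorm_const_smul, ← ofReal_norm, Complex.norm_real, Real.norm_of_nonneg hc]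
    _ ≤ eLpNorm (𝓕 v) 2 volume := by
        refine eLpNorm_mono fun η => ?_
        rw [hFv, Pi.smul_apply, norm_smul, norm_mul, Complex.norm_real, Real.norm_of_nonneg hc]
        gcongr
        exact h η
    _ = eLpNorm v 2 volume := eLpNorm_fourier hvi hv2
    _ = _ := by rw [hv_eq, eLpNorm_indicator_eq_eLpNorm_restrict measurableSet_Ioi]

/-- Both sides are continuous on L², so it is enough to treat simple functions, which are also
integrable. -/
theorem le_norm_sub_kernelOp (hKm : Measurable K) (hK : Integrable ((Ioi 0).indicator K))
    (hc : 0 ≤ c) (h : ∀ η : ℝ, c ≤ ‖1 - (l : ℂ) * 𝓕 ((Ioi 0).indicator K) η‖)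
    (hC : ∫⁻ x, ‖K x‖ₑ ∂halfLine ≠ ⊤) (u : Lp ℂ 2 halfLine) :
    c * ‖u‖ ≤ ‖u - (l : ℂ) • kernelOp (volterraKernel K 0 0) _ (measurable_volterraKernel hKm 0 0)
      hC (kernelBound_volterraKernel_zero hKm) u‖ := by
  set A := kernelOp (volterraKernel K 0 0) _ (measurable_volterraKernel hKm 0 0)
      hC (kernelBound_volterraKernel_zero hKm) with hA
  refine DenseRange.induction_on (p := fun u : Lp ℂ 2 halfLine =>
    c * ‖u‖ ≤ ‖u - (l : ℂ) • A u‖)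
    (Lp.simpleFunc.denseRange (E := ℂ) (p := 2) (μ := halfLine) (by norm_num)) u ?_ ?_
  · exact isClosed_le (by fun_prop) (by fun_prop)
  rintro ⟨U, hUs⟩
  have hUm : Measurable U := (Lp.stronglyMeasurable U).measurable
  have hUi : Integrable U halfLine := by
    have h1 := (SimpleFunc.memLp_iff_integrable (μ := halfLine) (p := 2) (by norm_num)
      (by norm_num)).1 (Lp.simpleFunc.memLp ⟨U, hUs⟩)
    exact h1.congr (Lp.simpleFunc.toSimpleFunc_eq_toFun ⟨U, hUs⟩)
  have key := le_eLpNorm_sub_volterra hKm hK hc h hUm hUi (Lp.memLp U)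
  have e : eLpNorm (U - (l : ℂ) • A U : Lp ℂ 2 halfLine) 2 halfLine =
      eLpNorm (fun x => U x - (l : ℂ) * ∫ y, volterraKernel K 0 0 x y * U y ∂halfLine) 2
        halfLine := by
    refine eLpNorm_congr_ae ?_
    filter_upwards [Lp.coeFn_sub U ((l : ℂ) • A U), Lp.coeFn_smul (l : ℂ) (A U),
      kernelOp_coeFn (measurable_volterraKernel hKm 0 0)
      hC (kernelBound_volterraKernel_zero hKm) U] with x h1 h2 h3
    rw [h1, Pi.sub_apply, h2, Pi.smul_apply, h3, smul_eq_mul]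
  rw [← e] at key
  rw [Lp.norm_def, Lp.norm_def, ← ENNReal.toReal_ofReal hc, ← ENNReal.toReal_mul]
  exact ENNReal.toReal_mono (Lp.eLpNorm_ne_top _) key

end

/-- The quotient (1 + x)/(1 + δx) lies between 1 and 1/δ. Replacing one weight by the other
therefore costs only a constant. -/
theorem one_add_rpow_le {δ s x : ℝ} (hδ : 0 < δ) (hδ1 : δ ≤ 1) (hx : 0 < x) :
    (1 + x) ^ s ≤ δ⁻¹ ^ |s| * (1 + δ * x) ^ s ∧ (1 + δ * x) ^ s ≤ δ⁻¹ ^ |s| * (1 + x) ^ s := by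
  have hx1 : 0 < 1 + δ * x := by positivity
  have hx2 : 0 < 1 + x := by positivity
  have h1 : 1 ≤ (1 + x) / (1 + δ * x) := by
    rw [one_le_div hx1]; nlinarith
  have h2 : (1 + x) / (1 + δ * x) ≤ δ⁻¹ := by
    rw [div_le_iff₀ hx1, mul_add, ← mul_assoc, inv_mul_cancel₀ hδ.ne', mul_one, one_mul]
    linarith [(one_le_inv₀ hδ).2 hδ1]
  have h3 : ∀ r : ℝ, r ≤ |s| → ((1 + x) / (1 + δ * x)) ^ r ≤ δ⁻¹ ^ |s| := fun r hr =>
    (Real.rpow_le_rpow_of_exponent_le h1 hr).trans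
      (Real.rpow_le_rpow (by linarith) h2 (abs_nonneg s))
  constructor
  · have := h3 s (le_abs_self s)
    rwa [Real.div_rpow hx2.le hx1.le, div_le_iff₀ (by positivity)] at this
  · have := h3 (-s) (neg_le_abs s)
    rwa [Real.rpow_neg (by positivity), ← Real.inv_rpow (by positivity), inv_div,
      Real.div_rpow hx1.le hx2.le, div_le_iff₀ (by positivity)] at this

/-- Weighted `L²` bounds for the solutions of `e = h + λ K * e` on the half-line, uniform in
`λ ∈ [0, Λ]`. -/
theorem exists_volterra_solution {K : ℝ → ℂ} {m : ℝ} (hm : 1 / 2 < m) (hKm : Measurable K)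
    (hK : MemLp (weighted m K) 2 halfLine) {Λ : ℝ}
    (hne : ∀ l ∈ Icc 0 Λ, ∀ η : ℝ, 1 - (l : ℂ) * 𝓕 ((Ioi 0).indicator K) η ≠ 0)
    {s : ℝ} (hs : s ≤ m) :
    ∃ C : ℝ≥0, ∀ l ∈ Icc 0 Λ, ∀ h : ℝ → ℂ, MemLp (weighted s h) 2 halfLine →
      ∃ e : ℝ → ℂ, Measurable e ∧ MemLp (weighted s e) 2 halfLine ∧
        eLpNorm (weighted s e) 2 halfLine ≤ C * eLpNorm (weighted s h) 2 halfLine ∧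
        (∀ᵐ x ∂halfLine, IntegrableOn (fun y => K (x - y) * e y) (Ioo 0 x)) ∧
        ∀ᵐ x ∂halfLine, e x = h x + (l : ℂ) * ∫ y in Ioo 0 x, K (x - y) * e y := by
  have hK1 := lintegral_enorm_lt_top_of_weighted hm hK
  have hKi : Integrable ((Ioi 0).indicator K) :=
    (integrable_indicator_iff measurableSet_Ioi).2 ⟨hKm.aestronglyMeasurable, hK1⟩
  obtain ⟨c, hc, hcb⟩ := exists_pos_le_norm_one_sub_fourier hKi hne
  -- Since l ≤ |Λ| + 1, a perturbation of norm η consumes at most half of the lower bound c, leaving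
  -- c/2 for the conjugated operator.
  set η : ℝ := c / (2 * (|Λ| + 1)) with hη
  have hη0 : 0 < η := by positivity
  obtain ⟨δ, hδ, hδ1, hdiff⟩ := exists_kernelBound_sub hm hKm hK hs hη0
  have hk0 := measurable_volterraKernel hKm 0 0
  have hk := measurable_volterraKernel hKm δ s
  have hB0 := kernelBound_volterraKernel_zero hKm
  have hB : KernelBound halfLine (fun x y => ‖volterraKernel K δ s x y‖ₑ)
      (ENNReal.ofReal η + ∫⁻ x, ‖K x‖ₑ ∂halfLine) := by
    refine (KernelBound.add (hk.sub hk0).enorm hk0.enorm hdiff hB0).mono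
      (Eventually.of_forall fun x => Eventually.of_forall fun y => ?_)
    calc _ = ‖(volterraKernel K δ s x y - volterraKernel K 0 0 x y) +
        volterraKernel K 0 0 x y‖ₑ := by rw [sub_add_cancel]
      _ ≤ _ := enorm_add_le _ _
  have hCtop : ENNReal.ofReal η + ∫⁻ x, ‖K x‖ₑ ∂halfLine ≠ ⊤ := by
    have := hK1.ne
    finiteness
  set A := kernelOp (volterraKernel K 0 0) _ hk0 hK1.ne hB0 with hA
  set B := kernelOp (volterraKernel K δ s) _ hk hCtop hB with hBdef
  have hlow : ∀ l ∈ Icc 0 Λ, ∀ u : Lp ℂ 2 halfLine, c / 2 * ‖u‖ ≤ ‖u - (l : ℂ) • B u‖ := by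
    intro l hl u
    have h1 : c * ‖u‖ ≤ ‖u - (l : ℂ) • A u‖ :=
      le_norm_sub_kernelOp hKm hKi hc.le (hcb l hl) hK1.ne u
    have h2 : ‖B u - A u‖ ≤ η * ‖u‖ := by
      have := kernelOp_sub hk hCtop hB hk0 hK1.ne hB0 ENNReal.ofReal_ne_top hdiff u
      rwa [ENNReal.toReal_ofReal hη0.le] at this
    have h3 : ‖u - (l : ℂ) • A u‖ ≤ ‖u - (l : ℂ) • B u‖ + l * ‖B u - A u‖ := by
      have e : u - (l : ℂ) • A u = (u - (l : ℂ) • B u) + (l : ℂ) • (B u - A u) := by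
        rw [smul_sub]; abel
      rw [e]
      refine (norm_add_le _ _).trans (le_of_eq ?_)
      rw [norm_smul, Complex.norm_real, Real.norm_of_nonneg hl.1]
    have h4 : l * ‖B u - A u‖ ≤ c / 2 * ‖u‖ := by
      have : l ≤ |Λ| + 1 := hl.2.trans ((le_abs_self Λ).trans (by linarith))
      calc l * ‖B u - A u‖ ≤ (|Λ| + 1) * (η * ‖u‖) := by gcongr
        _ = _ := by rw [hη]; field_simp
    linarith
  have hsurj := surjective_of_bounded_below B (half_pos hc) hlow
  set D : ℝ := δ⁻¹ ^ |s| with hD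
  have hD0 : 0 < D := by positivity
  -- One factor D passes from the weight (1 + x)^s to (1 + δx)^s on the source, the other passes
  -- back on the solution; 2/c is the norm of the inverse.
  refine ⟨⟨D * (2 / c) * D, by positivity⟩, fun l hl h hh => ?_⟩
  set w : ℝ → ℂ := fun x => (((1 + δ * x) ^ s : ℝ) : ℂ) with hw
  have hwm : Measurable w := by fun_prop
  have hwpos : ∀ x, 0 < x → 0 < (1 + δ * x) ^ s := fun x hx => by positivity
  have hw0 : ∀ x, 0 < x → w x ≠ 0 := fun x hx =>
    Complex.ofReal_ne_zero.2 (hwpos x hx).ne'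
  have hwn : ∀ x, 0 < x → ‖w x‖ = (1 + δ * x) ^ s := fun x hx => by
    rw [hw, Complex.norm_real, Real.norm_of_nonneg (hwpos x hx).le]
  have hmem : ∀ᵐ x ∂halfLine, 0 < x := by
    filter_upwards [ae_restrict_mem measurableSet_Ioi] with x hx using hx
  have hhae : AEStronglyMeasurable h halfLine := by
    have : AEStronglyMeasurable (fun x : ℝ => (((1 + x) ^ s : ℝ) : ℂ)⁻¹ * weighted s h x)
        halfLine := by
      have hm1 : Measurable fun x : ℝ => (((1 + x) ^ s : ℝ) : ℂ)⁻¹ := by fun_prop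
      exact hm1.aestronglyMeasurable.mul hh.1
    refine this.congr ?_
    filter_upwards [hmem] with x hx
    rw [inv_mul_cancel_left₀]
    exact Complex.ofReal_ne_zero.2 (by positivity)
  have hwh_le : ∀ᵐ x ∂halfLine, ‖w x * h x‖ ≤ D * ‖weighted s h x‖ := by
    filter_upwards [hmem] with x hx
    rw [norm_mul, norm_mul, hwn x hx, Complex.norm_real, Real.norm_of_nonneg (by positivity),
      ← mul_assoc]
    gcongr
    exact (one_add_rpow_le hδ hδ1 hx).2
  have hwh : MemLp (fun x => w x * h x) 2 halfLine :=
    MemLp.of_le_mul hh (hwm.aestronglyMeasurable.mul hhae) hwh_le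
  obtain ⟨u, hu⟩ := hsurj l hl (hwh.toLp _)
  have hum : Measurable u := (Lp.stronglyMeasurable u).measurable
  have hunorm : eLpNorm u 2 halfLine ≤ ENNReal.ofReal (2 / c) *
      eLpNorm (fun x => w x * h x) 2 halfLine := by
    have h1 := hlow l hl u
    rw [hu, Lp.norm_toLp, Lp.norm_def] at h1
    have h2 : (eLpNorm u 2 halfLine).toReal ≤
        2 / c * (eLpNorm (fun x => w x * h x) 2 halfLine).toReal := by
      rw [div_mul_eq_mul_div, le_div_iff₀ hc]
      linarith
    rw [← ENNReal.ofReal_toReal (Lp.eLpNorm_ne_top u), ← ENNReal.ofReal_toReal hwh.2.ne,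
      ← ENNReal.ofReal_mul (by positivity)]
    exact ENNReal.ofReal_le_ofReal h2
  have huw : ∀ᵐ x ∂halfLine, ‖weighted s (fun x => (w x)⁻¹ * u x) x‖ ≤ D * ‖u x‖ := by
    filter_upwards [hmem] with x hx
    rw [norm_mul, norm_mul, norm_inv, hwn x hx, Complex.norm_real,
      Real.norm_of_nonneg (by positivity), ← mul_assoc]
    gcongr
    rw [← div_eq_mul_inv, div_le_iff₀ (hwpos x hx)]
    exact (one_add_rpow_le hδ hδ1 hx).1
  have hem : Measurable fun x => (w x)⁻¹ * u x := hwm.inv.mul hum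
  have hkern : ∀ᵐ x ∂halfLine, ∀ᵐ y ∂halfLine,
      (w x)⁻¹ * (volterraKernel K δ s x y * u y) =
        volterraKernel K 0 0 x y * ((w y)⁻¹ * u y) := by
    filter_upwards [hmem] with x hx
    filter_upwards [hmem] with y hy
    rw [volterraKernel_zero]
    unfold volterraKernel
    split_ifs with hxy
    · rw [Real.div_rpow (by positivity) (by positivity), Complex.ofReal_div]
      have h1 := hw0 x hx
      have h2 := hw0 y hy
      simp only [hw] at h1 h2 ⊢
      field_simp
    · simp
  refine ⟨fun x => (w x)⁻¹ * u x, hem, ?_, ?_, ?_, ?_⟩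
  · refine MemLp.of_le_mul (Lp.memLp u) ?_ huw
    exact (Measurable.mul (by fun_prop) hem).aestronglyMeasurable
  · calc _ ≤ ENNReal.ofReal D * eLpNorm u 2 halfLine := eLpNorm_le_mul_eLpNorm_of_ae_le_mul huw 2
      _ ≤ ENNReal.ofReal D * (ENNReal.ofReal (2 / c) * (ENNReal.ofReal D *
          eLpNorm (weighted s h) 2 halfLine)) := by
        gcongr
        refine hunorm.trans ?_
        gcongr
        exact eLpNorm_le_mul_eLpNorm_of_ae_le_mul hwh_le 2
      _ = ENNReal.ofReal (D * (2 / c) * D) * eLpNorm (weighted s h) 2 halfLine := by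
        rw [ENNReal.ofReal_mul (by positivity), ENNReal.ofReal_mul (by positivity)]
        ring
      _ = _ := by
        congr 1
        exact (ENNReal.ofReal_eq_coe_nnreal (by positivity))
  · filter_upwards [hkern, hB.ae_integrable hk hCtop hum (Lp.eLpNorm_ne_top u)] with x hx hxi
    have h1 : Integrable (fun y => volterraKernel K 0 0 x y * ((w y)⁻¹ * u y)) halfLine :=
      (hxi.const_mul (w x)⁻¹).congr hx
    have h2 : IntegrableOn (fun y => volterraKernel K 0 0 x y * ((w y)⁻¹ * u y)) (Ioo 0 x) :=
      IntegrableOn.mono_set h1 Ioo_subset_Ioi_self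
    refine h2.congr_fun (fun y hy => ?_) measurableSet_Ioo
    simp [volterraKernel_zero, hy.2]
  · have h1 : (u - (l : ℂ) • B u : Lp ℂ 2 halfLine) =ᵐ[halfLine] fun x => w x * h x := by
      rw [hu]; exact hwh.coeFn_toLp
    filter_upwards [hkern, hmem, h1, Lp.coeFn_sub u ((l : ℂ) • B u),
      Lp.coeFn_smul (l : ℂ) (B u), kernelOp_coeFn hk hCtop hB u] with x hx hx0 e1 e2 e3 e4
    rw [← setIntegral_volterraKernel, ← integral_congr_ae hx, integral_const_mul, ← e4]
    rw [e2, Pi.sub_apply, e3, Pi.smul_apply, smul_eq_mul, sub_eq_iff_eq_add] at e1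
    rw [e1, mul_add, inv_mul_cancel_left₀ (hw0 x hx0)]
    ring

/-- Locally integrable solutions of the homogeneous Volterra inequality vanish. -/
theorem volterra_unique {K w : ℝ → ℂ} (hKm : Measurable K) (hK : ∫⁻ x, ‖K x‖ₑ ∂halfLine < ⊤)
    (hwm : Measurable w) (hw : ∀ A : ℝ, ∫⁻ x in Ioo 0 A, ‖w x‖ₑ < ⊤) {Λ : ℝ≥0∞} (hΛ : Λ ≠ ⊤)
    (h : ∀ᵐ x ∂halfLine, ‖w x‖ₑ ≤ Λ * ∫⁻ y in Ioo 0 x, ‖K (x - y)‖ₑ * ‖w y‖ₑ) :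
    ∀ᵐ x ∂halfLine, w x = 0 := by
  -- An exponential weight e^{-bu} makes the L¹ norm of the kernel as small as needed, so the
  -- Volterra inequality becomes a strict contraction in weighted L¹.
  set k : ℝ → ℝ → ℝ≥0∞ := fun b => (Ioi (0 : ℝ)).indicator
    fun u => ENNReal.ofReal (Real.exp (-b * u)) * ‖K u‖ₑ with hk
  have hkm : ∀ b, Measurable (k b) := fun b =>
    (Measurable.mul (by fun_prop) hKm.enorm).indicator measurableSet_Ioi
  have lim : Tendsto (fun n : ℕ => Λ * ∫⁻ u, k n u) atTop (𝓝 0) := by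
    have := tendsto_lintegral_of_dominated_convergence (μ := halfLine)
      (F := fun (n : ℕ) u => ENNReal.ofReal (Real.exp (-n * u)) * ‖K u‖ₑ)
      (f := fun _ => 0) (fun u => ‖K u‖ₑ)
      (fun n => Measurable.mul (by fun_prop) hKm.enorm)
      (fun n => by
        filter_upwards [ae_restrict_mem measurableSet_Ioi] with u hu
        have hu0 : 0 < u := hu
        refine mul_le_of_le_one_left (by positivity) ?_
        rw [ENNReal.ofReal_le_one, Real.exp_le_one_iff]
        have : (0 : ℝ) ≤ n * u := by positivity
        linarith)
      hK.ne
      (by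
        filter_upwards [ae_restrict_mem measurableSet_Ioi] with u hu
        have h1 : Tendsto (fun n : ℕ => Real.exp (-(n : ℝ) * u)) atTop (𝓝 0) := by
          refine Real.tendsto_exp_atBot.comp ?_
          simp only [neg_mul]
          exact tendsto_neg_atTop_atBot.comp
            (tendsto_natCast_atTop_atTop.atTop_mul_const (mem_Ioi.1 hu))
        have h2 := ENNReal.Tendsto.mul_const (ENNReal.tendsto_ofReal h1)
          (Or.inr (enorm_ne_top (x := K u)))
        simpa using h2)
    simp only [lintegral_zero] at this
    have h2 := ENNReal.Tendsto.const_mul this (Or.inr hΛ)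
    rw [mul_zero] at h2
    refine h2.congr fun n => ?_
    rw [hk, lintegral_indicator measurableSet_Ioi]
  obtain ⟨n, hn⟩ := (lim.eventually_lt_const (zero_lt_one (α := ℝ≥0∞))).exists
  -- Truncation at A keeps the integral finite, and the inequality survives because the Volterra
  -- integral at x < A only involves values before x. Finiteness is what allows a strict factor
  -- below 1 to force the integral to vanish.
  set q : ℝ → ℝ → ℝ≥0∞ := fun A => (Ioo (0 : ℝ) A).indicator
    fun y => ENNReal.ofReal (Real.exp (-n * y)) * ‖w y‖ₑ with hq
  have hqm : ∀ A, Measurable (q A) := fun A =>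
    (Measurable.mul (by fun_prop) hwm.enorm).indicator measurableSet_Ioo
  have hqle : ∀ A, ∀ᵐ x, q A x ≤ Λ * ∫⁻ y, k n (x - y) * q A y := by
    intro A
    filter_upwards [(ae_restrict_iff' measurableSet_Ioi).1 h] with x hx
    by_cases hxA : x ∈ Ioo 0 A
    · rw [hq]
      simp only [indicator_of_mem hxA]
      calc _ ≤ ENNReal.ofReal (Real.exp (-n * x)) *
            (Λ * ∫⁻ y in Ioo 0 x, ‖K (x - y)‖ₑ * ‖w y‖ₑ) := by gcongr; exact hx hxA.1
        _ = Λ * ∫⁻ y in Ioo 0 x, ENNReal.ofReal (Real.exp (-n * x)) *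
            (‖K (x - y)‖ₑ * ‖w y‖ₑ) := by
          rw [lintegral_const_mul' _ _ ENNReal.ofReal_ne_top]; ring
        _ ≤ _ := by
          rw [← lintegral_indicator measurableSet_Ioo]
          gcongr with y
          by_cases hy : y ∈ Ioo 0 x
          · have h1 : x - y ∈ Ioi (0 : ℝ) := sub_pos.2 hy.2
            have h2 : y ∈ Ioo 0 A := ⟨hy.1, hy.2.trans hxA.2⟩
            simp only [hk, indicator_of_mem hy, indicator_of_mem h1, indicator_of_mem h2]
            rw [mul_mul_mul_comm, ← ENNReal.ofReal_mul (by positivity), ← Real.exp_add]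
            refine le_of_eq ?_
            ring_nf
          · rw [indicator_of_notMem hy]
            exact zero_le
    · rw [hq]
      simp only [indicator_of_notMem hxA]
      exact zero_le
  have hqfin : ∀ A, ∫⁻ x, q A x ≠ ⊤ := by
    intro A
    rw [hq, lintegral_indicator measurableSet_Ioo]
    refine ne_top_of_le_ne_top (hw A).ne (setLIntegral_mono_ae' measurableSet_Ioo
      (Eventually.of_forall fun y hy => ?_))
    refine mul_le_of_le_one_left (by positivity) ?_
    rw [ENNReal.ofReal_le_one, Real.exp_le_one_iff]
    have : (0 : ℝ) ≤ n * y := mul_nonneg (Nat.cast_nonneg n) hy.1.le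
    linarith
  have hq0 : ∀ A, ∫⁻ x, q A x = 0 := by
    intro A
    have hm2 : Measurable (Function.uncurry fun x y => k n (x - y) * q A y) :=
      ((hkm n).comp (measurable_fst.sub measurable_snd)).mul ((hqm A).comp measurable_snd)
    have h1 : ∫⁻ x, q A x ≤ (Λ * ∫⁻ u, k n u) * ∫⁻ x, q A x := by
      calc _ ≤ ∫⁻ x, Λ * ∫⁻ y, k n (x - y) * q A y := lintegral_mono_ae (hqle A)
        _ = Λ * ∫⁻ y, ∫⁻ x, k n (x - y) * q A y := by
          rw [lintegral_const_mul' _ _ hΛ, lintegral_lintegral_swap hm2.aemeasurable]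
        _ = Λ * ∫⁻ y, (∫⁻ u, k n u) * q A y := by
          congr 1
          refine lintegral_congr fun y => ?_
          have hky : Measurable fun x => k n (x - y) := (hkm n).comp (measurable_id.sub_const y)
          rw [lintegral_mul_const _ hky, lintegral_sub_right_eq_self (μ := volume) (k n) y]
        _ = _ := by rw [lintegral_const_mul _ (hqm A), mul_assoc]
    by_contra hne
    have h2 : (Λ * ∫⁻ u, k n u) * ∫⁻ x, q A x < 1 * ∫⁻ x, q A x :=
      ENNReal.mul_lt_mul_left hne (hqfin A) hn
    rw [one_mul] at h2
    exact absurd h1 (not_le.2 h2)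
  have hae : ∀ᵐ x, ∀ N : ℕ, q N x = 0 :=
    ae_all_iff.2 fun N => (lintegral_eq_zero_iff (hqm N)).1 (hq0 N)
  refine (ae_restrict_iff' measurableSet_Ioi).2 ?_
  filter_upwards [hae] with x hx hx0
  obtain ⟨N, hN⟩ := exists_nat_gt x
  have h1 := hx N
  have h2 : x ∈ Ioo (0 : ℝ) N := ⟨hx0, hN⟩
  simp only [hq, indicator_of_mem h2, mul_eq_zero, ENNReal.ofReal_eq_zero, enorm_eq_zero] at h1
  rcases h1 with h1 | h1
  · exact absurd h1 (not_le.2 (Real.exp_pos _))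
  · exact h1

/-! ### From weighted L² bounds to pointwise bounds -/

theorem integral_two_mul_eq_sq_sub_sq {f φ : ℝ → ℝ} {a b : ℝ} (hab : a ≤ b)
    (hφ : IntervalIntegrable φ volume a b)
    (hf : ∀ x ∈ Icc a b, f x = f a + ∫ t in a..x, φ t) :
    ∫ x in a..b, 2 * (f x * φ x) = f b ^ 2 - f a ^ 2 := by
  set g : ℝ → ℝ := fun x => ∫ t in a..x, φ t with hg
  have hac : AbsolutelyContinuousOnInterval g a b :=
    hφ.absolutelyContinuousOnInterval_intervalIntegral left_mem_uIcc
  have h1 := hac.integral_deriv_mul_eq_sub hac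
  have hga : g a = 0 := by simp [hg]
  have hder : ∀ᵐ x, x ∈ uIoc a b → deriv g x = φ x := by
    filter_upwards [hφ.ae_hasDerivAt_integral] with x hx hxm
    exact (hx (uIoc_subset_uIcc hxm) a left_mem_uIcc).deriv
  have hgφ : IntervalIntegrable (fun x => g x * φ x) volume a b :=
    hφ.continuousOn_mul hac.continuousOn
  have h2 : ∫ x in a..b, deriv g x * g x + g x * deriv g x = ∫ x in a..b, 2 * (g x * φ x) := by
    refine intervalIntegral.integral_congr_ae ?_
    filter_upwards [hder] with x hx hxm
    rw [hx hxm]; ring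
  have h3 : ∫ x in a..b, 2 * (f x * φ x) =
      ∫ x in a..b, (2 * (g x * φ x) + 2 * f a * φ x) := by
    refine intervalIntegral.integral_congr fun x hx => ?_
    rw [uIcc_of_le hab] at hx
    rw [hf x hx]; ring
  have hgb : f b = f a + g b := hf b ⟨hab, le_rfl⟩
  rw [h3, intervalIntegral.integral_add (hgφ.const_mul 2) (hφ.const_mul _),
    ← h2, h1, intervalIntegral.integral_const_mul, hgb, hga]
  change g b * g b - 0 * 0 + 2 * f a * g b = _
  ring

/-- Real and imaginary parts are absolutely continuous, so (|u|²)' = 2 Re(u d̄), which is bounded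
below by -2|u||d|. -/
theorem norm_sq_le_add_integral {u d : ℝ → ℂ} {a b : ℝ} (hab : a ≤ b)
    (hd : IntervalIntegrable d volume a b)
    (hu : ∀ x ∈ Icc a b, u x = u a + ∫ t in a..x, d t) :
    ‖u a‖ₑ ^ 2 ≤ ‖u b‖ₑ ^ 2 + 2 * ∫⁻ x in Ioc a b, ‖u x‖ₑ * ‖d x‖ₑ := by
  have hdx : ∀ x ∈ Icc a b, IntervalIntegrable d volume a x := fun x hx =>
    hd.mono_set (by rw [uIcc_of_le hab, uIcc_of_le hx.1]; exact Icc_subset_Icc_right hx.2)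
  have hcont : ContinuousOn u (Icc a b) := by
    have h1 : ContinuousOn (fun x => u a + ∫ t in a..x, d t) (Icc a b) := by
      refine continuousOn_const.add ?_
      have := intervalIntegral.continuousOn_primitive_interval (μ := volume) (f := d) (a := a)
        (b := b) ((intervalIntegrable_iff_integrableOn_Icc_of_le hab).1 hd |>.mono_set
          (by rw [uIcc_of_le hab]))
      rwa [uIcc_of_le hab] at this
    exact h1.congr hu
  have hre : IntervalIntegrable (fun x => (d x).re) volume a b :=
    ⟨hd.1.re, hd.2.re⟩
  have him : IntervalIntegrable (fun x => (d x).im) volume a b :=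
    ⟨hd.1.im, hd.2.im⟩
  have e1 := integral_two_mul_eq_sq_sub_sq (f := fun x => (u x).re) hab hre fun x hx => by
    rw [hu x hx, Complex.add_re]
    congr 1
    rw [← Complex.reCLM_apply, ← Complex.reCLM.intervalIntegral_comp_comm (hdx x hx)]
    rfl
  have e2 := integral_two_mul_eq_sq_sub_sq (f := fun x => (u x).im) hab him fun x hx => by
    rw [hu x hx, Complex.add_im]
    congr 1
    rw [← Complex.imCLM_apply, ← Complex.imCLM.intervalIntegral_comp_comm (hdx x hx)]
    rfl
  have hcont' : ContinuousOn u (uIcc a b) := by rwa [uIcc_of_le hab]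
  have i1 : IntervalIntegrable (fun x => 2 * ((u x).re * (d x).re)) volume a b :=
    (hre.continuousOn_mul (Complex.continuous_re.comp_continuousOn hcont')).const_mul 2
  have i2 : IntervalIntegrable (fun x => 2 * ((u x).im * (d x).im)) volume a b :=
    (him.continuousOn_mul (Complex.continuous_im.comp_continuousOn hcont')).const_mul 2
  have i3 : IntervalIntegrable (fun x => 2 * (‖u x‖ * ‖d x‖)) volume a b :=
    (hd.norm.continuousOn_mul hcont'.norm).const_mul 2
  have e3 : ‖u a‖ ^ 2 ≤ ‖u b‖ ^ 2 + ∫ x in a..b, 2 * (‖u x‖ * ‖d x‖) := by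
    have h1 : -∫ x in a..b, 2 * (‖u x‖ * ‖d x‖) ≤
        ∫ x in a..b, (2 * ((u x).re * (d x).re) + 2 * ((u x).im * (d x).im)) := by
      rw [← intervalIntegral.integral_neg]
      refine intervalIntegral.integral_mono_on hab i3.neg (i1.add i2) fun x _ => ?_
      have h2 := abs_le.1 (Complex.abs_re_le_norm (u x * (starRingEnd ℂ) (d x)))
      rw [norm_mul, RCLike.norm_conj, Complex.mul_re, Complex.conj_re, Complex.conj_im] at h2
      linarith [h2.1]
    rw [intervalIntegral.integral_add i1 i2, e1, e2] at h1
    rw [← Complex.normSq_eq_norm_sq, ← Complex.normSq_eq_norm_sq, Complex.normSq_apply,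
      Complex.normSq_apply]
    linarith
  have e4 : ENNReal.ofReal (∫ x in a..b, 2 * (‖u x‖ * ‖d x‖)) =
      2 * ∫⁻ x in Ioc a b, ‖u x‖ₑ * ‖d x‖ₑ := by
    rw [intervalIntegral.integral_of_le hab, ofReal_integral_eq_lintegral_ofReal
      ((intervalIntegrable_iff_integrableOn_Ioc_of_le hab).1 i3)
      (Eventually.of_forall fun x => by positivity), ← lintegral_const_mul' _ _ (by norm_num)]
    refine lintegral_congr fun x => ?_
    rw [ENNReal.ofReal_mul (by norm_num), ENNReal.ofReal_mul (by positivity), ofReal_norm,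
      ofReal_norm, ENNReal.ofReal_ofNat]
  rw [← e4, ← ofReal_norm, ← ofReal_norm, ← ENNReal.ofReal_pow (norm_nonneg _),
    ← ENNReal.ofReal_pow (norm_nonneg _), ← ENNReal.ofReal_add (by positivity)]
  · exact ENNReal.ofReal_le_ofReal e3
  · exact intervalIntegral.integral_nonneg hab fun x _ => by positivity

/-- If the bound failed at y, then |u|² would stay above some ε > 0 on [y, ∞). The weighted square
would then be at least ε(1 + x)^{2r} ≥ ε/(1 + x), which is not integrable. The threshold r = -1/2 is
the last exponent for which this works. -/
theorem enorm_sq_le_lintegral {u d : ℝ → ℂ} {r : ℝ} (hr : -(1 / 2) ≤ r)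
    (hd : ∀ a b : ℝ, 0 ≤ a → a ≤ b → IntervalIntegrable d volume a b)
    (hu : ∀ a b : ℝ, 0 ≤ a → a ≤ b → u b = u a + ∫ t in a..b, d t)
    (hur : MemLp (weighted r u) 2 halfLine) {y : ℝ} (hy : 0 ≤ y) :
    ‖u y‖ₑ ^ 2 ≤ 2 * ∫⁻ x in Ioi y, ‖u x‖ₑ * ‖d x‖ₑ := by
  by_contra! hcon
  obtain ⟨R, hR⟩ : ∃ R, R = 2 * ∫⁻ x in Ioi y, ‖u x‖ₑ * ‖d x‖ₑ := ⟨_, rfl⟩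
  rw [← hR] at hcon
  have hstep : ∀ z, y ≤ z → ‖u y‖ₑ ^ 2 ≤ ‖u z‖ₑ ^ 2 + R := by
    intro z hz
    refine (norm_sq_le_add_integral hz (hd y z hy hz) fun x hx => hu y x hy hx.1).trans ?_
    rw [hR]
    gcongr
    exact Ioc_subset_Ioi_self
  obtain ⟨ε, hε, hεz⟩ : ∃ ε : ℝ, 0 < ε ∧ ∀ z, y ≤ z → ε ≤ ‖u z‖ ^ 2 := by
    have hRtop : R ≠ ⊤ := ne_top_of_lt hcon
    refine ⟨‖u y‖ ^ 2 - R.toReal, ?_, fun z hz => ?_⟩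
    · rw [sub_pos, ← toReal_enorm, ← ENNReal.toReal_pow]
      exact (ENNReal.toReal_lt_toReal hRtop (by finiteness)).2 hcon
    · have := ENNReal.toReal_mono (by finiteness) (hstep z hz)
      rw [ENNReal.toReal_add (by finiteness) hRtop, ENNReal.toReal_pow, ENNReal.toReal_pow,
        toReal_enorm, toReal_enorm] at this
      linarith
  have hint : IntegrableOn (fun x => ‖weighted r u x‖ ^ 2) (Ioi (max y 1)) := by
    have h1 : Integrable (fun x => ‖weighted r u x‖ ^ 2) halfLine := hur.integrable_norm_pow two_ne_zero
    exact IntegrableOn.mono_set h1 (Ioi_subset_Ioi (hy.trans (le_max_left _ _)))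
  refine not_integrableOn_Ioi_inv (a := max y 1) ?_
  refine Integrable.mono' (hint.const_mul (2 / ε)) (by fun_prop) ?_
  filter_upwards [ae_restrict_mem measurableSet_Ioi] with x hx
  have hx1 : 1 < x := (le_max_right _ _).trans_lt hx
  have hxy : y ≤ x := ((le_max_left _ _).trans_lt hx).le
  have hx2 : 0 < 1 + x := by linarith
  rw [norm_inv, Real.norm_of_nonneg (by linarith), norm_mul, Complex.norm_real,
    Real.norm_of_nonneg (by positivity), mul_pow, ← Real.rpow_natCast, ← Real.rpow_mul hx2.le]
  have h1 : (1 + x)⁻¹ ≤ (1 + x) ^ (r * (2 : ℕ)) := by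
    rw [← Real.rpow_neg_one]
    exact Real.rpow_le_rpow_of_exponent_le (by linarith) (by push_cast; linarith)
  have h2 := hεz x hxy
  calc x⁻¹ ≤ 2 * (1 + x)⁻¹ := by
        rw [← div_eq_mul_inv, inv_eq_one_div, div_le_div_iff₀ (by linarith) hx2]; linarith
    _ = 2 / ε * ((1 + x)⁻¹ * ε) := by field_simp
    _ ≤ _ := by gcongr

/-- On (y, ∞) the weight (1 + x)^{r+r'} is at least its value at y, so it can be taken out before
Cauchy-Schwarz. The norm of u is kept on the tail only, since it must supply the little-o. -/
theorem lintegral_mul_le_weighted {u d : ℝ → ℂ} {r r' : ℝ} (hrr : 0 ≤ r + r')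
    (hu : MemLp (weighted r u) 2 halfLine) (hd : MemLp (weighted r' d) 2 halfLine) {y : ℝ}
    (hy : 0 ≤ y) :
    ∫⁻ x in Ioi y, ‖u x‖ₑ * ‖d x‖ₑ ≤ ENNReal.ofReal ((1 + y) ^ (-(r + r'))) *
      (eLpNorm (weighted r u) 2 (volume.restrict (Ioi y)) *
        eLpNorm (weighted r' d) 2 halfLine) := by
  have hsub : volume.restrict (Ioi y) ≤ halfLine := Measure.restrict_mono (Ioi_subset_Ioi hy) le_rfl
  have h1 : ∫⁻ x in Ioi y, ‖weighted r u x‖ₑ * ‖weighted r' d x‖ₑ ≤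
      eLpNorm (weighted r u) 2 (volume.restrict (Ioi y)) *
        eLpNorm (weighted r' d) 2 halfLine := by
    have h2 := lintegral_mul_sq_le (hu.1.enorm.mono_measure hsub) (hd.1.enorm.mono_measure hsub)
    rw [← eLpNorm_two_sq, ← eLpNorm_two_sq, ← mul_pow] at h2
    refine ((ENNReal.pow_right_strictMono two_ne_zero).le_iff_le.1 h2).trans ?_
    gcongr
  refine le_trans ?_ (mul_le_mul_right h1 _)
  rw [← lintegral_const_mul' _ _ ENNReal.ofReal_ne_top]
  refine setLIntegral_mono_ae' measurableSet_Ioi (Eventually.of_forall fun x hx => ?_)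
  have hx0 : 0 < x := hy.trans_lt hx
  have hx1 : 0 < 1 + x := by linarith
  rw [enorm_ofReal_rpow_mul hx0, enorm_ofReal_rpow_mul hx0, mul_mul_mul_comm,
    ← ENNReal.ofReal_mul (by positivity), ← Real.rpow_add hx1, ← mul_assoc,
    ← ENNReal.ofReal_mul (by positivity)]
  refine le_mul_of_one_le_left (by positivity) ?_
  rw [ENNReal.one_le_ofReal, Real.rpow_neg (by linarith), ← div_eq_inv_mul,
    one_le_div (by positivity)]
  exact Real.rpow_le_rpow (by linarith) (by linarith [mem_Ioi.1 hx]) hrr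

theorem tendsto_eLpNorm_tail {u : ℝ → ℂ} (hu : MemLp u 2 halfLine) :
    Tendsto (fun y => eLpNorm u 2 (volume.restrict (Ioi y))) atTop (𝓝 0) := by
  have h1 : Tendsto (fun y : ℝ => ∫⁻ x, (Ioi y).indicator (fun x => ‖u x‖ₑ ^ 2) x ∂halfLine)
      atTop (𝓝 (∫⁻ _, 0 ∂halfLine)) := by
    refine tendsto_lintegral_filter_of_dominated_convergence' (fun x => ‖u x‖ₑ ^ 2)
      (Eventually.of_forall fun y => (hu.1.enorm.pow_const 2).indicator measurableSet_Ioi)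
      (Eventually.of_forall fun y => Eventually.of_forall fun x => indicator_le_self _ _ x) ?_
      (Eventually.of_forall fun x => ?_)
    · rw [← eLpNorm_two_sq]; exact ENNReal.pow_ne_top hu.2.ne
    · refine tendsto_const_nhds.congr' ?_
      filter_upwards [eventually_ge_atTop x] with y hy
      rw [indicator_of_notMem]
      simpa using hy
  rw [lintegral_zero] at h1
  have h2 : Tendsto (fun y : ℝ => eLpNorm u 2 (volume.restrict (Ioi y)) ^ 2) atTop (𝓝 0) := by
    refine h1.congr' ?_
    filter_upwards [eventually_ge_atTop 0] with y hy
    rw [eLpNorm_two_sq, lintegral_indicator measurableSet_Ioi,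
      Measure.restrict_restrict measurableSet_Ioi,
      inter_eq_self_of_subset_left (Ioi_subset_Ioi hy)]
  have h3 := (ENNReal.continuous_rpow_const (y := 1 / 2)).tendsto 0 |>.comp h2
  rw [ENNReal.zero_rpow_of_pos (by norm_num)] at h3
  refine h3.congr fun y => ?_
  simp only [Function.comp]
  rw [← ENNReal.rpow_natCast, ← ENNReal.rpow_mul]
  simp

theorem integrableOn_of_weighted {u : ℝ → ℂ} {r : ℝ} (hu : MemLp (weighted r u) 2 halfLine)
    (A : ℝ) : IntegrableOn u (Ioc 0 A) := by
  have hle : volume.restrict (Ioc 0 A) ≤ halfLine :=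
    Measure.restrict_mono Ioc_subset_Ioi_self le_rfl
  have h1 : Integrable (weighted r u) (volume.restrict (Ioc 0 A)) :=
    (hu.mono_measure hle).integrable (by norm_num)
  have hm : Measurable fun x : ℝ => (((1 + x) ^ (-r) : ℝ) : ℂ) := by fun_prop
  have h2 : Integrable (fun x => (((1 + x) ^ (-r) : ℝ) : ℂ) * weighted r u x)
      (volume.restrict (Ioc 0 A)) := by
    refine Integrable.bdd_mul (c := (1 + |A|) ^ |r|) h1 hm.aestronglyMeasurable ?_
    filter_upwards [ae_restrict_mem measurableSet_Ioc] with x hx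
    have hx0 : 0 < x := hx.1
    rw [Complex.norm_real, Real.norm_of_nonneg (by positivity)]
    calc (1 + x) ^ (-r) ≤ (1 + x) ^ |r| :=
          Real.rpow_le_rpow_of_exponent_le (by linarith) (neg_le_abs r)
      _ ≤ _ := Real.rpow_le_rpow (by linarith) (by linarith [hx.2, le_abs_self A])
          (abs_nonneg r)
  refine h2.congr ?_
  filter_upwards [ae_restrict_mem measurableSet_Ioc] with x hx
  have hx0 : 0 < 1 + x := by linarith [hx.1]
  rw [← mul_assoc, ← Complex.ofReal_mul, ← Real.rpow_add hx0]
  simp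

/-! ### Decay of Volterra solutions with differentiable source -/

theorem volterra_eq {K e₁ e₂ h : ℝ → ℂ} {l : ℂ} (hKm : Measurable K)
    (hK : ∫⁻ x, ‖K x‖ₑ ∂halfLine < ⊤) (h₁m : Measurable e₁) (h₂m : Measurable e₂)
    (h₁ : ∀ A : ℝ, IntegrableOn e₁ (Ioc 0 A)) (h₂ : ∀ A : ℝ, IntegrableOn e₂ (Ioc 0 A))
    (i₁ : ∀ᵐ x ∂halfLine, IntegrableOn (fun y => K (x - y) * e₁ y) (Ioo 0 x))
    (i₂ : ∀ᵐ x ∂halfLine, IntegrableOn (fun y => K (x - y) * e₂ y) (Ioo 0 x))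
    (q₁ : ∀ᵐ x ∂halfLine, e₁ x = h x + l * ∫ y in Ioo 0 x, K (x - y) * e₁ y)
    (q₂ : ∀ᵐ x ∂halfLine, e₂ x = h x + l * ∫ y in Ioo 0 x, K (x - y) * e₂ y) :
    ∀ᵐ x ∂halfLine, e₁ x = e₂ x := by
  have := volterra_unique (w := fun x => e₁ x - e₂ x) (Λ := ‖l‖ₑ) hKm hK (h₁m.sub h₂m)
    (fun A => ?_) (by finiteness) ?_
  · filter_upwards [this] with x hx using sub_eq_zero.1 hx
  · have h3 : IntegrableOn (fun x => e₁ x - e₂ x) (Ioo 0 A) :=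
      ((h₁ A).sub (h₂ A)).mono_set Ioo_subset_Ioc_self
    exact h3.2
  · filter_upwards [i₁, i₂, q₁, q₂] with x a₁ a₂ b₁ b₂
    have e : e₁ x - e₂ x = l * ∫ y in Ioo 0 x, K (x - y) * (e₁ y - e₂ y) := by
      simp only [mul_sub]
      rw [integral_sub a₁ a₂, b₁, b₂]
      ring
    rw [e, enorm_mul]
    gcongr
    refine (enorm_integral_le_lintegral_enorm _).trans (le_of_eq ?_)
    simp [enorm_mul]

theorem integrableOn_comp_sub_mul {K e : ℝ → ℂ} (hK : Integrable ((Ioi 0).indicator K))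
    (he : Continuous e) (x : ℝ) : IntegrableOn (fun y => K (x - y) * e y) (Ioo 0 x) := by
  obtain ⟨C, hC⟩ := (isCompact_Icc (a := 0) (b := x)).exists_bound_of_continuousOn he.continuousOn
  have h1 : Integrable (fun y => (Ioi 0).indicator K (x - y)) := hK.comp_sub_left x
  have h2 : IntegrableOn (fun y => K (x - y)) (Ioo 0 x) := by
    refine h1.integrableOn.congr_fun (fun y hy => ?_) measurableSet_Ioo
    simp [indicator, hy.2]
  refine Integrable.mul_bdd (c := C) h2 he.aestronglyMeasurable ?_
  filter_upwards [ae_restrict_mem measurableSet_Ioo] with y hy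
  exact hC y (Ioo_subset_Icc_self hy)

/-- Convolution with `K` commutes with taking primitives. -/
theorem integral_volterra_primitive {K d : ℝ → ℂ} (hK : Integrable ((Ioi 0).indicator K))
    {y : ℝ} (hd : IntegrableOn d (Ioo 0 y)) :
    ∫ x in Ioo 0 y, ∫ z in Ioo 0 x, K (x - z) * d z =
      ∫ x in Ioo 0 y, K (y - x) * ∫ z in Ioo 0 x, d z := by
  set D : ℝ → ℂ := (Ioo 0 y).indicator d with hD
  set k : ℝ → ℂ := (Ioi 0).indicator K with hk
  have hDi : Integrable D := (integrable_indicator_iff measurableSet_Ioo).2 hd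
  have i1 : Integrable (fun p : ℝ × ℝ => (Iio y).indicator (fun _ => (1 : ℂ)) p.1 *
      (k (p.1 - p.2) * D p.2)) (volume.prod volume) := by
    have h1 := hDi.convolution_integrand (ContinuousLinearMap.mul ℂ ℂ) hK
    have h2 : Integrable (fun p : ℝ × ℝ => k (p.1 - p.2) * D p.2) (volume.prod volume) := by
      refine h1.congr (Eventually.of_forall fun p => ?_)
      simp [mul_comm, hk]
    refine Integrable.bdd_mul (c := 1) h2 ?_ (Eventually.of_forall fun p => ?_)
    · exact ((measurable_const.indicator measurableSet_Iio).comp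
        measurable_fst).aestronglyMeasurable
    · by_cases hp : p.1 ∈ Iio y
      · simp [indicator_of_mem hp]
      · simp [indicator_of_notMem hp]
  have i2 : Integrable (fun p : ℝ × ℝ => {p : ℝ × ℝ | p.2 < p.1}.indicator (fun _ => (1 : ℂ)) p *
      (k (y - p.1) * D p.2)) (volume.prod volume) := by
    have h2 : Integrable (fun p : ℝ × ℝ => k (y - p.1) * D p.2) (volume.prod volume) :=
      (hK.comp_sub_left y).mul_prod hDi
    have hms : MeasurableSet {p : ℝ × ℝ | p.2 < p.1} := measurableSet_lt measurable_snd measurable_fst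
    refine Integrable.bdd_mul (c := 1) h2 ?_ (Eventually.of_forall fun p => ?_)
    · exact (measurable_const.indicator hms).aestronglyMeasurable
    · by_cases hp : p ∈ {p : ℝ × ℝ | p.2 < p.1}
      · simp [indicator_of_mem hp]
      · simp [indicator_of_notMem hp]
  have l1 : ∫ x in Ioo 0 y, ∫ z in Ioo 0 x, K (x - z) * d z =
      ∫ x, ∫ z, (Iio y).indicator (fun _ => (1 : ℂ)) x * (k (x - z) * D z) := by
    rw [← integral_indicator measurableSet_Ioo]
    congr 1
    ext x
    by_cases hx : x ∈ Ioo 0 y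
    · rw [indicator_of_mem hx, ← integral_indicator measurableSet_Ioo]
      congr 1
      ext z
      have hx2 := hx.2
      by_cases h1 : 0 < z <;> by_cases h2 : z < x
      · simp [indicator, hk, hD, h1, h2, hx.2, h2.trans hx.2]
      · simp [indicator, hk, h2]
      · simp [indicator, hD, h1]
      · simp [indicator, hD, h1]
    · rw [indicator_of_notMem hx, ← integral_zero ℝ ℂ (μ := volume)]
      congr 1
      ext z
      by_cases h1 : x < y
      · have h0 : x ≤ 0 := by
          by_contra! h0
          exact hx ⟨h0, h1⟩
        by_cases h2 : 0 < z
        · have : ¬ (z < x) := by linarith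
          simp [hk, indicator, this]
        · simp [hD, indicator, h2]
      · simp [indicator, h1]
  have l2 : ∫ x in Ioo 0 y, K (y - x) * ∫ z in Ioo 0 x, d z =
      ∫ x, ∫ z, {p : ℝ × ℝ | p.2 < p.1}.indicator (fun _ => (1 : ℂ)) (x, z) *
        (k (y - x) * D z) := by
    rw [← integral_indicator measurableSet_Ioo]
    congr 1
    ext x
    by_cases hx : x ∈ Ioo 0 y
    · rw [indicator_of_mem hx, ← integral_indicator measurableSet_Ioo, ← integral_const_mul]
      congr 1
      ext z
      have hx2 := hx.2
      by_cases h1 : 0 < z <;> by_cases h2 : z < x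
      · simp [indicator, hk, hD, h1, h2, hx.2, h2.trans hx.2]
      · simp [indicator, h2]
      · simp [indicator, hD, h1]
      · simp [indicator, hD, h1]
    · rw [indicator_of_notMem hx, ← integral_zero ℝ ℂ (μ := volume)]
      congr 1
      ext z
      by_cases h1 : x < y
      · have h0 : x ≤ 0 := by
          by_contra! h0
          exact hx ⟨h0, h1⟩
        by_cases h2 : 0 < z
        · have : ¬ (z < x) := by linarith
          simp [indicator, this]
        · simp [hD, indicator, h2]
      · simp [indicator, hk, h1]
  rw [l1, l2]
  refine (integral_integral_swap i1).trans (Eq.trans ?_ (integral_integral_swap i2).symm)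
  congr 1
  ext z
  -- The reflection x ↦ y + z - x exchanges x - z with y - x, and the constraint x < y with z < x.
  rw [← integral_sub_left_eq_self _ volume (y + z)]
  congr 1
  ext x
  have e1 : y + z - x - z = y - x := by ring
  rw [e1]
  congr 1
  by_cases h1 : z < x
  · simp [indicator, h1]
    linarith
  · simp [indicator, h1]
    linarith

/-- Decay of the solutions of `e = G + λ K * e` on the half-line. -/
theorem exists_decay_bound {K : ℝ → ℂ} {m : ℝ} (hm : 1 / 2 < m) (hKm : Measurable K)
    (hK : MemLp (weighted m K) 2 halfLine) {Λ : ℝ}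
    (hne : ∀ l ∈ Icc 0 Λ, ∀ η : ℝ, 1 - (l : ℂ) * 𝓕 ((Ioi 0).indicator K) η ≠ 0)
    {r r' : ℝ} (hr : -(1 / 2) ≤ r) (hrm : r ≤ m) (hrm' : r' ≤ m) (hrr : 0 ≤ r + r') :
    ∃ C : ℝ≥0, ∀ l ∈ Icc 0 Λ, ∀ G H e : ℝ → ℂ,
      (∀ a b : ℝ, 0 ≤ a → a ≤ b → G b = G a + ∫ t in a..b, H t) →
      MemLp (weighted r G) 2 halfLine → MemLp (weighted r' H) 2 halfLine → Continuous e →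
      (∀ x, 0 ≤ x → e x = G x + (l : ℂ) * ∫ y in Ioo 0 x, K (x - y) * e y) →
      ∃ τ : ℝ → ℝ≥0∞, Tendsto τ atTop (𝓝 0) ∧
        (∀ y, 0 ≤ y → τ y ≤ C * eLpNorm (weighted r G) 2 halfLine) ∧
        ∀ y, 0 ≤ y → ‖e y‖ₑ ^ 2 ≤ C * τ y *
          (ENNReal.ofReal ((1 + y) ^ (-(r + r'))) * eLpNorm (weighted r' H) 2 halfLine +
           ENNReal.ofReal l * ENNReal.ofReal ((1 + y) ^ (-(r + m))) *
            (eLpNorm (weighted r G) 2 halfLine * eLpNorm (weighted r' H) 2 halfLine) ^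
              (1 / 2 : ℝ)) := by
  have hK1 := lintegral_enorm_lt_top_of_weighted hm hK
  have hKi : Integrable ((Ioi 0).indicator K) :=
    (integrable_indicator_iff measurableSet_Ioi).2 ⟨hKm.aestronglyMeasurable, hK1⟩
  obtain ⟨C₁, H₁⟩ := exists_volterra_solution hm hKm hK hne hrm
  obtain ⟨C₂, H₂⟩ := exists_volterra_solution hm hKm hK hne hrm'
  obtain ⟨C₃, H₃⟩ := exists_volterra_solution hm hKm hK hne (le_refl m)
  have hKn : eLpNorm (weighted m K) 2 halfLine ≠ ⊤ := hK.2.ne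
  set kn : ℝ≥0 := (eLpNorm (weighted m K) 2 halfLine).toNNReal with hkn
  have hkn' : eLpNorm (weighted m K) 2 halfLine = kn := (ENNReal.coe_toNNReal hKn).symm
  -- `C₁` bounds the weighted norm of e, hence its tail. The factor 2 comes from |e|² ≤ 2∫|e||e'|,
  -- and the remaining factor 2 in 4 from the bound on G(0).
  refine ⟨C₁ + 2 * C₂ + 4 * (C₃ * kn), fun l hl G H e hG hGr hHr he heq => ?_⟩
  obtain ⟨e', e'm, e'mem, e'le, e'i, e'q⟩ := H₁ l hl G hGr
  have hcomp : ∀ {w : ℝ → ℂ}, Continuous w → ∀ x : ℝ,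
      IntegrableOn (fun y => K (x - y) * w y) (Ioo 0 x) :=
    fun hw x => integrableOn_comp_sub_mul hKi hw x
  have hee : weighted r e =ᵐ[halfLine] weighted r e' := by
    have := volterra_eq (h := G) (l := l) hKm hK1 he.measurable e'm
      (fun A => he.locallyIntegrable.integrableOn_isCompact isCompact_Icc
        |>.mono_set Ioc_subset_Icc_self) (integrableOn_of_weighted e'mem)
      (Eventually.of_forall (hcomp he)) e'i
      ((ae_restrict_iff' measurableSet_Ioi).2
        (Eventually.of_forall fun x hx => heq x (mem_Ioi.1 hx).le)) e'q
    filter_upwards [this] with x hx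
    rw [weighted, hx]
  have hemem : MemLp (weighted r e) 2 halfLine := (memLp_congr_ae hee).2 e'mem
  have hele : eLpNorm (weighted r e) 2 halfLine ≤ C₁ * eLpNorm (weighted r G) 2 halfLine := by
    rw [eLpNorm_congr_ae hee]; exact e'le
  -- Differentiating the equation gives the source H + l G(0) K, the last term being the boundary
  -- contribution at 0. Each piece is solved in the weight natural to it, and the derivative
  -- candidate is assembled by linearity. No differentiability of e is assumed; it is recovered from
  -- uniqueness.
  obtain ⟨d₁, d₁m, d₁mem, d₁le, d₁i, d₁q⟩ := H₂ l hl H hHr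
  obtain ⟨R, Rm, Rmem, Rle, Ri, Rq⟩ := H₃ l hl K hK
  set q : ℂ := (l : ℂ) * G 0 with hq
  set d₂ : ℝ → ℂ := fun x => q * R x with hd₂
  set d : ℝ → ℂ := fun x => d₁ x + d₂ x with hd
  have hw₂ : weighted m d₂ = q • weighted m R := by
    ext x
    simp only [weighted, hd₂, Pi.smul_apply, smul_eq_mul]
    ring
  have d₂mem : MemLp (weighted m d₂) 2 halfLine := by
    rw [hw₂]; exact Rmem.const_smul q
  have d₂le : eLpNorm (weighted m d₂) 2 halfLine ≤
      ENNReal.ofReal l * ‖G 0‖ₑ * (C₃ * kn) := by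
    rw [hw₂, eLpNorm_const_smul, hq, enorm_mul, ← hkn', ← ofReal_norm (l : ℂ), Complex.norm_real,
      Real.norm_of_nonneg hl.1]
    gcongr
  have hdi : ∀ A, IntegrableOn d (Ioc 0 A) := fun A =>
    (integrableOn_of_weighted d₁mem A).add (integrableOn_of_weighted d₂mem A)
  have hdeq : ∀ᵐ x ∂halfLine, d x = H x + q * K x + (l : ℂ) * ∫ y in Ioo 0 x, K (x - y) * d y := by
    filter_upwards [d₁i, Ri, d₁q, Rq] with x a₁ a₂ b₁ b₂
    have e1 : ∀ y, K (x - y) * d y = K (x - y) * d₁ y + q * (K (x - y) * R y) := fun y => by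
      simp only [hd, hd₂]; ring
    simp only [e1]
    rw [integral_add a₁ (a₂.const_mul q), integral_const_mul]
    simp only [hd, hd₂]
    rw [b₁, b₂]
    ring
  set D : ℝ → ℂ := (Ioi 0).indicator d with hD
  have hDi : ∀ a b, IntervalIntegrable D volume a b := by
    have h1 : ∀ a b, IntegrableOn D (Ioc a b) := fun a b => by
      rw [hD, IntegrableOn, integrable_indicator_iff measurableSet_Ioi, IntegrableOn,
        Measure.restrict_restrict measurableSet_Ioi]
      exact (hdi b).mono_set fun x hx => ⟨hx.1, hx.2.2⟩
    exact fun a b => ⟨h1 a b, h1 b a⟩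
  set v : ℝ → ℂ := fun y => G 0 + ∫ t in (0 : ℝ)..y, D t with hv
  have hvc : Continuous v := continuous_const.add (intervalIntegral.continuous_primitive hDi 0)
  have hDd : ∀ a b, 0 ≤ a → a ≤ b → ∫ t in a..b, D t = ∫ t in a..b, d t := by
    intro a b ha hab
    rw [intervalIntegral.integral_of_le hab, intervalIntegral.integral_of_le hab]
    refine setIntegral_congr_fun measurableSet_Ioc fun x hx => ?_
    exact indicator_of_mem (show x ∈ Ioi (0 : ℝ) from ha.trans_lt hx.1) _
  have hvI : ∀ x, 0 ≤ x → v x = G 0 + ∫ t in Ioo 0 x, d t := by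
    intro x hx
    simp only [hv]
    rw [hDd 0 x le_rfl hx, intervalIntegral.integral_of_le hx, integral_Ioc_eq_integral_Ioo]
  have hveq : ∀ x, 0 ≤ x → v x = G x + (l : ℂ) * ∫ y in Ioo 0 x, K (x - y) * v y := by
    intro x hx
    have hsub : Ioo 0 x ⊆ Ioi (0 : ℝ) := Ioo_subset_Ioi_self
    have hae : ∀ᵐ t ∂(volume.restrict (Ioo 0 x)),
        (l : ℂ) * ∫ y in Ioo 0 t, K (t - y) * d y = d t - H t - q * K t := by
      filter_upwards [ae_mono (Measure.restrict_mono hsub le_rfl) hdeq] with t ht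
      rw [ht]; ring
    have iH : IntegrableOn H (Ioo 0 x) :=
      (integrableOn_of_weighted hHr x).mono_set Ioo_subset_Ioc_self
    have iK : IntegrableOn K (Ioo 0 x) :=
      (integrableOn_of_weighted hK x).mono_set Ioo_subset_Ioc_self
    have id : IntegrableOn d (Ioo 0 x) := (hdi x).mono_set Ioo_subset_Ioc_self
    have key := integral_volterra_primitive hKi id
    have h1 : (l : ℂ) * ∫ t in Ioo 0 x, ∫ y in Ioo 0 t, K (t - y) * d y =
        (∫ t in Ioo 0 x, d t) - (∫ t in Ioo 0 x, H t) - q * ∫ t in Ioo 0 x, K t := by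
      rw [← integral_const_mul, integral_congr_ae hae]
      have e1 := integral_sub (id.sub iH) (iK.const_mul q)
      have e2 := integral_sub id iH
      simp only [Pi.sub_apply] at e1
      rw [e1, e2, integral_const_mul]
    have h2 : ∫ t in Ioo 0 x, H t = G x - G 0 := by
      rw [hG 0 x le_rfl hx, intervalIntegral.integral_of_le hx, integral_Ioc_eq_integral_Ioo]
      ring
    have h3 : ∫ y in Ioo 0 x, K (x - y) = ∫ t in Ioo 0 x, K t := by
      rw [← integral_Ioc_eq_integral_Ioo, ← integral_Ioc_eq_integral_Ioo,
        ← intervalIntegral.integral_of_le hx, ← intervalIntegral.integral_of_le hx,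
        intervalIntegral.integral_comp_sub_left]
      simp
    have h4 : ∫ y in Ioo 0 x, K (x - y) * v y =
        G 0 * (∫ t in Ioo 0 x, K t) +
          ∫ y in Ioo 0 x, K (x - y) * ∫ t in Ioo 0 y, d t := by
      have i1 : IntegrableOn (fun y => G 0 * K (x - y)) (Ioo 0 x) := by
        simpa [mul_comm] using hcomp (continuous_const (y := G 0)) x
      have e1 : EqOn (fun y => K (x - y) * ∫ t in Ioo 0 y, d t)
          (fun y => K (x - y) * v y - G 0 * K (x - y)) (Ioo 0 x) := fun y hy => by
        simp only [hvI y hy.1.le]; ring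
      rw [setIntegral_congr_fun measurableSet_Ioo e1, integral_sub (hcomp hvc x) i1,
        integral_const_mul, h3]
      ring
    rw [hvI x hx, h4, ← key, mul_add, h1, h2, hq]
    ring
  -- Uniqueness gives equality almost everywhere only; inserting it under the Volterra integral
  -- gives equality at every point.
  have hve : ∀ x, 0 ≤ x → e x = v x := by
    have h1 := volterra_eq (h := G) (l := l) hKm hK1 he.measurable hvc.measurable
      (fun A => he.locallyIntegrable.integrableOn_isCompact isCompact_Icc
        |>.mono_set Ioc_subset_Icc_self)
      (fun A => hvc.locallyIntegrable.integrableOn_isCompact isCompact_Icc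
        |>.mono_set Ioc_subset_Icc_self)
      (Eventually.of_forall (hcomp he)) (Eventually.of_forall (hcomp hvc))
      ((ae_restrict_iff' measurableSet_Ioi).2
        (Eventually.of_forall fun x hx => heq x (mem_Ioi.1 hx).le))
      ((ae_restrict_iff' measurableSet_Ioi).2
        (Eventually.of_forall fun x hx => hveq x (mem_Ioi.1 hx).le))
    intro x hx
    rw [heq x hx, hveq x hx]
    congr 2
    refine integral_congr_ae ?_
    filter_upwards [ae_mono (Measure.restrict_mono Ioo_subset_Ioi_self le_rfl) h1] with y hy
    rw [hy]
  have hprim : ∀ a b : ℝ, 0 ≤ a → a ≤ b → e b = e a + ∫ t in a..b, d t := by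
    intro a b ha hab
    rw [hve a ha, hve b (ha.trans hab), ← hDd a b ha hab]
    simp only [hv]
    rw [add_assoc, intervalIntegral.integral_add_adjacent_intervals (hDi _ _) (hDi _ _)]
  have hint : ∀ w : ℝ → ℂ, (∀ A, IntegrableOn w (Ioc 0 A)) → ∀ a b : ℝ, 0 ≤ a → a ≤ b →
      IntervalIntegrable w volume a b := fun w hw a b ha hab =>
    (intervalIntegrable_iff_integrableOn_Ioc_of_le hab).2
      ((hw b).mono_set (Ioc_subset_Ioc_left ha))
  set nG := eLpNorm (weighted r G) 2 halfLine with hnG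
  set nH := eLpNorm (weighted r' H) 2 halfLine with hnH
  -- The bound used for e also applies to G at y = 0. It explains the geometric mean of the two
  -- norms in the estimate.
  have hG0 : ‖G 0‖ₑ ≤ 2 * (nG * nH) ^ (1 / 2 : ℝ) := by
    have h1 := enorm_sq_le_lintegral hr (hint H (integrableOn_of_weighted hHr)) hG hGr le_rfl
    have h2 := lintegral_mul_le_weighted hrr hGr hHr (le_refl 0)
    rw [add_zero, Real.one_rpow, ENNReal.ofReal_one, one_mul] at h2
    have h3 : ((nG * nH) ^ (1 / 2 : ℝ)) ^ 2 = nG * nH := by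
      rw [← ENNReal.rpow_natCast, ← ENNReal.rpow_mul]; simp
    refine (ENNReal.pow_right_strictMono two_ne_zero).le_iff_le.1 ?_
    rw [mul_pow, h3]
    calc ‖G 0‖ₑ ^ 2 ≤ 2 * (nG * nH) := h1.trans (by gcongr)
      _ ≤ 2 ^ 2 * (nG * nH) := by gcongr; norm_num
  refine ⟨fun y => eLpNorm (weighted r e) 2 (volume.restrict (Ioi y)),
    tendsto_eLpNorm_tail hemem, fun y hy => ?_, fun y hy => ?_⟩
  · refine (eLpNorm_mono_measure _
      (Measure.restrict_mono (Ioi_subset_Ioi hy) le_rfl)).trans (hele.trans ?_)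
    gcongr
    rw [add_assoc]
    exact le_self_add
  obtain ⟨t, ht⟩ : ∃ t, t = eLpNorm (weighted r e) 2 (volume.restrict (Ioi y)) := ⟨_, rfl⟩
  have h1 := enorm_sq_le_lintegral hr (hint d hdi) hprim hemem hy
  have h2 := lintegral_mul_le_weighted hrr hemem d₁mem hy
  have h3 := lintegral_mul_le_weighted (by linarith : 0 ≤ r + m) hemem d₂mem hy
  beta_reduce
  rw [← ht] at h2 h3 ⊢
  set P := ENNReal.ofReal ((1 + y) ^ (-(r + r')))
  set Q := ENNReal.ofReal ((1 + y) ^ (-(r + m)))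
  set S := (nG * nH) ^ (1 / 2 : ℝ)
  have h4 : ∫⁻ x in Ioi y, ‖e x‖ₑ * ‖d x‖ₑ ≤
      (∫⁻ x in Ioi y, ‖e x‖ₑ * ‖d₁ x‖ₑ) + ∫⁻ x in Ioi y, ‖e x‖ₑ * ‖d₂ x‖ₑ := by
    have hm₁ : Measurable fun x => ‖e x‖ₑ * ‖d₁ x‖ₑ := he.measurable.enorm.mul d₁m.enorm
    rw [← lintegral_add_left hm₁]
    refine lintegral_mono fun x => ?_
    rw [← mul_add]
    gcongr
    exact enorm_add_le _ _
  calc ‖e y‖ₑ ^ 2 ≤ 2 * (P * (t * (C₂ * nH)) +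
        Q * (t * (ENNReal.ofReal l * (2 * S) * (C₃ * kn)))) := by
        refine h1.trans ?_
        gcongr
        refine h4.trans (add_le_add (h2.trans ?_) (h3.trans ?_))
        · gcongr
        · gcongr
          refine d₂le.trans ?_
          gcongr
    _ = (2 * C₂) * t * (P * nH) + (4 * (C₃ * kn)) * t * (ENNReal.ofReal l * Q * S) := by ring
    _ ≤ (C₁ + 2 * C₂ + 4 * (C₃ * kn)) * t * (P * nH) +
        (C₁ + 2 * C₂ + 4 * (C₃ * kn)) * t * (ENNReal.ofReal l * Q * S) := by
        gcongr
        · exact le_add_right le_add_self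
        · exact le_add_self
    _ = _ := by push_cast; ring

/-! ### Barrelledness of the Schwartz space -/

instance : (uniformity 𝓢(ℝ, ℂ)).IsCountablyGenerated :=
  IsUniformAddGroup.uniformity_countably_generated

/-- The Schwartz space is complete. -/
instance : CompleteSpace 𝓢(ℝ, ℂ) := by
  refine UniformSpace.complete_of_cauchySeq_tendsto fun u hu => ?_
  have hsem : ∀ k n : ℕ, ∀ ε > 0, ∃ N, ∀ i ≥ N, ∀ j ≥ N,
      SchwartzMap.seminorm ℂ k n (u j - u i) < ε := by
    intro k n ε hε
    have h1 : Tendsto (fun p : ℕ × ℕ => u p.2 - u p.1) atTop (𝓝 0) := by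
      have h2 : Tendsto (Prod.map u u) atTop (uniformity 𝓢(ℝ, ℂ)) := hu.tendsto_uniformity
      rw [uniformity_eq_comap_nhds_zero, tendsto_comap_iff] at h2
      exact h2
    have h3 := ((schwartz_withSeminorms ℂ ℝ ℂ).continuous_seminorm (k, n)).tendsto 0 |>.comp h1
    rw [map_zero] at h3
    have h4 := h3.eventually_lt_const hε
    obtain ⟨⟨a, b⟩, hab⟩ := eventually_atTop.1 h4
    refine ⟨max a b, fun i hi j hj => hab (i, j) ⟨?_, ?_⟩⟩
    · exact (le_max_left _ _).trans hi
    · exact (le_max_right _ _).trans hj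
  have hpt : ∀ k n : ℕ, ∀ ε > 0, ∃ N, ∀ i ≥ N, ∀ j ≥ N, ∀ x : ℝ,
      |x| ^ k * ‖iteratedDeriv n (u j) x - iteratedDeriv n (u i) x‖ < ε := by
    intro k n ε hε
    obtain ⟨N, hN⟩ := hsem k n ε hε
    refine ⟨N, fun i hi j hj x => lt_of_le_of_lt ?_ (hN i hi j hj)⟩
    have h1 := SchwartzMap.le_seminorm' ℂ k n (u j - u i) x
    have h2 : iteratedDeriv n (⇑(u j - u i)) x =
        iteratedDeriv n (u j) x - iteratedDeriv n (u i) x := by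
      have : ⇑(u j - u i) = ⇑(u j) - ⇑(u i) := rfl
      rw [this]
      exact iteratedDeriv_sub ((u j).smooth n).contDiffAt ((u i).smooth n).contDiffAt
    rwa [h2] at h1
  have hlim : ∀ n (x : ℝ), ∃ z, Tendsto (fun i => iteratedDeriv n (u i) x) atTop (𝓝 z) := by
    intro n x
    refine cauchySeq_tendsto_of_complete (Metric.cauchySeq_iff.2 fun ε hε => ?_)
    obtain ⟨N, hN⟩ := hpt 0 n ε hε
    refine ⟨N, fun i hi j hj => ?_⟩
    have := hN j hj i hi x
    rwa [pow_zero, one_mul, ← dist_eq_norm] at this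
  choose G hG using hlim
  have hGb : ∀ k n : ℕ, ∀ ε > 0, ∃ N, ∀ i ≥ N, ∀ x : ℝ,
      |x| ^ k * ‖iteratedDeriv n (u i) x - G n x‖ ≤ ε := by
    intro k n ε hε
    obtain ⟨N, hN⟩ := hpt k n ε hε
    refine ⟨N, fun i hi x => ?_⟩
    have h1 : Tendsto (fun j => |x| ^ k * ‖iteratedDeriv n (u i) x - iteratedDeriv n (u j) x‖)
        atTop (𝓝 (|x| ^ k * ‖iteratedDeriv n (u i) x - G n x‖)) :=
      ((tendsto_const_nhds.sub (hG n x)).norm).const_mul _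
    refine le_of_tendsto h1 ?_
    filter_upwards [eventually_ge_atTop N] with j hj
    exact (hN j hj i hi x).le
  have hunif : ∀ n, TendstoUniformly (fun i => iteratedDeriv n (u i)) (G n) atTop := by
    intro n
    refine Metric.tendstoUniformly_iff.2 fun ε hε => ?_
    obtain ⟨N, hN⟩ := hGb 0 n (ε / 2) (by positivity)
    filter_upwards [eventually_ge_atTop N] with i hi x
    have := hN i hi x
    rw [pow_zero, one_mul, ← dist_eq_norm, dist_comm] at this
    linarith
  have hder : ∀ n x, HasDerivAt (G n) (G (n + 1) x) x := by
    intro n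
    refine hasDerivAt_of_tendstoUniformly (hunif (n + 1)) (Eventually.of_forall fun i x => ?_)
      (hG n)
    rw [iteratedDeriv_succ]
    refine DifferentiableAt.hasDerivAt ?_
    exact (((u i).smooth ⊤).differentiable_iteratedDeriv n (by exact_mod_cast ENat.natCast_lt_top n)) x
  have hit : ∀ n, iteratedDeriv n (G 0) = G n := by
    intro n
    induction n with
    | zero => exact iteratedDeriv_zero
    | succ n ih =>
      rw [iteratedDeriv_succ, ih]
      exact funext fun x => (hder n x).deriv
  have hsmooth : ContDiff ℝ ∞ (G 0) := by
    refine contDiff_of_differentiable_iteratedDeriv fun n _ => ?_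
    rw [hit]
    exact fun x => (hder n x).differentiableAt
  set g : 𝓢(ℝ, ℂ) :=
    { toFun := G 0
      smooth' := hsmooth
      decay' := fun k n => by
        obtain ⟨N, hN⟩ := hGb k n 1 one_pos
        refine ⟨1 + SchwartzMap.seminorm ℂ k n (u N), fun x => ?_⟩
        rw [norm_iteratedFDeriv_eq_norm_iteratedDeriv, hit, Real.norm_eq_abs]
        have h1 := hN N le_rfl x
        have h2 := SchwartzMap.le_seminorm' ℂ k n (u N) x
        have h3 : ‖G n x‖ ≤ ‖iteratedDeriv n (u N) x - G n x‖ + ‖iteratedDeriv n (u N) x‖ := by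
          rw [norm_sub_rev]
          exact (norm_le_norm_sub_add _ _)
        have h4 : (0 : ℝ) ≤ |x| ^ k := by positivity
        nlinarith } with hg
  refine ⟨g, ?_⟩
  rw [(schwartz_withSeminorms ℂ ℝ ℂ).tendsto_nhds]
  rintro ⟨k, n⟩ ε hε
  obtain ⟨N, hN⟩ := hGb k n (ε / 2) (by positivity)
  filter_upwards [eventually_ge_atTop N] with i hi
  refine lt_of_le_of_lt ?_ (half_lt_self hε)
  refine SchwartzMap.seminorm_le_bound' ℂ k n _ (by positivity) fun x => ?_
  have h2 : iteratedDeriv n (⇑(u i - g)) x = iteratedDeriv n (u i) x - G n x := by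
    have : ⇑(u i - g) = ⇑(u i) - G 0 := rfl
    rw [this, ← congrFun (hit n) x]
    exact iteratedDeriv_sub ((u i).smooth n).contDiffAt (hsmooth.of_le (by exact_mod_cast le_top)).contDiffAt
  rw [h2]
  exact hN i hi x

/-- Completeness and a countably generated uniformity give a Baire space, and hence the
Banach-Steinhaus theorem. It is needed because a solution is only known to be differentiable in time
against each fixed test function, while the transport argument pairs it with moving ones. -/
instance : BarrelledSpace ℂ 𝓢(ℝ, ℂ) := by
  have : BaireSpace 𝓢(ℝ, ℂ) := by
    let _ := UniformSpace.pseudoMetricSpace 𝓢(ℝ, ℂ)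
    infer_instance
  infer_instance

/-- Pointwise bounded families of tempered distributions are equicontinuous. -/
theorem tendsto_of_pointwise_bounded {ι α : Type*} {l : Filter α} {u : ι → 𝓢'(ℝ, ℂ)}
    (hu : ∀ ψ : 𝓢(ℝ, ℂ), ∃ C, ∀ i, ‖u i ψ‖ ≤ C) {ψ : α → 𝓢(ℝ, ℂ)} (hψ : Tendsto ψ l (𝓝 0))
    {i : α → ι} : Tendsto (fun a => u (i a) (ψ a)) l (𝓝 0) := by
  have h1 : UniformEquicontinuous (DFunLike.coe ∘ fun i => (u i : 𝓢(ℝ, ℂ) →L[ℂ] ℂ)) := by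
    refine (norm_withSeminorms ℂ ℂ).banach_steinhaus fun _ ψ => ?_
    obtain ⟨C, hC⟩ := hu ψ
    exact ⟨C, by rintro _ ⟨i, rfl⟩; exact hC i⟩
  have h2 := h1.equicontinuous 0
  rw [Metric.equicontinuousAt_iff_right] at h2
  refine Metric.tendsto_nhds.2 fun ε hε => ?_
  filter_upwards [hψ.eventually (h2 ε hε)] with a ha
  have := ha (i a)
  simp only [Function.comp] at this
  rw [dist_comm] at this
  have e : (u (i a)) 0 = 0 := map_zero _
  rw [← e]
  exact this

/-! ### Translations of test functions and Duhamel's formula -/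

theorem norm_taylor_le {f f' f'' : ℝ → ℂ} (h1 : ∀ x, HasDerivAt f (f' x) x)
    (h2 : ∀ x, HasDerivAt f' (f'' x) x) {x h M : ℝ} (hM : ∀ s, |s| ≤ |h| → ‖f'' (x - s)‖ ≤ M) :
    ‖f (x - h) - f x + h * f' x‖ ≤ M * h ^ 2 := by
  have hin : ∀ s ∈ uIcc 0 h, |s| ≤ |h| := fun s hs => by
    have := abs_sub_left_of_mem_uIcc hs
    simpa using this
  have hsub : ∀ s, HasDerivAt (fun s : ℝ => x - s) (-1) s := fun s => by
    simpa using (hasDerivAt_id s).const_sub x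
  have b1 : ∀ s ∈ uIcc 0 h, ‖f' (x - s) - f' x‖ ≤ M * |h| := by
    intro s hs
    have := (convex_uIcc 0 h).norm_image_sub_le_of_norm_hasDerivWithin_le
      (f := fun s => f' (x - s)) (f' := fun s => (-1 : ℝ) • f'' (x - s)) (C := M)
      (fun z _ => ((h2 (x - z)).scomp z (hsub z)).hasDerivWithinAt)
      (fun z hz => by rw [norm_smul]; simpa using hM z (hin z hz)) left_mem_uIcc hs
    simp only [sub_zero, Real.norm_eq_abs] at this
    refine this.trans ?_
    have hM0 : 0 ≤ M := (norm_nonneg _).trans (hM 0 (by simp))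
    simpa using mul_le_mul_of_nonneg_left (hin s hs) hM0
  have := (convex_uIcc 0 h).norm_image_sub_le_of_norm_hasDerivWithin_le
    (f := fun s : ℝ => f (x - s) + (s : ℂ) * f' x)
    (f' := fun s => (-1 : ℝ) • f' (x - s) + 1 * f' x) (C := M * |h|)
    (fun z _ => (((h1 (x - z)).scomp z (hsub z)).add
      ((Complex.ofRealCLM.hasDerivAt (x := z)).mul_const (f' x))).hasDerivWithinAt)
    (fun z hz => by
      have := b1 z hz
      rw [neg_one_smul, one_mul, neg_add_eq_sub, norm_sub_rev]
      exact this) left_mem_uIcc right_mem_uIcc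
  simp only [sub_zero, Real.norm_eq_abs, Complex.ofReal_zero, zero_mul, add_zero] at this
  rw [mul_assoc, abs_mul_abs_self, ← pow_two] at this
  rwa [add_sub_right_comm] at this

/-- Translation is differentiable in the Schwartz space. -/
theorem tendsto_translate_slope (θ : 𝓢(ℝ, ℂ)) :
    Tendsto (fun h : ℝ => h⁻¹ • (θ.compSubConstCLM ℂ h - θ)) (𝓝[≠] 0)
      (𝓝 (-SchwartzMap.derivCLM ℂ ℂ θ)) := by
  rw [(schwartz_withSeminorms ℂ ℝ ℂ).tendsto_nhds]
  rintro ⟨k, n⟩ ε hε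
  -- The bound is |x|^k times the second-order Taylor remainder of the n-th derivative. The weight
  -- is moved to the intermediate point x - s by |x|^k ≤ 2^{k-1}(|x - s|^k + 1), valid for |s| ≤ 1.
  set M : ℝ := 2 ^ (k - 1) * (SchwartzMap.seminorm ℂ k (n + 2) θ +
    SchwartzMap.seminorm ℂ 0 (n + 2) θ) with hM
  have hM0 : 0 ≤ M := by positivity
  have hd : ∀ (j : ℕ) x, HasDerivAt (iteratedDeriv j θ) (iteratedDeriv (j + 1) θ x) x := by
    intro j x
    rw [iteratedDeriv_succ]
    exact ((((θ.smooth ⊤).differentiable_iteratedDeriv j (by exact_mod_cast ENat.natCast_lt_top j)) x)).hasDerivAt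
  have key : ∀ h : ℝ, h ≠ 0 → |h| ≤ 1 → SchwartzMap.seminorm ℂ k n
      (h⁻¹ • (θ.compSubConstCLM ℂ h - θ) - -SchwartzMap.derivCLM ℂ ℂ θ) ≤ M * |h| := by
    intro h h0 h1
    refine SchwartzMap.seminorm_le_bound' ℂ k n _ (by positivity) fun x => ?_
    have e : iteratedDeriv n (⇑(h⁻¹ • (θ.compSubConstCLM ℂ h - θ) - -SchwartzMap.derivCLM ℂ ℂ θ)) x
        = (h⁻¹ : ℝ) • (iteratedDeriv n θ (x - h) - iteratedDeriv n θ x +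
          h * iteratedDeriv (n + 1) θ x) := by
      have hs : ∀ (g : 𝓢(ℝ, ℂ)) (y : ℝ), ContDiffAt ℝ n g y := fun g y => (g.smooth n).contDiffAt
      have hc : ⇑(h⁻¹ • (θ.compSubConstCLM ℂ h - θ) - -SchwartzMap.derivCLM ℂ ℂ θ) =
          ⇑(h⁻¹ • (θ.compSubConstCLM ℂ h - θ)) - ⇑(-SchwartzMap.derivCLM ℂ ℂ θ) := rfl
      have hc2 : ⇑(h⁻¹ • (θ.compSubConstCLM ℂ h - θ)) =
          h⁻¹ • (⇑(θ.compSubConstCLM ℂ h - θ)) := rfl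
      have hc3 : ⇑(θ.compSubConstCLM ℂ h - θ) = ⇑(θ.compSubConstCLM ℂ h) - ⇑θ := rfl
      have hc4 : ⇑(-SchwartzMap.derivCLM ℂ ℂ θ) = -deriv θ := rfl
      have hc5 : ⇑(θ.compSubConstCLM ℂ h) = fun x => θ (x - h) := rfl
      rw [hc, iteratedDeriv_sub (hs _ x) (hs _ x), hc2, iteratedDeriv_const_smul (hs _ x), hc3,
        iteratedDeriv_sub (hs _ x) (hs _ x), hc4, iteratedDeriv_neg, hc5,
        iteratedDeriv_comp_sub_const, ← iteratedDeriv_succ', smul_add]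
      have : (h⁻¹ : ℝ) • ((h : ℂ) * iteratedDeriv (n + 1) θ x) = iteratedDeriv (n + 1) θ x := by
        rw [Complex.real_smul, ← mul_assoc, Complex.ofReal_inv,
          inv_mul_cancel₀ (by exact_mod_cast h0), one_mul]
      rw [this]
      simp
    rw [e, norm_smul, norm_inv, Real.norm_eq_abs]
    -- The Taylor bound is applied with the constant M/|x|^k, so a vanishing weight is treated
    -- apart.
    by_cases hx : |x| ^ k = 0
    · rw [hx, zero_mul]; positivity
    have hxk : 0 < |x| ^ k := lt_of_le_of_ne (by positivity) (Ne.symm hx)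
    have h2 := norm_taylor_le (hd n) (hd (n + 1)) (x := x) (h := h) (M := M / |x| ^ k) ?_
    · calc |x| ^ k * (|h|⁻¹ * ‖_‖) ≤ |x| ^ k * (|h|⁻¹ * (M / |x| ^ k * h ^ 2)) := by gcongr
        _ = M * |h| := by
          have : |h| ≠ 0 := abs_ne_zero.2 h0
          rw [← sq_abs h]
          field_simp
    · intro s hs
      rw [le_div_iff₀ hxk]
      have h3 : |x| ^ k ≤ 2 ^ (k - 1) * (|x - s| ^ k + 1) := by
        have h4 : |x| ≤ |x - s| + 1 := by
          have := abs_add_le (x - s) s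
          rw [sub_add_cancel] at this
          linarith
        have h5 := add_pow_le (abs_nonneg (x - s)) zero_le_one k
        rw [one_pow] at h5
        exact (pow_le_pow_left₀ (abs_nonneg x) h4 k).trans h5
      have h6 := SchwartzMap.le_seminorm' ℂ k (n + 2) θ (x - s)
      have h7 := SchwartzMap.le_seminorm' ℂ 0 (n + 2) θ (x - s)
      rw [pow_zero, one_mul] at h7
      calc ‖iteratedDeriv (n + 1 + 1) θ (x - s)‖ * |x| ^ k ≤
          ‖iteratedDeriv (n + 2) θ (x - s)‖ * (2 ^ (k - 1) * (|x - s| ^ k + 1)) := by gcongr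
        _ = 2 ^ (k - 1) * (|x - s| ^ k * ‖iteratedDeriv (n + 2) θ (x - s)‖ +
          ‖iteratedDeriv (n + 2) θ (x - s)‖) := by ring
        _ ≤ M := by rw [hM]; gcongr
  have hlim : Tendsto (fun h : ℝ => M * |h|) (𝓝[≠] 0) (𝓝 0) := by
    have : Continuous fun h : ℝ => M * |h| := by fun_prop
    have h2 := this.tendsto 0
    simp only [abs_zero, mul_zero] at h2
    exact h2.mono_left nhdsWithin_le_nhds
  have hsmall : ∀ᶠ h : ℝ in 𝓝[≠] 0, |h| ≤ 1 := by
    have : Continuous fun h : ℝ => |h| := by fun_prop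
    have h2 := this.tendsto 0
    rw [abs_zero] at h2
    exact ((h2.mono_left nhdsWithin_le_nhds).eventually_le_const zero_lt_one)
  filter_upwards [hlim.eventually_lt_const hε, hsmall, self_mem_nhdsWithin] with h a1 a2 a3
  exact (key h a3 a2).trans_lt a1

/-- The product rule for the pairing of a curve of tempered distributions with a curve of
Schwartz functions. -/
theorem hasDerivWithinAt_pairing {U : ℝ → 𝓢'(ℝ, ℂ)} {Θ : ℝ → 𝓢(ℝ, ℂ)} {χ : 𝓢(ℝ, ℂ)} {τ : ℝ}
    (hτ : 0 ≤ τ) {d : ℂ} (hc : ∀ ψ, ContinuousOn (fun s => U s ψ) (Ici 0))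
    (hU : HasDerivWithinAt (fun s => U s (Θ τ)) d (Ici 0) τ)
    (hΘ : Tendsto (fun s => (s - τ)⁻¹ • (Θ s - Θ τ)) (𝓝[≠] τ) (𝓝 χ)) :
    HasDerivWithinAt (fun s => U s (Θ s)) (d + U τ χ) (Ici 0) τ := by
  rw [hasDerivWithinAt_iff_tendsto_slope] at hU ⊢
  have hle : 𝓝[Ici 0 \ {τ}] τ ≤ 𝓝[≠] τ := nhdsWithin_mono _ fun x hx => hx.2
  have hle2 : 𝓝[Ici 0 \ {τ}] τ ≤ 𝓝[Ici 0] τ := nhdsWithin_mono _ fun x hx => hx.1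
  have hτ1 : (0 : ℝ) ≤ τ + 1 := by linarith
  have h1 : Tendsto (fun s => (s - τ)⁻¹ • (Θ s - Θ τ) - χ) (𝓝[Ici 0 \ {τ}] τ) (𝓝 0) := by
    simpa using (hΘ.mono_left hle).sub_const χ
  -- On a compact time interval the functionals are pointwise bounded, hence equicontinuous, so the
  -- difference quotients of Θ may be replaced by their limit even though the functional moves with
  -- s. The projection onto the interval only serves to index the family.
  have h2 := tendsto_of_pointwise_bounded (u := fun i : Icc 0 (τ + 1) => U i) (fun ψ => by
    obtain ⟨C, hC⟩ := (isCompact_Icc (a := 0) (b := τ + 1)).exists_bound_of_continuousOn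
      ((hc ψ).mono Icc_subset_Ici_self)
    exact ⟨C, fun i => hC i i.2⟩) h1 (i := fun s => projIcc 0 (τ + 1) hτ1 s)
  have h3 : Tendsto (fun s => U s χ) (𝓝[Ici 0 \ {τ}] τ) (𝓝 (U τ χ)) :=
    (hc χ τ hτ).mono_left hle2
  have h4 := (h2.add h3).add hU
  rw [zero_add, add_comm (U τ χ) d] at h4
  refine h4.congr' ?_
  have hsmall : ∀ᶠ s in 𝓝[Ici 0 \ {τ}] τ, s < τ + 1 :=
    mem_nhdsWithin_of_mem_nhds (Iio_mem_nhds (by linarith))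
  filter_upwards [hsmall, self_mem_nhdsWithin] with s hs1 hs2
  rw [projIcc_of_mem hτ1 ⟨hs2.1, hs1.le⟩]
  simp only [slope_def_module]
  have e1 : (U s) ((s - τ)⁻¹ • (Θ s - Θ τ) - χ) =
      (s - τ)⁻¹ • (U s (Θ s) - U s (Θ τ)) - U s χ := by
    rw [map_sub, ← map_sub (U s) (Θ s)]
    congr 1
    have : (s - τ)⁻¹ • (Θ s - Θ τ) = (((s - τ)⁻¹ : ℝ) : ℂ) • (Θ s - Θ τ) := rfl
    rw [this, map_smul]
    rfl
  rw [e1, sub_add_cancel, ← smul_add]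
  congr 1
  ring

/-- The chain rule for a test function carried along the characteristics. The derivative κθ' cancels
the transport term when the solution is paired with it. -/
theorem tendsto_translate_comp_slope (θ : 𝓢(ℝ, ℂ)) {κ : ℝ} (hκ : κ ≠ 0) (t τ : ℝ) :
    Tendsto (fun s => (s - τ)⁻¹ • (θ.compSubConstCLM ℂ (κ * (t - s)) -
      θ.compSubConstCLM ℂ (κ * (t - τ)))) (𝓝[≠] τ)
      (𝓝 ((κ : ℂ) • SchwartzMap.derivCLM ℂ ℂ (θ.compSubConstCLM ℂ (κ * (t - τ))))) := by
  have h1 : Tendsto (fun s : ℝ => -κ * (s - τ)) (𝓝[≠] τ) (𝓝[≠] 0) := by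
    refine tendsto_nhdsWithin_iff.2 ⟨?_, ?_⟩
    · have : Continuous fun s : ℝ => -κ * (s - τ) := by fun_prop
      have := this.tendsto τ
      simp only [sub_self, mul_zero] at this
      exact this.mono_left nhdsWithin_le_nhds
    · filter_upwards [self_mem_nhdsWithin] with s hs
      exact mul_ne_zero (neg_ne_zero.2 hκ) (sub_ne_zero.2 hs)
  have h2 := ((tendsto_translate_slope (θ.compSubConstCLM ℂ (κ * (t - τ)))).comp h1).const_smul
    (-κ : ℂ)
  have e : (-κ : ℂ) • -SchwartzMap.derivCLM ℂ ℂ (θ.compSubConstCLM ℂ (κ * (t - τ))) =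
      (κ : ℂ) • SchwartzMap.derivCLM ℂ ℂ (θ.compSubConstCLM ℂ (κ * (t - τ))) := by
    rw [smul_neg, neg_smul, neg_neg]
  rw [e] at h2
  refine h2.congr' ?_
  filter_upwards [self_mem_nhdsWithin] with s hs
  simp only [Function.comp]
  rw [SchwartzMap.compSubConstCLM_comp]
  have e2 : κ * (t - τ) + -κ * (s - τ) = κ * (t - s) := by ring
  rw [e2]
  ext x
  simp only [smul_apply, Complex.real_smul, smul_eq_mul]
  have : (s - τ : ℂ) ≠ 0 := by
    have := sub_ne_zero.2 hs
    exact_mod_cast this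
  have : (κ : ℂ) ≠ 0 := by exact_mod_cast hκ
  push_cast
  field_simp

/-- Duhamel's formula for the transport equation with a source, in the dual variable. -/
theorem transport_eq {U : ℝ → 𝓢'(ℝ, ℂ)} {ε : ℝ → ℂ} {φ : ℝ → ℂ} {κ : ℝ} (hκ : κ ≠ 0)
    (hε : ContinuousOn ε (Ici 0)) (hφ : Integrable φ)
    (hU : ∀ θ : 𝓢(ℝ, ℂ), ∀ t ∈ Ici (0 : ℝ), HasDerivWithinAt (fun s => U s θ)
      (-(κ * U t (SchwartzMap.derivCLM ℂ ℂ θ)) + ε t * ∫ x, φ x * θ x) (Ici 0) t)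
    {t : ℝ} (ht : 0 ≤ t) (θ : 𝓢(ℝ, ℂ)) :
    U t θ = U 0 (θ.compSubConstCLM ℂ (κ * t)) +
      ∫ τ in 0..t, ε τ * ∫ x, φ x * θ (x - κ * (t - τ)) := by
  have hc : ∀ ψ, ContinuousOn (fun s => U s ψ) (Ici 0) :=
    fun ψ s hs => (hU ψ s hs).continuousWithinAt
  -- The test function solves the dual transport equation with value θ at time t, so only the source
  -- remains in the derivative of the pairing.
  set Θ : ℝ → 𝓢(ℝ, ℂ) := fun s => θ.compSubConstCLM ℂ (κ * (t - s)) with hΘ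
  have hd : ∀ τ ∈ Ici (0 : ℝ), HasDerivWithinAt (fun s => U s (Θ s))
      (ε τ * ∫ x, φ x * Θ τ x) (Ici 0) τ := by
    intro τ hτ
    have := hasDerivWithinAt_pairing hτ hc (hU (Θ τ) τ hτ) (tendsto_translate_comp_slope θ hκ t τ)
    convert this using 1
    rw [map_smul, smul_eq_mul]
    ring
  have hcont : Continuous fun τ => ∫ x, φ x * θ (x - κ * (t - τ)) := by
    obtain ⟨C, hC⟩ : ∃ C, ∀ x, ‖θ x‖ ≤ C :=
      ⟨SchwartzMap.seminorm ℂ 0 0 θ, fun x => by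
        simpa using SchwartzMap.norm_le_seminorm ℂ θ x⟩
    refine continuous_of_dominated (bound := fun x => ‖φ x‖ * C) (fun τ => ?_) (fun τ => ?_)
      (hφ.norm.mul_const C) ?_
    · exact hφ.aestronglyMeasurable.mul
        (θ.continuous.comp (by fun_prop)).aestronglyMeasurable
    · refine Eventually.of_forall fun x => ?_
      rw [norm_mul]
      gcongr
      exact hC _
    · refine Eventually.of_forall fun x => ?_
      exact continuous_const.mul (θ.continuous.comp (by fun_prop))
  have hftc := intervalIntegral.integral_eq_sub_of_hasDeriv_right_of_le
    (f := fun s => U s (Θ s)) (f' := fun τ => ε τ * ∫ x, φ x * Θ τ x) ht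
    (fun s hs => ((hd s hs.1).continuousWithinAt).mono Icc_subset_Ici_self)
    (fun s hs => ((hd s hs.1.le).mono (Ioi_subset_Ici hs.1.le)))
    (ContinuousOn.intervalIntegrable (by
      rw [uIcc_of_le ht]
      exact (hε.mono Icc_subset_Ici_self).mul hcont.continuousOn))
  have e1 : Θ t = θ := by
    ext x
    simp [hΘ]
  have e0 : Θ 0 = θ.compSubConstCLM ℂ (κ * t) := by
    simp only [hΘ, sub_zero]
  simp only [e1, e0] at hftc
  rw [eq_sub_iff_add_eq, add_comm] at hftc
  exact hftc.symm

/-! ### The Volterra equation of a Fourier mode -/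

/-- Averaging against a compactly supported approximate identity. -/
theorem tendsto_integral_mul_approx {ρ : 𝓢(ℝ, ℂ)} (hρ : ∀ x, 1 < |x| → ρ x = 0)
    (hρ1 : ∫ x, ρ x = 1) {h : ℝ → ℂ} (hm : Measurable h) {C : ℝ}
    (hC : ∀ x, |x| ≤ 1 → ‖h x‖ ≤ C) (h0 : ContinuousAt h 0) :
    Tendsto (fun n : ℕ => ∫ x, h x * (((n : ℝ) + 1 : ℝ) * ρ (((n : ℝ) + 1) * x))) atTop
      (𝓝 (h 0)) := by
  have e : ∀ n : ℕ, ∫ x, h x * (((n : ℝ) + 1 : ℝ) * ρ (((n : ℝ) + 1) * x)) =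
      ∫ x, h (((n : ℝ) + 1)⁻¹ * x) * ρ x := by
    intro n
    have hn : (0 : ℝ) < (n : ℝ) + 1 := by positivity
    have := Measure.integral_comp_mul_left (fun x => h (((n : ℝ) + 1)⁻¹ * x) * ρ x) ((n : ℝ) + 1)
    rw [abs_of_pos (inv_pos.2 hn), Complex.real_smul] at this
    have h2 : (((n : ℝ) + 1 : ℝ) : ℂ) ≠ 0 := by exact_mod_cast hn.ne'
    rw [Complex.ofReal_inv, eq_inv_mul_iff_mul_eq₀ h2, ← integral_const_mul] at this
    rw [← this]
    refine integral_congr_ae (Eventually.of_forall fun x => ?_)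
    simp only [inv_mul_cancel_left₀ hn.ne']
    ring
  simp only [e]
  have hlim : ∫ x, h 0 * ρ x = h 0 := by rw [integral_const_mul, hρ1, mul_one]
  rw [← hlim]
  refine tendsto_integral_of_dominated_convergence (fun x => C * ‖ρ x‖) (fun n => ?_)
    (ρ.integrable.norm.const_mul C) (fun n => ?_) ?_
  · exact ((hm.comp (measurable_const_mul _)).mul ρ.continuous.measurable).aestronglyMeasurable
  · refine Eventually.of_forall fun x => ?_
    rw [norm_mul]
    by_cases hx : 1 < |x|
    · rw [hρ x hx]; simp
    · gcongr
      refine hC _ ?_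
      rw [abs_mul, abs_of_pos (by positivity)]
      have h1 : ((n : ℝ) + 1)⁻¹ ≤ 1 := inv_le_one_of_one_le₀ (by linarith [n.cast_nonneg (α := ℝ)])
      have h2 := not_lt.1 hx
      calc _ ≤ 1 * (1 : ℝ) := by gcongr
        _ = 1 := one_mul 1
  · refine Eventually.of_forall fun x => ?_
    refine Tendsto.mul_const _ ?_
    have h1 : Tendsto (fun n : ℕ => ((n : ℝ) + 1)⁻¹ * x) atTop (𝓝 0) := by
      have : Tendsto (fun n : ℕ => ((n : ℝ) + 1)⁻¹) atTop (𝓝 0) :=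
        tendsto_inv_atTop_zero.comp
          (tendsto_atTop_add_const_right _ _ tendsto_natCast_atTop_atTop)
      simpa using this.mul_const x
    exact h0.tendsto.comp h1

/-- The convolution term of Duhamel's formula, tested against an approximate identity. -/
theorem tendsto_duhamel_approx {ρ : 𝓢(ℝ, ℂ)} (hρ : ∀ x, 1 < |x| → ρ x = 0)
    (hρ1 : ∫ x, ρ x = 1) {ε φ : ℝ → ℂ} {κ : ℝ} (hκ : κ ≠ 0)
    (hε : ContinuousOn ε (Ici 0)) (hφ : Integrable φ) {t : ℝ} (ht : 0 ≤ t) :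
    Tendsto (fun n : ℕ => ∫ τ in 0..t, ε τ *
      ∫ x, φ x * (((n : ℝ) + 1 : ℝ) * ρ (((n : ℝ) + 1) * (x - κ * (t - τ))))) atTop
      (𝓝 (∫ τ in 0..t, ε τ * φ (κ * (t - τ)))) := by
  -- The truncated field is bounded and continuous except possibly at 0 and t; `max` extends it
  -- continuously to negative times before the cut-off.
  set e : ℝ → ℂ := (Ioo 0 t).indicator (fun s => ε (max s 0)) with he
  have hc : Continuous fun s => ε (max s 0) :=
    hε.comp_continuous (by fun_prop) fun s => mem_Ici.2 (le_max_right _ _)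
  have hem : Measurable e := hc.measurable.indicator measurableSet_Ioo
  obtain ⟨M, hM⟩ : ∃ M, ∀ s, ‖e s‖ ≤ M := by
    obtain ⟨M, hM⟩ := (isCompact_Icc (a := 0) (b := t)).exists_bound_of_continuousOn
      (hc.continuousOn)
    refine ⟨max M 0, fun s => ?_⟩
    by_cases hs : s ∈ Ioo 0 t
    · rw [he, indicator_of_mem hs]
      exact (hM s (Ioo_subset_Icc_self hs)).trans (le_max_left _ _)
    · rw [he, indicator_of_notMem hs, norm_zero]
      exact le_max_right _ _
  have hM0 : 0 ≤ M := (norm_nonneg _).trans (hM 0)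
  have hee : ∀ F : ℝ → ℂ, ∫ τ in 0..t, ε τ * F τ = ∫ τ, e τ * F τ := by
    intro F
    rw [intervalIntegral.integral_of_le ht, integral_Ioc_eq_integral_Ioo,
      ← integral_indicator measurableSet_Ioo]
    refine integral_congr_ae (Eventually.of_forall fun τ => ?_)
    by_cases hs : τ ∈ Ioo 0 t
    · simp only [he, indicator_of_mem hs, max_eq_left hs.1.le]
    · simp only [he, indicator_of_notMem hs, zero_mul]
  have hcv : ∀ F : ℝ → ℂ, ∀ x, ∫ τ, e τ * F (x - κ * (t - τ)) =
      |κ⁻¹| • ∫ y, e (t - κ⁻¹ * (x - y)) * F y := by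
    intro F x
    rw [← integral_add_right_eq_self (fun y => e (t - κ⁻¹ * (x - y)) * F y) (x - κ * t),
      ← Measure.integral_comp_mul_left
        (fun y => e (t - κ⁻¹ * (x - (y + (x - κ * t)))) * F (y + (x - κ * t))) κ]
    refine integral_congr_ae (Eventually.of_forall fun τ => ?_)
    have e2 : κ * τ + (x - κ * t) = x - κ * (t - τ) := by ring
    have e1 : t - κ⁻¹ * (x - (x - κ * (t - τ))) = τ := by field_simp; ring
    simp only [e2, e1]
  set d : ℕ → ℝ → ℂ := fun n x => ((n : ℝ) + 1 : ℝ) * ρ (((n : ℝ) + 1) * x) with hd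
  have hdc : ∀ n, Continuous (d n) := fun n =>
    continuous_const.mul (ρ.continuous.comp (by fun_prop))
  -- φ is merely integrable and cannot be evaluated as a limit of averages. Fubini moves the
  -- mollifier onto e, which is continuous off two points, and φ then serves as the dominating
  -- function.
  have hswap : ∀ n, ∫ τ, e τ * ∫ x, φ x * d n (x - κ * (t - τ)) =
      ∫ x, φ x * (|κ⁻¹| • ∫ y, e (t - κ⁻¹ * (x - y)) * d n y) := by
    intro n
    simp only [← hcv, ← integral_const_mul]
    rw [integral_integral_swap]
    · refine integral_congr_ae (Eventually.of_forall fun x => ?_)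
      refine integral_congr_ae (Eventually.of_forall fun τ => ?_)
      simp only
      ring
    · obtain ⟨C, hC⟩ : ∃ C, ∀ x, ‖ρ x‖ ≤ C :=
        ⟨SchwartzMap.seminorm ℂ 0 0 ρ, fun x => by
          simpa using SchwartzMap.norm_le_seminorm ℂ ρ x⟩
      have hei : Integrable e := by
        rw [he, integrable_indicator_iff measurableSet_Ioo]
        exact (hc.integrableOn_Icc).mono_set Ioo_subset_Icc_self
      have h1 := (hei.mul_prod hφ).mul_bdd (c := (n + 1) * C)
        (g := fun p : ℝ × ℝ => d n (p.2 - κ * (t - p.1)))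
        ((hdc n).comp (g := d n) (f := fun p : ℝ × ℝ => p.2 - κ * (t - p.1))
          (by fun_prop)).aestronglyMeasurable
        (Eventually.of_forall fun p => by
          simp only [hd, norm_mul, Complex.norm_real, Real.norm_eq_abs]
          rw [abs_of_pos (by positivity)]
          gcongr
          exact hC _)
      refine h1.congr (Eventually.of_forall fun p => ?_)
      simp only [Function.uncurry]
      ring
  have hlim : ∫ τ, e τ * φ (κ * (t - τ)) = ∫ x, φ x * (|κ⁻¹| • e (t - κ⁻¹ * x)) := by
    have h1 := hcv (fun y => φ (-y)) 0
    simp only [zero_sub, neg_neg] at h1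
    rw [h1, ← integral_neg_eq_self, ← integral_smul]
    refine integral_congr_ae (Eventually.of_forall fun x => ?_)
    simp only [neg_neg, Complex.real_smul]
    ring
  simp only [hee, hlim]
  change Tendsto (fun n : ℕ => ∫ τ, e τ * ∫ x, φ x * d n (x - κ * (t - τ))) _ _
  simp only [hswap]
  have hρn : ∀ n : ℕ, ∫ y, ‖d n y‖ = ∫ y, ‖ρ y‖ := by
    intro n
    have hn : (0 : ℝ) < (n : ℝ) + 1 := by positivity
    have := Measure.integral_comp_mul_left (fun x => ‖ρ x‖) ((n : ℝ) + 1)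
    simp only [hd, norm_mul, Complex.norm_real, Real.norm_eq_abs, abs_of_pos hn]
    rw [integral_const_mul, this, abs_of_pos (inv_pos.2 hn), smul_eq_mul,
      mul_inv_cancel_left₀ hn.ne']
  have hdi : ∀ n : ℕ, Integrable (d n) := fun n =>
    (ρ.integrable.comp_mul_left' (by positivity)).const_mul _
  refine tendsto_integral_of_dominated_convergence
    (fun x => ‖φ x‖ * (|κ⁻¹| * (M * ∫ y, ‖ρ y‖))) (fun n => ?_) (hφ.norm.mul_const _)
    (fun n => ?_) ?_
  · refine hφ.aestronglyMeasurable.mul (StronglyMeasurable.aestronglyMeasurable ?_)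
    refine StronglyMeasurable.const_smul ?_ |κ⁻¹|
    refine StronglyMeasurable.integral_prod_right (f := fun x y => e (t - κ⁻¹ * (x - y)) * d n y) ?_
    refine Measurable.stronglyMeasurable ?_
    exact (hem.comp (by fun_prop)).mul ((hdc n).measurable.comp measurable_snd)
  · refine Eventually.of_forall fun x => ?_
    rw [norm_mul, norm_smul, Real.norm_eq_abs, abs_abs, ← hρn n, ← integral_const_mul]
    gcongr
    refine norm_integral_le_of_norm_le ((hdi n).norm.const_mul M) (Eventually.of_forall fun y => ?_)
    rw [norm_mul]
    gcongr
    exact hM _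
  · have hae : ∀ᵐ x : ℝ, x ≠ κ * t ∧ x ≠ 0 := by
      have h1 : ∀ a : ℝ, ∀ᵐ x : ℝ, x ≠ a := fun a => by
        simp [ae_iff]
      exact (h1 _).and (h1 _)
    filter_upwards [hae] with x hx
    refine Tendsto.const_mul _ (Tendsto.const_smul ?_ _)
    have := tendsto_integral_mul_approx hρ hρ1 (h := fun y => e (t - κ⁻¹ * (x - y))) (C := M)
      (hem.comp (by fun_prop)) (fun _ _ => hM _) ?_
    · simpa only [sub_zero] using this
    · have hcomp : Continuous fun y : ℝ => t - κ⁻¹ * (x - y) := by fun_prop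
      refine ContinuousAt.comp (g := e) (f := fun y : ℝ => t - κ⁻¹ * (x - y)) ?_ hcomp.continuousAt
      simp only [sub_zero]
      have hne : t - κ⁻¹ * x ≠ 0 ∧ t - κ⁻¹ * x ≠ t := by
        constructor
        · intro h
          apply hx.1
          field_simp at h
          linarith
        · intro h
          have h2 : κ⁻¹ * x = 0 := by linarith
          rcases mul_eq_zero.1 h2 with h3 | h3
          · exact hκ (inv_eq_zero.1 h3)
          · exact hx.2 h3
      refine (hc.continuousOn).continuousAt_indicator fun hmem => ?_
      rcases ht.eq_or_lt with h0 | h0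
      · rw [← h0, Ioo_self, frontier_empty] at hmem
        exact hmem
      · rw [frontier_Ioo h0] at hmem
        rcases hmem with h | h
        · exact hne.1 h
        · exact hne.2 h

theorem mode_dx (T : ℝ) (k : ℤ) : PeriodicTest.dx (PeriodicTest.mode T k) =
    (2 * Real.pi * Complex.I * (k / T : ℝ) : ℂ) • PeriodicTest.mode T k := by
  apply Subtype.ext
  funext x
  have h1 : HasDerivAt (fun x : ℝ => ((x / T : ℝ) : ℂ)) ((1 / T : ℝ) : ℂ) x :=
    ((hasDerivAt_id x).div_const T).ofReal_comp
  have h2 := (h1.const_mul (2 * Real.pi * Complex.I * k : ℂ)).cexp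
  change deriv (fun x : ℝ => Complex.exp (2 * Real.pi * Complex.I * k * ((x / T : ℝ) : ℂ))) x =
    (2 * Real.pi * Complex.I * (k / T : ℝ) : ℂ) *
      Complex.exp (2 * Real.pi * Complex.I * k * ((x / T : ℝ) : ℂ))
  rw [h2.deriv]
  push_cast
  ring

/-- A smooth compactly supported function of integral one. -/
theorem exists_mollifier : ∃ ρ : 𝓢(ℝ, ℂ), HasCompactSupport ρ ∧ (∀ x, 1 < |x| → ρ x = 0) ∧
    ∫ x, ρ x = 1 := by
  let b : ContDiffBump (0 : ℝ) := ⟨1 / 2, 1, by norm_num, by norm_num⟩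
  have h1 : HasCompactSupport fun x => ((b.normed volume x : ℝ) : ℂ) :=
    b.hasCompactSupport_normed.comp_left Complex.ofReal_zero
  have h2 : ContDiff ℝ ∞ fun x => ((b.normed volume x : ℝ) : ℂ) :=
    Complex.ofRealCLM.contDiff.comp b.contDiff_normed
  refine ⟨h1.toSchwartzMap h2, h1, fun x hx => ?_, ?_⟩
  · change ((b.normed volume x : ℝ) : ℂ) = 0
    have : x ∉ Function.support (b.normed volume) := by
      rw [b.support_normed_eq]
      simp [b, hx.le]
    rw [Function.notMem_support.1 this, Complex.ofReal_zero]
  · change ∫ x, ((b.normed volume x : ℝ) : ℂ) = 1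
    rw [integral_complex_ofReal, b.integral_normed, Complex.ofReal_one]

theorem dilate_apply (R : ℝˣ) (χ : 𝓢(ℝ, ℂ)) (x : ℝ) : dilate R χ x = χ ((R : ℝ)⁻¹ * x) := by
  change χ _ = χ _
  congr 1
  simp [mul_comm]

/-- The cut-offs that define the integral over v are, on the dual side, an approximate identity at
the origin. -/
theorem dilate_fourier (R : ℝˣ) (hR : 0 < (R : ℝ)) (ρ : 𝓢(ℝ, ℂ)) :
    dilate R (𝓕 ρ) = 𝓕 (((R : ℝ) : ℂ) • dilate R⁻¹ ρ) := by
  ext v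
  rw [dilate_apply, SchwartzMap.fourier_coe, SchwartzMap.fourier_coe, Real.fourier_real_eq,
    Real.fourier_real_eq]
  have := Measure.integral_comp_mul_left
    (fun x => 𝐞 (-(x * ((R : ℝ)⁻¹ * v))) • ρ x) (R : ℝ)
  rw [abs_of_pos (inv_pos.2 hR), Complex.real_smul] at this
  have h2 : ((R : ℝ) : ℂ) ≠ 0 := by exact_mod_cast hR.ne'
  rw [Complex.ofReal_inv, eq_inv_mul_iff_mul_eq₀ h2, ← integral_const_mul] at this
  rw [← this]
  refine integral_congr_ae (Eventually.of_forall fun x => ?_)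
  have e : (R : ℝ) * x * ((R : ℝ)⁻¹ * v) = x * v := by
    field_simp
  simp only [e, smul_apply, dilate_apply, Circle.smul_def, smul_eq_mul, Units.val_inv_eq_inv_val,
    inv_inv]
  ring

theorem smulLeft_fourier (θ : 𝓢(ℝ, ℂ)) :
    (2 * Real.pi * Complex.I) • SchwartzMap.smulLeftCLM ℂ (fun v : ℝ => (v : ℂ)) (𝓕 θ) =
      𝓕 (SchwartzMap.derivCLM ℂ ℂ θ) := by
  have h1 := SchwartzMap.fourier_lineDerivOp_eq θ 1
  have h2 : LineDeriv.lineDerivOp (1 : ℝ) θ = SchwartzMap.derivCLM ℂ ℂ θ := by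
    ext x
    rw [SchwartzMap.lineDerivOp_apply_eq_fderiv]
    exact fderiv_apply_one_eq_deriv
  rw [h2] at h1
  rw [h1]
  congr 1
  ext v
  rw [SchwartzMap.smulLeftCLM_apply_apply (by fun_prop),
    SchwartzMap.smulLeftCLM_apply_apply (by fun_prop)]
  simp

/-- The Volterra equation for the `k`-th mode of the field. -/
theorem IsSolution.volterra {f₀ : ℝ → ℝ} {T : ℝ} (hT : 0 < T)
    {f : ℝ → PeriodicDistribution T 𝓢'(ℝ, ℂ)} {E : ℝ → PeriodicDistribution T ℂ}
    (hsol : IsSolution f₀ f E) {φ : ℝ → ℂ} (hφ : Integrable φ)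
    (hf₀ : ∀ v, ((deriv f₀ v : ℝ) : ℂ) = 𝓕⁻ φ v) {k : ℤ} (hk : k ≠ 0) {G : ℝ → ℂ}
    (hGc : Continuous G)
    (hG : ∀ θ : 𝓢(ℝ, ℂ), HasCompactSupport θ →
      f 0 (PeriodicTest.mode T (-k)) (𝓕 θ) = ∫ x, G x * θ x) {t : ℝ} (ht : 0 ≤ t) :
    -(2 * Real.pi * Complex.I * (k / T : ℝ)) * E t (PeriodicTest.mode T (-k)) =
      G (k / T * t) +
        ∫ τ in 0..t, E τ (PeriodicTest.mode T (-k)) * φ (k / T * (t - τ)) := by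
  set a := PeriodicTest.mode T (-k) with ha
  set κ : ℝ := k / T with hκd
  have hκ : κ ≠ 0 := div_ne_zero (by exact_mod_cast hk) hT.ne'
  have hdx : PeriodicTest.dx a = (-(2 * Real.pi * Complex.I * κ) : ℂ) • a := by
    rw [ha, mode_dx, hκd]
    congr 1
    push_cast
    ring
  set U : ℝ → 𝓢'(ℝ, ℂ) := fun t => 𝓕 (f t a) with hUd
  have hUa : ∀ t θ, U t θ = f t a (𝓕 θ) := fun t θ => TemperedDistribution.fourier_apply _ _
  have hU : ∀ θ : 𝓢(ℝ, ℂ), ∀ t ∈ Ici (0 : ℝ), HasDerivWithinAt (fun s => U s θ)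
      (-(κ * U t (SchwartzMap.derivCLM ℂ ℂ θ)) + E t a * ∫ x, φ x * θ x) (Ici 0) t := by
    intro θ t ht
    have h1 := hsol.vlasov a (𝓕 θ) t ht
    have e1 : (vMul (f t)).dx a (𝓕 θ) = κ * U t (SchwartzMap.derivCLM ℂ ℂ θ) := by
      change (-(vMul (f t)).toLin (PeriodicTest.dx a)) (𝓕 θ) = _
      rw [hdx, map_smul, hUa, ← smulLeft_fourier, map_smul]
      change -((-(2 * Real.pi * Complex.I * κ) : ℂ) • (f t a)
        (SchwartzMap.smulLeftCLM ℂ (fun v : ℝ => (v : ℂ)) (𝓕 θ))) = _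
      simp only [smul_eq_mul]
      ring
    have e2 : ∫ v, ((deriv f₀ v : ℝ) : ℂ) * (𝓕 θ) v = ∫ x, φ x * θ x := by
      simp only [hf₀]
      rw [integral_fourierInv_mul_eq hφ (𝓕 θ : 𝓢(ℝ, ℂ)).integrable, ← SchwartzMap.fourierInv_coe,
        FourierTransform.fourierInv_fourier_eq]
    rw [e1, e2] at h1
    exact h1
  obtain ⟨ρ, hρc, hρ, hρ1⟩ := exists_mollifier
  set R : ℕ → ℝˣ := fun n => Units.mk0 ((n : ℝ) + 1) (by positivity) with hR
  set d : ℕ → 𝓢(ℝ, ℂ) := fun n => (((R n : ℝˣ) : ℝ) : ℂ) • dilate (R n)⁻¹ ρ with hd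
  have hda : ∀ n x, d n x = ((n : ℝ) + 1 : ℝ) * ρ (((n : ℝ) + 1) * x) := by
    intro n x
    simp only [hd, smul_apply, dilate_apply, smul_eq_mul, hR, Units.val_inv_eq_inv_val, inv_inv,
      Units.val_mk0]
  have hχ : (𝓕 ρ : 𝓢(ℝ, ℂ)) 0 = 1 := by
    rw [SchwartzMap.fourier_coe, Real.fourier_real_eq]
    simpa using hρ1
  -- Poisson's equation with the cut-off χ = 𝓕ρ, normalised by χ(0) = ∫ρ = 1. The same sequence is
  -- computed a second time through Duhamel's formula, and the two limits are equated.
  have hL : Tendsto (fun n => U t (d n)) atTop (𝓝 (-(2 * Real.pi * Complex.I * κ) * E t a)) := by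
    have h1 := hsol.poisson a t ht (𝓕 ρ) hχ
    have e1 : -((E t).dx a) = -(2 * Real.pi * Complex.I * κ) * E t a := by
      change -(-(E t).toLin (PeriodicTest.dx a)) = _
      rw [hdx, map_smul, neg_neg, smul_eq_mul]
    rw [e1] at h1
    refine h1.congr fun n => ?_
    rw [hUa]
    congr 1
    exact dilate_fourier (R n) (by simp only [hR, Units.val_mk0]; positivity) ρ
  have hcs : ∀ n, HasCompactSupport ((d n).compSubConstCLM ℂ (κ * t)) := by
    intro n
    refine HasCompactSupport.intro (K := Icc (κ * t - 1) (κ * t + 1)) isCompact_Icc fun x hx => ?_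
    rw [SchwartzMap.compSubConstCLM_apply, hda, hρ, mul_zero]
    by_contra hcon
    apply hx
    have hn : (1 : ℝ) ≤ (n : ℝ) + 1 := by linarith [n.cast_nonneg (α := ℝ)]
    rw [not_lt, abs_mul, abs_of_pos (by linarith)] at hcon
    have : |x - κ * t| ≤ 1 := by nlinarith [abs_nonneg (x - κ * t)]
    rw [abs_le] at this
    constructor <;> linarith
  have hRr : Tendsto (fun n => U t (d n)) atTop
      (𝓝 (G (κ * t) + ∫ τ in 0..t, E τ a * φ (κ * (t - τ)))) := by
    have h1 := tendsto_integral_mul_approx hρ hρ1 (h := fun x => G (x + κ * t))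
      (C := sSup ((fun x => ‖G (x + κ * t)‖) '' Icc (-1) 1))
      (hGc.measurable.comp (by fun_prop)) (fun x hx => ?_)
      (hGc.comp (by fun_prop : Continuous fun x : ℝ => x + κ * t)).continuousAt
    · have h2 := tendsto_duhamel_approx hρ hρ1 hκ (hsol.continuous_field a) hφ ht
      simp only [zero_add] at h1
      refine (h1.add h2).congr fun n => ?_
      rw [transport_eq hκ (hsol.continuous_field a) hφ hU ht (d n)]
      simp only [hda]
      congr 1
      rw [hUa, hG _ (hcs n), ← integral_add_right_eq_self
        (fun x => G x * (d n).compSubConstCLM ℂ (κ * t) x) (κ * t)]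
      simp only [SchwartzMap.compSubConstCLM_apply, hda, add_sub_cancel_right]
    · refine le_csSup ?_ ⟨x, abs_le.1 hx, rfl⟩
      exact (isCompact_Icc.image_of_continuousOn
        ((hGc.comp (by fun_prop : Continuous fun x : ℝ => x + κ * t)).norm.continuousOn)).bddAbove
  exact tendsto_nhds_unique hL hRr

/-! ### Weak derivatives of locally integrable functions -/

theorem exists_support_Icc {θ : ℝ → ℂ} (h : HasCompactSupport θ) :
    ∃ R, 0 < R ∧ ∀ x, x ∉ Ioo (-R) R → θ x = 0 := by
  obtain ⟨R, hR⟩ := h.isBounded.subset_closedBall 0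
  refine ⟨max R 0 + 1, by positivity, fun x hx => ?_⟩
  by_contra hne
  have h1 := hR (subset_tsupport _ hne)
  rw [mem_closedBall_zero_iff, Real.norm_eq_abs, abs_le] at h1
  have := le_max_left R 0
  exact hx ⟨by linarith, by linarith⟩

theorem integral_eq_intervalIntegral_of_support {F : ℝ → ℂ} {R : ℝ} (hR : 0 < R)
    (h : ∀ x, x ∉ Ioo (-R) R → F x = 0) : ∫ x, F x = ∫ x in (-R)..R, F x := by
  rw [intervalIntegral.integral_of_le (by linarith), setIntegral_eq_integral_of_forall_compl_eq_zero]
  exact fun x hx => h x fun h' => hx (Ioo_subset_Ioc_self h')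

/-- A compactly supported Schwartz function of integral zero is the derivative of a compactly
supported one. -/
theorem exists_primitive_of_integral_eq_zero {ζ : 𝓢(ℝ, ℂ)} (hζ : HasCompactSupport ζ)
    (h0 : ∫ x, ζ x = 0) : ∃ η : 𝓢(ℝ, ℂ), HasCompactSupport η ∧ ∀ x, HasDerivAt η (ζ x) x := by
  obtain ⟨R, hR, hs⟩ := exists_support_Icc hζ
  set η : ℝ → ℂ := fun x => ∫ y in (-R)..x, ζ y with hη
  have hd : ∀ x, HasDerivAt η (ζ x) x := fun x =>
    intervalIntegral.integral_hasDerivAt_right (ζ.continuous.intervalIntegrable _ _)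
      (ζ.continuous.stronglyMeasurableAtFilter _ _) ζ.continuous.continuousAt
  have hc : HasCompactSupport η := by
    refine HasCompactSupport.intro (isCompact_Icc (a := -R) (b := R)) fun x hx => ?_
    rcases lt_or_ge x (-R) with h1 | h1
    · simp only [hη]
      rw [intervalIntegral.integral_congr (g := fun _ => 0), intervalIntegral.integral_zero]
      intro y hy
      rw [uIcc_of_ge h1.le] at hy
      exact hs y fun h => by linarith [h.1, hy.2]
    · have h2 : R < x := by
        by_contra h
        exact hx ⟨h1, not_lt.1 h⟩
      simp only [hη]
      rw [← intervalIntegral.integral_add_adjacent_intervals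
        (ζ.continuous.intervalIntegrable (-R) R) (ζ.continuous.intervalIntegrable R x),
        ← integral_eq_intervalIntegral_of_support hR hs, h0, zero_add,
        intervalIntegral.integral_congr (g := fun _ => 0), intervalIntegral.integral_zero]
      intro y hy
      rw [uIcc_of_le h2.le] at hy
      exact hs y fun h => by linarith [h.2, hy.1]
  have hsm : ContDiff ℝ ∞ η := by
    rw [contDiff_infty_iff_deriv]
    refine ⟨fun x => (hd x).differentiableAt, ?_⟩
    rw [show deriv η = ζ from funext fun x => (hd x).deriv]
    exact ζ.smooth ⊤
  exact ⟨hc.toSchwartzMap hsm, hc, hd⟩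

theorem integrable_mul_of_compactSupport {F : ℝ → ℂ} (hF : LocallyIntegrable F) {θ : 𝓢(ℝ, ℂ)}
    (hθ : HasCompactSupport θ) : Integrable fun x => F x * θ x := by
  have := hF.integrable_smul_left_of_hasCompactSupport θ.continuous hθ
  refine this.congr (Eventually.of_forall fun x => ?_)
  simp [mul_comm]

theorem hasCompactSupport_deriv {θ : 𝓢(ℝ, ℂ)} (hθ : HasCompactSupport θ) :
    HasCompactSupport (SchwartzMap.derivCLM ℂ ℂ θ) :=
  HasCompactSupport.deriv (f := θ) hθ

/-- Integration by parts against the primitive of a locally integrable function. -/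
theorem integral_primitive_mul_deriv {H : ℝ → ℂ} (hH : LocallyIntegrable H) {θ : 𝓢(ℝ, ℂ)}
    (hθ : HasCompactSupport θ) :
    ∫ x, (∫ y in 0..x, H y) * SchwartzMap.derivCLM ℂ ℂ θ x = -∫ x, H x * θ x := by
  obtain ⟨R, hR, hs⟩ := exists_support_Icc hθ
  obtain ⟨R', hR', hs'⟩ := exists_support_Icc (hasCompactSupport_deriv hθ)
  set S := max R R' with hS
  have hSp : 0 < S := lt_max_of_lt_left hR
  have hsub : ∀ {r : ℝ}, r ≤ S → ∀ x, x ∉ Ioo (-S) S → x ∉ Ioo (-r) r := fun hr x hx h =>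
    hx ⟨by linarith [h.1], by linarith [h.2]⟩
  have z1 : ∀ x, x ∉ Ioo (-S) S → θ x = 0 := fun x hx => hs x (hsub (le_max_left _ _) x hx)
  have z2 : ∀ x, x ∉ Ioo (-S) S → SchwartzMap.derivCLM ℂ ℂ θ x = 0 :=
    fun x hx => hs' x (hsub (le_max_right _ _) x hx)
  have hint : ∀ a b, IntervalIntegrable H volume a b := fun a b =>
    (hH.integrableOn_isCompact isCompact_uIcc).intervalIntegrable
  set D := SchwartzMap.derivCLM ℂ ℂ θ with hD
  have hftc : ∀ a b : ℝ, ∫ x in a..b, D x = θ b - θ a := fun a b =>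
    intervalIntegral.integral_deriv_eq_sub' θ (by rfl)
      (fun x _ => θ.differentiableAt) D.continuous.continuousOn
  rw [integral_eq_intervalIntegral_of_support hSp (fun x hx => by rw [z2 x hx, mul_zero]),
    integral_eq_intervalIntegral_of_support hSp (fun x hx => by rw [z1 x hx, mul_zero])]
  have e1 : ∀ x, (∫ y in 0..x, H y) = (∫ y in 0..(-S), H y) + ∫ y in (-S)..x, H y := fun x =>
    (intervalIntegral.integral_add_adjacent_intervals (hint _ _) (hint _ _)).symm
  have hcP : Continuous fun x => ∫ y in (-S)..x, H y :=
    intervalIntegral.continuous_primitive hint _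
  have e2 : ∫ x in (-S)..S, (∫ y in 0..x, H y) * D x =
      ∫ x in (-S)..S, (∫ y in (-S)..x, H y) * D x := by
    have e3 : ∀ x, (∫ y in 0..x, H y) * D x =
        (∫ y in 0..(-S), H y) * D x + (∫ y in (-S)..x, H y) * D x := fun x => by
      rw [e1 x, add_mul]
    rw [intervalIntegral.integral_congr fun x _ => e3 x, intervalIntegral.integral_add, intervalIntegral.integral_const_mul, hftc, z1 S (by simp),
      z1 (-S) (by simp), sub_zero, mul_zero, zero_add]
    · exact (continuous_const.mul D.continuous).intervalIntegrable _ _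
    · exact (hcP.mul D.continuous).intervalIntegrable _ _
  rw [e2]
  have hle : -S ≤ S := by linarith
  rw [intervalIntegral.integral_of_le hle, intervalIntegral.integral_of_le hle]
  have hHi : IntegrableOn H (Ioc (-S) S) :=
    (hH.integrableOn_isCompact (isCompact_Icc (a := -S) (b := S))).mono_set Ioc_subset_Icc_self
  have hDi : IntegrableOn D (Ioc (-S) S) := D.integrable.integrableOn
  -- Fubini on the triangle y ≤ x: integrating in x first leaves the increment of θ, which is -θ(y)
  -- because θ(S) = 0.
  have hsw := integral_integral_swap (μ := volume.restrict (Ioc (-S) S))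
    (ν := volume.restrict (Ioc (-S) S))
    (f := fun x y => {p : ℝ × ℝ | p.2 ≤ p.1}.indicator (fun p => D p.1 * H p.2) (x, y)) (by
      refine Integrable.indicator ?_ (measurableSet_le measurable_snd measurable_fst)
      exact Integrable.mul_prod hDi hHi)
  have l1 : ∀ x ∈ Ioc (-S) S, (∫ y in Ioc (-S) S,
      {p : ℝ × ℝ | p.2 ≤ p.1}.indicator (fun p => D p.1 * H p.2) (x, y)) =
      (∫ y in (-S)..x, H y) * D x := by
    intro x hx
    rw [intervalIntegral.integral_of_le hx.1.le, mul_comm, ← integral_const_mul,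
      ← integral_indicator measurableSet_Ioc, ← integral_indicator measurableSet_Ioc]
    congr 1
    ext y
    by_cases h1 : y ∈ Ioc (-S) S
    · by_cases h2 : y ≤ x
      · rw [indicator_of_mem h1, indicator_of_mem (by exact h2),
          indicator_of_mem (by exact ⟨h1.1, h2⟩)]
      · rw [indicator_of_mem h1, indicator_of_notMem (by exact h2),
          indicator_of_notMem (by exact fun h => h2 h.2)]
    · rw [indicator_of_notMem h1, indicator_of_notMem (by exact fun h => h1 ⟨h.1, h.2.trans hx.2⟩)]
  have l2 : ∀ y ∈ Ioc (-S) S, (∫ x in Ioc (-S) S,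
      {p : ℝ × ℝ | p.2 ≤ p.1}.indicator (fun p => D p.1 * H p.2) (x, y)) = -(H y * θ y) := by
    intro y hy
    have h3 : ∫ x in Ioc y S, D x * H y = -(H y * θ y) := by
      rw [integral_mul_const, ← intervalIntegral.integral_of_le hy.2, hftc, z1 S (by simp)]
      ring
    rw [← h3, integral_Ioc_eq_integral_Ioo, ← integral_Icc_eq_integral_Ioc,
      ← integral_indicator measurableSet_Icc, ← integral_indicator measurableSet_Ioo,
      integral_indicator measurableSet_Ioo, ← integral_Ioc_eq_integral_Ioo,
      ← integral_indicator measurableSet_Ioc]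
    congr 1
    ext x
    by_cases h1 : x ∈ Icc y S
    · rw [indicator_of_mem h1, indicator_of_mem (by exact ⟨hy.1.trans_le h1.1, h1.2⟩),
        indicator_of_mem (by exact h1.1)]
    · rw [indicator_of_notMem h1]
      by_cases h2 : x ∈ Ioc (-S) S
      · rw [indicator_of_mem h2, indicator_of_notMem (by exact fun h => h1 ⟨h, h2.2⟩)]
      · rw [indicator_of_notMem h2]
  rw [← setIntegral_congr_fun measurableSet_Ioc l1, hsw,
    setIntegral_congr_fun measurableSet_Ioc l2, integral_neg]

/-- The du Bois-Reymond lemma: a locally integrable function with a locally integrable weak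
derivative is almost everywhere equal to a primitive of the latter. -/
theorem exists_continuous_primitive {G₀ H : ℝ → ℂ} (hG : LocallyIntegrable G₀)
    (hH : LocallyIntegrable H)
    (h : ∀ θ : 𝓢(ℝ, ℂ), HasCompactSupport θ →
      ∫ x, G₀ x * SchwartzMap.derivCLM ℂ ℂ θ x = -∫ x, H x * θ x) :
    ∃ G : ℝ → ℂ, Continuous G ∧ G₀ =ᵐ[volume] G ∧ ∀ a b, G b = G a + ∫ t in a..b, H t := by
  have hint : ∀ a b, IntervalIntegrable H volume a b := fun a b =>
    (hH.integrableOn_isCompact isCompact_uIcc).intervalIntegrable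
  set F : ℝ → ℂ := fun x => ∫ y in 0..x, H y with hF
  have hFc : Continuous F := intervalIntegral.continuous_primitive hint _
  obtain ⟨ρ, hρc, -, hρ1⟩ := exists_mollifier
  have hDl : LocallyIntegrable fun x => G₀ x - F x := hG.sub hFc.locallyIntegrable
  set c : ℂ := ∫ x, (G₀ x - F x) * ρ x with hc
  have key : (fun x => G₀ x - F x) =ᵐ[volume] fun _ => c := by
    refine ae_eq_of_schwartz_pairing hDl continuous_const.locallyIntegrable fun θ hθ => ?_
    set I : ℂ := ∫ x, θ x with hI
    -- Subtracting (∫θ)ρ leaves a test function of integral zero, hence a derivative, against which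
    -- the difference of G₀ and the primitive vanishes. So that difference pairs with θ like the
    -- constant c.
    have hζc : HasCompactSupport (θ - I • ρ : 𝓢(ℝ, ℂ)) :=
      hθ.sub (hρc.smul_left (f := fun _ => I))
    obtain ⟨η, hηc, hη⟩ := exists_primitive_of_integral_eq_zero hζc (by
      change ∫ x, (θ x - I * ρ x) = 0
      rw [integral_sub θ.integrable (ρ.integrable.const_mul I), integral_const_mul, hρ1, mul_one,
        sub_self])
    have h1 : ∀ x, SchwartzMap.derivCLM ℂ ℂ η x = θ x - I * ρ x := fun x => (hη x).deriv
    have h2 : ∫ x, (G₀ x - F x) * (θ x - I * ρ x) = 0 := by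
      simp only [← h1]
      simp only [sub_mul]
      rw [integral_sub (integrable_mul_of_compactSupport hG (hasCompactSupport_deriv hηc))
        (integrable_mul_of_compactSupport hFc.locallyIntegrable (hasCompactSupport_deriv hηc)),
        h η hηc, integral_primitive_mul_deriv hH hηc, sub_self]
    have h3 : ∫ x, (G₀ x - F x) * θ x = I * c := by
      have e : ∀ x, (G₀ x - F x) * (θ x - I * ρ x) =
          (G₀ x - F x) * θ x - I * ((G₀ x - F x) * ρ x) := fun x => by ring
      simp only [e] at h2
      rw [integral_sub (integrable_mul_of_compactSupport hDl hθ)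
        ((integrable_mul_of_compactSupport hDl hρc).const_mul I), integral_const_mul] at h2
      exact sub_eq_zero.1 h2
    rw [integral_mul_const, ← hI, ← h3]
    exact integral_congr_ae (Eventually.of_forall fun x => mul_comm _ _)
  refine ⟨fun x => c + F x, continuous_const.add hFc, ?_, fun a b => ?_⟩
  · filter_upwards [key] with x hx
    rw [← hx, sub_add_cancel]
  · simp only [hF]
    rw [add_assoc, intervalIntegral.integral_add_adjacent_intervals (hint _ _) (hint _ _)]

/-! ### Sobolev spaces on the Fourier side -/

/-- Multiplication by the symbol `(1 + ξ²)^{s/2}` of the Bessel potential. -/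
noncomputable abbrev besselWeighted (s : ℝ) (G : ℝ → ℂ) : ℝ → ℂ :=
  fun ξ => (((1 + ξ ^ 2) ^ (s / 2) : ℝ) : ℂ) * G ξ

theorem continuous_bessel_symbol (s : ℝ) :
    Continuous fun ξ : ℝ => (((1 + ξ ^ 2) ^ (s / 2) : ℝ) : ℂ) := by
  refine Complex.continuous_ofReal.comp ?_
  exact (by fun_prop : Continuous fun ξ : ℝ => 1 + ξ ^ 2).rpow_const fun x => Or.inl (by positivity)

theorem besselWeighted_neg_cancel (s : ℝ) (G : ℝ → ℂ) :
    besselWeighted s (besselWeighted (-s) G) = G := by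
  funext ξ
  have h : (0 : ℝ) < 1 + ξ ^ 2 := by positivity
  simp only [besselWeighted]
  rw [← mul_assoc, ← Complex.ofReal_mul, ← Real.rpow_add h]
  have : s / 2 + -s / 2 = 0 := by ring
  rw [this, Real.rpow_zero, Complex.ofReal_one, one_mul]

/-- The Fourier transform of an element of `H^s` is a function in a weighted `L²` space. -/
theorem exists_fourier_repr {s : ℝ} {u : 𝓢'(ℝ, ℂ)} {w : Lp ℂ 2 (volume : Measure ℝ)}
    (h : TemperedDistribution.besselPotential ℝ ℂ s u = (w : 𝓢'(ℝ, ℂ))) :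
    ∃ G : ℝ → ℂ, Measurable G ∧ MemLp (besselWeighted s G) 2 volume ∧
      eLpNorm (besselWeighted s G) 2 volume = ‖w‖ₑ ∧ ∀ θ : 𝓢(ℝ, ℂ), u (𝓕 θ) = ∫ x, G x * θ x := by
  set z : Lp ℂ 2 (volume : Measure ℝ) := 𝓕 w with hz
  refine ⟨besselWeighted (-s) z, ?_, ?_, ?_, fun θ => ?_⟩
  · exact (continuous_bessel_symbol (-s)).measurable.mul (Lp.stronglyMeasurable z).measurable
  · rw [besselWeighted_neg_cancel]
    exact Lp.memLp z
  · rw [besselWeighted_neg_cancel, ← Lp.enorm_def, ← ofReal_norm, ← ofReal_norm, hz,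
      Lp.norm_fourier_eq]
  · have h1 : 𝓕 (TemperedDistribution.besselPotential ℝ ℂ s u) = (z : 𝓢'(ℝ, ℂ)) := by
      rw [h, Lp.fourier_toTemperedDistribution_eq]
    rw [TemperedDistribution.fourier_besselPotential_eq_smulLeftCLM_fourier_apply] at h1
    -- Testing with the symbol of order -s applied to θ undoes the Bessel potential.
    set θ' : 𝓢(ℝ, ℂ) :=
      SchwartzMap.smulLeftCLM ℂ (fun x : ℝ => (((1 + ‖x‖ ^ 2) ^ (-s / 2) : ℝ) : ℂ)) θ with hθ'
    have hθ'a : ∀ x, θ' x = (((1 + x ^ 2) ^ (-s / 2) : ℝ) : ℂ) * θ x := fun x => by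
      rw [hθ', SchwartzMap.smulLeftCLM_apply_apply (by fun_prop), smul_eq_mul, Real.norm_eq_abs,
        sq_abs]
    have h2 : SchwartzMap.smulLeftCLM ℂ (fun x : ℝ => (((1 + ‖x‖ ^ 2) ^ (s / 2) : ℝ) : ℂ)) θ'
        = θ := by
      ext x
      rw [SchwartzMap.smulLeftCLM_apply_apply (by fun_prop), smul_eq_mul, hθ'a, Real.norm_eq_abs,
        sq_abs]
      exact congrFun (besselWeighted_neg_cancel s θ) x
    have h3 := congrArg (fun v : 𝓢'(ℝ, ℂ) => v θ') h1
    simp only [TemperedDistribution.smulLeftCLM_apply_apply, Lp.toTemperedDistribution_apply] at h3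
    rw [h2, TemperedDistribution.fourier_apply] at h3
    rw [h3]
    refine integral_congr_ae (Eventually.of_forall fun x => ?_)
    simp only [hθ'a, smul_eq_mul]
    ring

/-- The infimum in the norm runs over at most one function, since L² embeds injectively in the
tempered distributions; any representative therefore realises it. -/
theorem exists_fourier_repr_of_sobolevNorm {s : ℝ} {u : 𝓢'(ℝ, ℂ)} (h : sobolevNorm s u < ⊤) :
    ∃ G : ℝ → ℂ, Measurable G ∧ MemLp (besselWeighted s G) 2 volume ∧
      eLpNorm (besselWeighted s G) 2 volume ≤ sobolevNorm s u ∧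
      ∀ θ : 𝓢(ℝ, ℂ), u (𝓕 θ) = ∫ x, G x * θ x := by
  have h' := h
  simp only [sobolevNorm, iInf_lt_iff] at h'
  obtain ⟨w, hw, -⟩ := h'
  obtain ⟨G, hG, hG2, hGn, hGp⟩ := exists_fourier_repr hw
  refine ⟨G, hG, hG2, ?_, hGp⟩
  rw [hGn, sobolevNorm]
  refine le_iInf₂ fun w' hw' => le_of_eq ?_
  have h1 : w - w' ∈ (MeasureTheory.Lp.toTemperedDistributionCLM ℂ
      (volume : Measure ℝ) 2).ker := by
    rw [LinearMap.mem_ker, map_sub, sub_eq_zero]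
    exact hw.symm.trans hw'
  rw [Lp.ker_toTemperedDistributionCLM_eq_bot, Submodule.mem_bot, sub_eq_zero] at h1
  rw [h1]

theorem locallyIntegrable_of_besselWeighted {s : ℝ} {G : ℝ → ℂ}
    (h : MemLp (besselWeighted s G) 2 volume) : LocallyIntegrable G := by
  have h1 : LocallyIntegrable (besselWeighted s G) := h.locallyIntegrable (by norm_num)
  have h2 := besselWeighted_neg_cancel (-s) G
  rw [neg_neg] at h2
  rw [← h2, locallyIntegrable_iff]
  intro K hK
  exact (h1.integrableOn_isCompact hK).continuousOn_mul (continuous_bessel_symbol (-s)).continuousOn hK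

/-- For x ≥ 0 one has 1 + x² ≤ (1 + x)² ≤ 2(1 + x²); the upper bound serves r ≥ 0 and the lower one
r ≤ 0. -/
theorem one_add_rpow_le_bessel (r : ℝ) {x : ℝ} (hx : 0 ≤ x) :
    (1 + x) ^ r ≤ 2 ^ (|r| / 2) * (1 + x ^ 2) ^ (r / 2) := by
  have h0 : (0 : ℝ) < 1 + x ^ 2 := by positivity
  have e : (1 + x) ^ r = ((1 + x) ^ 2) ^ (r / 2) := by
    rw [← Real.rpow_natCast, ← Real.rpow_mul (by positivity)]
    congr 1
    push_cast
    ring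
  rw [e]
  rcases le_total 0 r with hr | hr
  · rw [abs_of_nonneg hr, ← Real.mul_rpow (by norm_num) h0.le]
    refine Real.rpow_le_rpow (by positivity) ?_ (by positivity)
    nlinarith [sq_nonneg (1 - x)]
  · refine (Real.rpow_le_rpow_of_nonpos h0 (by nlinarith) (by linarith)).trans ?_
    refine le_mul_of_one_le_left (by positivity) ?_
    exact Real.one_le_rpow (by norm_num) (by positivity)

/-- The restrictions to the two half-lines of a function in a weighted `L²` space. -/
theorem eLpNorm_weighted_le {r : ℝ} {G : ℝ → ℂ} (hG : MemLp (besselWeighted r G) 2 volume)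
    {σ : ℝ} (hσ : σ = 1 ∨ σ = -1) :
    MemLp (weighted r fun x => G (σ * x)) 2 halfLine ∧
    eLpNorm (weighted r fun x => G (σ * x)) 2 halfLine ≤
      ENNReal.ofReal (2 ^ (|r| / 2)) * eLpNorm (besselWeighted r G) 2 volume := by
  have hmp : MeasurePreserving (fun x : ℝ => σ * x) volume volume := by
    rcases hσ with rfl | rfl
    · simp only [one_mul]
      exact MeasurePreserving.id (volume : Measure ℝ)
    · simpa using Measure.measurePreserving_neg (volume : Measure ℝ)
  have hσ2 : σ ^ 2 = 1 := by rcases hσ with rfl | rfl <;> norm_num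
  have e : besselWeighted r (fun x => G (σ * x)) = besselWeighted r G ∘ fun x => σ * x := by
    funext x
    simp only [besselWeighted, Function.comp, mul_pow, hσ2, one_mul]
  have h1 : MemLp (besselWeighted r fun x => G (σ * x)) 2 volume := by
    rw [e]
    exact hG.comp_measurePreserving hmp
  have h2 : eLpNorm (besselWeighted r fun x => G (σ * x)) 2 volume =
      eLpNorm (besselWeighted r G) 2 volume := by
    rw [e, eLpNorm_comp_measurePreserving hG.aestronglyMeasurable hmp]
  have h3 : ∀ᵐ x ∂halfLine, ‖weighted r (fun x => G (σ * x)) x‖ ≤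
      2 ^ (|r| / 2) * ‖besselWeighted r (fun x => G (σ * x)) x‖ := by
    filter_upwards [ae_restrict_mem measurableSet_Ioi] with x hx
    have hx0 : 0 ≤ x := le_of_lt hx
    simp only [weighted, besselWeighted, norm_mul, Complex.norm_real, Real.norm_eq_abs]
    rw [← mul_assoc, abs_of_nonneg (by positivity : 0 ≤ (1 + x) ^ r),
      abs_of_nonneg (by positivity : 0 ≤ (1 + x ^ 2) ^ (r / 2))]
    exact mul_le_mul_of_nonneg_right (one_add_rpow_le_bessel r hx0) (norm_nonneg _)
  have h4 := h1.restrict (Ioi 0)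
  have hm : AEStronglyMeasurable (weighted r fun x => G (σ * x)) halfLine := by
    have h5 : AEStronglyMeasurable (fun x => G (σ * x)) halfLine := by
      have := besselWeighted_neg_cancel (-r) (fun x => G (σ * x))
      rw [neg_neg] at this
      rw [← this]
      exact (continuous_bessel_symbol (-r)).aestronglyMeasurable.mul h4.aestronglyMeasurable
    refine AEStronglyMeasurable.mul ?_ h5
    refine (Complex.measurable_ofReal.comp ?_).aestronglyMeasurable
    fun_prop
  refine ⟨h4.of_le_mul hm h3, ?_⟩
  refine (eLpNorm_le_mul_eLpNorm_of_ae_le_mul h3 2).trans ?_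
  gcongr
  rw [← h2]
  exact eLpNorm_mono_measure _ Measure.restrict_le_self

/-- A distribution `u` with `u ∈ H^r` and `v u ∈ H^{r'}` has a continuous Fourier transform, whose
derivative is the Fourier transform of `-2πi v u`. -/
theorem exists_continuous_fourier_repr {r r' : ℝ} {u : 𝓢'(ℝ, ℂ)} (h : sobolevNorm r u < ⊤)
    (h' : sobolevNorm r' (TemperedDistribution.smulLeftCLM ℂ (fun v : ℝ => (v : ℂ)) u) < ⊤) :
    ∃ G H : ℝ → ℂ, Continuous G ∧ (∀ a b, G b = G a + ∫ t in a..b, H t) ∧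
      (∀ θ : 𝓢(ℝ, ℂ), u (𝓕 θ) = ∫ x, G x * θ x) ∧
      MemLp (besselWeighted r G) 2 volume ∧
      eLpNorm (besselWeighted r G) 2 volume ≤ sobolevNorm r u ∧
      MemLp (besselWeighted r' H) 2 volume ∧
      eLpNorm (besselWeighted r' H) 2 volume ≤ ENNReal.ofReal (2 * Real.pi) *
        sobolevNorm r' (TemperedDistribution.smulLeftCLM ℂ (fun v : ℝ => (v : ℂ)) u) := by
  obtain ⟨G₀, hGm, hG2, hGn, hGp⟩ := exists_fourier_repr_of_sobolevNorm h
  obtain ⟨H₀, hHm, hH2, hHn, hHp⟩ := exists_fourier_repr_of_sobolevNorm h'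
  set c : ℂ := -(2 * Real.pi * Complex.I) with hc
  have hce : ‖c‖ = 2 * Real.pi := by
    simp [hc, abs_of_pos Real.pi_pos]
  have eH : besselWeighted r' (fun x => c * H₀ x) = c • besselWeighted r' H₀ := by
    funext x
    simp only [besselWeighted, Pi.smul_apply, smul_eq_mul]
    ring
  -- Multiplication by v is differentiation on the dual side, so G₀ has the weak derivative -2πi H₀
  -- and hence a continuous version.
  have hweak : ∀ θ : 𝓢(ℝ, ℂ), HasCompactSupport θ →
      ∫ x, G₀ x * SchwartzMap.derivCLM ℂ ℂ θ x = -∫ x, (c * H₀ x) * θ x := by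
    intro θ _
    rw [← hGp, ← smulLeft_fourier, map_smul]
    have := hHp θ
    rw [TemperedDistribution.smulLeftCLM_apply_apply] at this
    rw [this, smul_eq_mul, ← integral_neg, ← integral_const_mul]
    refine integral_congr_ae (Eventually.of_forall fun x => ?_)
    simp only [hc]
    ring
  have hH2' : MemLp (besselWeighted r' fun x => c * H₀ x) 2 volume := by
    rw [eH]
    exact hH2.const_smul c
  obtain ⟨G, hGc, hGG, hGH⟩ := exists_continuous_primitive (locallyIntegrable_of_besselWeighted hG2)
    (locallyIntegrable_of_besselWeighted hH2') hweak
  have e : besselWeighted r G₀ =ᵐ[volume] besselWeighted r G := by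
    filter_upwards [hGG] with x hx
    simp only [besselWeighted, hx]
  refine ⟨G, fun x => c * H₀ x, hGc, hGH, fun θ => ?_, hG2.ae_eq e, ?_, hH2', ?_⟩
  · rw [hGp]
    refine integral_congr_ae ?_
    filter_upwards [hGG] with x hx
    rw [hx]
  · rwa [← eLpNorm_congr_ae e]
  · rw [eH, eLpNorm_const_smul, ← ofReal_norm, hce]
    gcongr

/-! ### The Fourier transform of the equilibrium profile -/

theorem integrable_of_besselWeighted {m : ℝ} (hm : 1 / 2 < m) {G : ℝ → ℂ}
    (h : MemLp (besselWeighted m G) 2 volume) : Integrable G := by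
  have h1 : MemLp (fun ξ : ℝ => (((1 + ξ ^ 2) ^ (-m / 2) : ℝ) : ℂ)) 2 volume := by
    rw [memLp_two_iff_integrable_sq_norm (continuous_bessel_symbol (-m)).aestronglyMeasurable]
    have h2 := integrable_rpow_neg_one_add_norm_sq (E := ℝ) (μ := volume) (r := 2 * m)
      (by simp; linarith)
    refine h2.congr (Eventually.of_forall fun x => ?_)
    have h0 : (0 : ℝ) ≤ 1 + x ^ 2 := by positivity
    simp only [Complex.norm_real, Real.norm_eq_abs, sq_abs]
    rw [← Real.rpow_natCast ((1 + x ^ 2) ^ (-m / 2)), ← Real.rpow_mul h0]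
    congr 1
    push_cast
    ring
  have h3 := h1.integrable_mul h
  have h4 := besselWeighted_neg_cancel (-m) G
  rw [neg_neg] at h4
  rw [← h4]
  exact h3

theorem one_le_bessel_symbol {s : ℝ} (hs : 0 ≤ s) (ξ : ℝ) : 1 ≤ (1 + ξ ^ 2) ^ (s / 2) :=
  Real.one_le_rpow (by nlinarith [sq_nonneg ξ]) (by positivity)

theorem memLp_of_besselWeighted {s : ℝ} (hs : 0 ≤ s) {G : ℝ → ℂ} (hGm : Measurable G)
    (h : MemLp (besselWeighted s G) 2 volume) : MemLp G 2 volume := by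
  refine h.of_le hGm.aestronglyMeasurable (Eventually.of_forall fun x => ?_)
  rw [norm_mul, Complex.norm_real, Real.norm_eq_abs]
  refine le_mul_of_one_le_left (norm_nonneg _) ?_
  exact (one_le_bessel_symbol hs x).trans (le_abs_self _)

/-- Differentiation costs one order. This turns s₀ > 3/2 into the weight exponent s₀ - 1 > 1/2 for
the transform of f₀'. -/
theorem besselWeighted_mul_id {s : ℝ} {G : ℝ → ℂ} (hGm : Measurable G)
    (h : MemLp (besselWeighted s G) 2 volume) :
    MemLp (besselWeighted (s - 1) fun ξ => 2 * Real.pi * Complex.I * ξ * G ξ) 2 volume := by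
  refine h.of_le_mul (c := 2 * Real.pi) ?_ (Eventually.of_forall fun x => ?_)
  · exact ((continuous_bessel_symbol _).measurable.mul (by fun_prop)).aestronglyMeasurable
  · simp only [norm_mul, Complex.norm_real, Real.norm_eq_abs, Complex.norm_I, Complex.norm_ofNat,
      abs_of_pos Real.pi_pos]
    have h0 : (0 : ℝ) < 1 + x ^ 2 := by positivity
    have h1 : |x| ≤ (1 + x ^ 2) ^ (1 / 2 : ℝ) := by
      rw [← Real.sqrt_eq_rpow]
      exact Real.abs_le_sqrt (by linarith)
    have h2 : (1 + x ^ 2) ^ (s / 2) = (1 + x ^ 2) ^ ((s - 1) / 2) * (1 + x ^ 2) ^ (1 / 2 : ℝ) := by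
      rw [← Real.rpow_add h0]
      congr 1
      ring
    rw [h2, abs_mul, abs_of_nonneg (by positivity : 0 ≤ (1 + x ^ 2) ^ (1 / 2 : ℝ))]
    calc _ = 2 * Real.pi * (|(1 + x ^ 2) ^ ((s - 1) / 2)| * |x| * ‖G x‖) := by ring
      _ ≤ _ := by gcongr

theorem hasDerivAt_fourierInv {p : ℝ → ℂ} (hp : Integrable p)
    (hp' : Integrable fun ξ => 2 * Real.pi * Complex.I * ξ * p ξ) (v : ℝ) :
    HasDerivAt (𝓕⁻ p) (𝓕⁻ (fun ξ : ℝ => 2 * Real.pi * Complex.I * ξ * p ξ) v) v := by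
  have h1 : Integrable fun ξ : ℝ => ξ • p ξ := by
    refine (hp'.const_mul (2 * Real.pi * Complex.I)⁻¹).congr (Eventually.of_forall fun ξ => ?_)
    have : (2 * Real.pi * Complex.I : ℂ) ≠ 0 := by
      simp [Real.pi_ne_zero]
    simp only [Complex.real_smul]
    field_simp
  have h2 := (Real.hasDerivAt_fourier hp h1 (-v)).scomp v (hasDerivAt_neg v)
  have e1 : 𝓕 p ∘ Neg.neg = 𝓕⁻ p := by
    funext x
    exact (Real.fourierInv_eq_fourier_neg p x).symm
  rw [e1] at h2
  refine h2.congr_deriv ?_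
  rw [Real.fourierInv_eq_fourier_neg, neg_one_smul, Real.fourier_real_eq, Real.fourier_real_eq,
    ← integral_neg]
  refine integral_congr_ae (Eventually.of_forall fun x => ?_)
  simp only [Circle.smul_def, smul_eq_mul]
  ring

theorem fourierInv_conj_neg (p : ℝ → ℂ) (v : ℝ) :
    𝓕⁻ (fun ξ => (starRingEnd ℂ) (p (-ξ))) v = (starRingEnd ℂ) (𝓕⁻ p v) := by
  rw [Real.fourierInv_eq_fourier_neg, Real.fourierInv_eq_fourier_neg, Real.fourier_real_eq,
    Real.fourier_real_eq, ← integral_conj, ← integral_neg_eq_self]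
  refine integral_congr_ae (Eventually.of_forall fun x => ?_)
  simp only [Circle.smul_def, smul_eq_mul, map_mul, neg_neg, neg_mul, mul_neg]
  rw [← Circle.coe_inv_eq_conj, ← AddChar.map_neg_eq_inv]

/-- The Fourier transform of a function of class `H^s`, `s > 3/2`. -/
theorem exists_fourier_profile {s : ℝ} (hs : 3 / 2 < s) {f₀ : ℝ → ℝ} (h : MemHs s f₀)
    (hc : Continuous f₀) :
    ∃ p : ℝ → ℂ, Measurable p ∧ (∀ ξ, p (-ξ) = (starRingEnd ℂ) (p ξ)) ∧
      MemLp (besselWeighted s p) 2 volume ∧ ∀ v, HasDerivAt (fun v => (f₀ v : ℂ))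
        (𝓕⁻ (fun ξ : ℝ => 2 * Real.pi * Complex.I * ξ * p ξ) v) v := by
  obtain ⟨hf, w, hw⟩ := h
  obtain ⟨q, hqm, hq2, -, hqp⟩ := exists_fourier_repr hw
  have hqi : Integrable q := integrable_of_besselWeighted (by linarith) hq2
  have hq : ∀ v, (f₀ v : ℂ) = 𝓕⁻ q v := by
    have hqc : Continuous (𝓕⁻ q) := by
      have : 𝓕⁻ q = 𝓕 q ∘ Neg.neg := by
        funext x
        exact Real.fourierInv_eq_fourier_neg q x
      rw [this]
      exact (continuous_fourier hqi).comp continuous_neg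
    have hfc : Continuous fun v => (f₀ v : ℂ) := Complex.continuous_ofReal.comp hc
    have h1 : (fun v => (f₀ v : ℂ)) =ᵐ[volume] 𝓕⁻ q := by
      refine ae_eq_of_schwartz_pairing hfc.locallyIntegrable hqc.locallyIntegrable fun θ _ => ?_
      have h2 := hqp (𝓕⁻ θ)
      rw [FourierTransform.fourier_fourierInv_eq, Lp.toTemperedDistribution_apply] at h2
      have h3 := integral_fourierInv_mul_eq hqi θ.integrable
      rw [← SchwartzMap.fourierInv_coe, ← h2] at h3
      calc ∫ x, θ x * (f₀ x : ℂ) = ∫ x, θ x • (hf.toLp _ : Lp ℂ 2 (volume : Measure ℝ)) x := by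
            refine integral_congr_ae ?_
            filter_upwards [hf.coeFn_toLp] with x hx
            rw [hx, smul_eq_mul]
        _ = ∫ x, θ x * 𝓕⁻ q x := by
            rw [← h3]
            exact integral_congr_ae (Eventually.of_forall fun x => mul_comm _ _)
    exact congrFun ((hfc.ae_eq_iff_eq volume hqc).1 h1)
  -- Reality of f₀ makes q Hermitian only up to null sets. Averaging with the conjugate reflection
  -- gives a representative that is Hermitian at every point, with the same inverse transform.
  set q' : ℝ → ℂ := fun ξ => (starRingEnd ℂ) (q (-ξ)) with hq'
  have hq'm : Measurable q' := Complex.continuous_conj.measurable.comp (hqm.comp measurable_neg)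
  have hq'i : Integrable q' := by
    refine (hqi.comp_neg).norm.mono' hq'm.aestronglyMeasurable (Eventually.of_forall fun x => ?_)
    simp [hq']
  have hq'2 : MemLp (besselWeighted s q') 2 volume := by
    have h1 := hq2.comp_measurePreserving (Measure.measurePreserving_neg (volume : Measure ℝ))
    refine h1.of_le ((continuous_bessel_symbol _).measurable.mul hq'm).aestronglyMeasurable
      (Eventually.of_forall fun x => ?_)
    simp [hq']
  set p : ℝ → ℂ := fun ξ => 2⁻¹ * (q ξ + q' ξ) with hp
  have hpm : Measurable p := (hqm.add hq'm).const_mul _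
  have hp2 : MemLp (besselWeighted s p) 2 volume := by
    have h1 := (hq2.add hq'2).const_mul (2⁻¹ : ℂ)
    refine h1.ae_eq (Eventually.of_forall fun x => ?_)
    simp only [besselWeighted, hp, Pi.add_apply]
    ring
  have hpi : Integrable p := integrable_of_besselWeighted (by linarith) hp2
  have hp'i : Integrable fun ξ => 2 * Real.pi * Complex.I * ξ * p ξ :=
    integrable_of_besselWeighted (by linarith) (besselWeighted_mul_id hpm hp2)
  refine ⟨p, hpm, fun ξ => ?_, hp2, fun v => ?_⟩
  · simp only [hp, hq', map_mul, map_add, neg_neg, Complex.conj_conj, map_inv₀, Complex.conj_ofNat]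
    rw [add_comm]
  · have e : (fun v => (f₀ v : ℂ)) = 𝓕⁻ p := by
      funext x
      have h1 := fourierInv_conj_neg q x
      rw [← hq, Complex.conj_ofReal] at h1
      have h2 : 𝓕⁻ p x = 2⁻¹ * (𝓕⁻ q x + 𝓕⁻ q' x) := by
        simp only [Real.fourierInv_eq_fourier_neg, Real.fourier_real_eq, hp]
        rw [← integral_add, ← integral_const_mul]
        · refine integral_congr_ae (Eventually.of_forall fun y => ?_)
          simp only [Circle.smul_def, smul_eq_mul]
          ring
        · have := (Real.fourierIntegral_convergent_iff (-x)).2 hqi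
          simpa [mul_comm] using this
        · have := (Real.fourierIntegral_convergent_iff (-x)).2 hq'i
          simpa [mul_comm] using this
      rw [h2, h1, ← hq]
      ring
    rw [e]
    exact hasDerivAt_fourierInv hpi hp'i v

theorem deriv_eq_of_hasDerivAt_ofReal {f₀ : ℝ → ℝ} {d : ℂ} {v : ℝ}
    (h : HasDerivAt (fun v => (f₀ v : ℂ)) d v) : ((deriv f₀ v : ℝ) : ℂ) = d := by
  have h1 : HasDerivAt f₀ d.re v := by
    have := Complex.reCLM.hasFDerivAt.comp_hasDerivAt v h
    exact this
  rw [h1.deriv]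
  exact h1.ofReal_comp.unique h

/-! ### Cauchy integrals and the Penrose condition -/

theorem integrable_div_sub {F : ℝ → ℝ} {c C α : ℝ} (hFc : Continuous F) (hF2 : MemLp F 2 volume)
    (hα : 0 < α) (hC : 0 ≤ C) (hH : ∀ v, |F v| ≤ C * |v - c| ^ α) :
    Integrable fun v => F v / (v - c) := by
  set g : ℝ → ℝ := (Ioc (0 : ℝ) 1).indicator fun x => x ^ (α - 1) with hg
  have hgi : Integrable g := by
    rw [hg, integrable_indicator_iff measurableSet_Ioc, ← intervalIntegrable_iff_integrableOn_Ioc_of_le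
      zero_le_one]
    exact intervalIntegral.intervalIntegrable_rpow' (by linarith)
  have hg0 : ∀ x, 0 ≤ g x := fun x => indicator_nonneg (fun y hy => Real.rpow_nonneg hy.1.le _) x
  have hgu : Integrable fun v => C * (g (v - c) + g (-(v - c))) :=
    ((hgi.comp_sub_right c).add (hgi.comp_neg.comp_sub_right c)).const_mul C
  have hsq : Integrable fun v => ‖F v‖ ^ 2 :=
    (memLp_two_iff_integrable_sq_norm hF2.aestronglyMeasurable).1 hF2
  -- Near c the Hölder bound leaves the integrable singularity |v - c|^{α-1}. Away from c the
  -- quotient is at most |F|² + |v - c|⁻², where the last term is below this one.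
  have hj : Integrable fun v : ℝ => 2 * (1 + (v - c) ^ 2)⁻¹ :=
    (integrable_inv_one_add_sq.comp_sub_right c).const_mul 2
  refine ((hgu.add hsq).add hj).mono' ?_ (Eventually.of_forall fun v => ?_)
  · exact (hFc.measurable.div (by fun_prop)).aestronglyMeasurable
  · simp only [Pi.add_apply, norm_div, Real.norm_eq_abs]
    set u := v - c with hu
    have n1 : 0 ≤ C * (g u + g (-u)) := mul_nonneg hC (add_nonneg (hg0 _) (hg0 _))
    have n2 : 0 ≤ |F v| ^ 2 := by positivity
    have n3 : 0 ≤ 2 * (1 + u ^ 2)⁻¹ := by positivity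
    rcases eq_or_ne u 0 with h0 | h0
    · have : |F v| / |u| = 0 := by rw [h0, abs_zero, div_zero]
      rw [this]
      exact add_nonneg (add_nonneg n1 n2) n3
    have hup : 0 < |u| := abs_pos.2 h0
    rcases le_or_gt |u| 1 with h1 | h1
    · have h2 : |F v| / |u| ≤ C * |u| ^ (α - 1) := by
        rw [div_le_iff₀ hup, mul_assoc, ← Real.rpow_add_one hup.ne', sub_add_cancel]
        exact hH v
      have h3 : |u| ^ (α - 1) ≤ g u + g (-u) := by
        rcases lt_or_gt_of_ne h0 with h | h
        · rw [abs_of_neg h] at h1 ⊢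
          have : g (-u) = (-u) ^ (α - 1) := indicator_of_mem (by exact ⟨by linarith, h1⟩) _
          rw [this]
          linarith [hg0 u]
        · rw [abs_of_pos h] at h1 ⊢
          have : g u = u ^ (α - 1) := indicator_of_mem (by exact ⟨h, h1⟩) _
          rw [this]
          linarith [hg0 (-u)]
      have h4 := mul_le_mul_of_nonneg_left h3 hC
      linarith
    · have h2 : |F v| / |u| ≤ |F v| ^ 2 + (|u| ^ 2)⁻¹ := by
        rw [div_eq_mul_inv, ← inv_pow]
        nlinarith [sq_nonneg (|F v| - |u|⁻¹), sq_nonneg (|F v|), sq_nonneg (|u|⁻¹)]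
      have h3 : (|u| ^ 2)⁻¹ ≤ 2 * (1 + u ^ 2)⁻¹ := by
        rw [← sq_abs u, ← div_eq_mul_inv, inv_eq_one_div, div_le_div_iff₀ (by positivity)
          (by positivity)]
        nlinarith
      linarith

/-- Interpolation between the Lipschitz bound, used for |θ| ≤ 1, and the trivial bound 2. -/
theorem norm_exp_sub_one_le (θ : ℝ) {α : ℝ} (h0 : 0 < α) (h1 : α ≤ 1) :
    ‖Complex.exp (Complex.I * θ) - 1‖ ≤ 2 * |θ| ^ α := by
  rcases le_or_gt |θ| 1 with h | h
  · have h2 : |θ| ≤ |θ| ^ α := by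
      simpa using Real.rpow_le_rpow_of_exponent_ge' (abs_nonneg θ) h h0.le h1
    have h3 := Real.norm_exp_I_mul_ofReal_sub_one_le (x := θ)
    rw [Real.norm_eq_abs] at h3
    linarith [Real.rpow_nonneg (abs_nonneg θ) α]
  · have h2 : 1 ≤ |θ| ^ α := Real.one_le_rpow h.le h0.le
    have h3 : ‖Complex.exp (Complex.I * θ) - 1‖ ≤ 1 + 1 := by
      refine (norm_sub_le _ _).trans ?_
      rw [mul_comm, Complex.norm_exp_ofReal_mul_I, norm_one]
    linarith

theorem fourierInv_eq_integral_exp (φ : ℝ → ℂ) (v : ℝ) :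
    𝓕⁻ φ v = ∫ ξ, φ ξ * Complex.exp (2 * Real.pi * Complex.I * ξ * v) := by
  rw [Real.fourierInv_eq_fourier_neg, Real.fourier_real_eq_integral_exp_smul]
  refine integral_congr_ae (Eventually.of_forall fun ξ => ?_)
  simp only [smul_eq_mul]
  rw [mul_comm]
  congr 2
  push_cast
  ring

theorem norm_exp_two_pi (ξ v : ℝ) : ‖Complex.exp (2 * Real.pi * Complex.I * ξ * v)‖ = 1 := by
  rw [show (2 * Real.pi * Complex.I * ξ * v : ℂ) = ((2 * Real.pi * ξ * v : ℝ) : ℂ) * Complex.I by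
    push_cast; ring]
  exact Complex.norm_exp_ofReal_mul_I _

theorem integrable_mul_exp {φ : ℝ → ℂ} (hφ : Integrable φ) (v : ℝ) :
    Integrable fun ξ : ℝ => φ ξ * Complex.exp (2 * Real.pi * Complex.I * ξ * v) := by
  refine hφ.mul_bdd (c := 1) ?_ (Eventually.of_forall fun ξ => (norm_exp_two_pi ξ v).le)
  exact (by fun_prop : Continuous fun ξ : ℝ =>
    Complex.exp (2 * Real.pi * Complex.I * ξ * v)).aestronglyMeasurable

/-- The Fourier transform of an integrable function with `α` moments is `α`-Hölder. -/
theorem exists_holder_fourierInv {φ : ℝ → ℂ} (hφ : Integrable φ) {α : ℝ} (h0 : 0 < α) (h1 : α ≤ 1)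
    (hα : Integrable fun ξ => |ξ| ^ α * ‖φ ξ‖) :
    ∃ C, 0 ≤ C ∧ ∀ v c, ‖𝓕⁻ φ v - 𝓕⁻ φ c‖ ≤ C * |v - c| ^ α := by
  refine ⟨∫ ξ, 2 * (2 * Real.pi) ^ α * (|ξ| ^ α * ‖φ ξ‖), integral_nonneg fun ξ => by positivity,
    fun v c => ?_⟩
  rw [fourierInv_eq_integral_exp, fourierInv_eq_integral_exp,
    ← integral_sub (integrable_mul_exp hφ v) (integrable_mul_exp hφ c), ← integral_mul_const]
  refine norm_integral_le_of_norm_le ((hα.const_mul _).mul_const _)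
    (Eventually.of_forall fun ξ => ?_)
  have e : φ ξ * Complex.exp (2 * Real.pi * Complex.I * ξ * v) -
      φ ξ * Complex.exp (2 * Real.pi * Complex.I * ξ * c) =
      φ ξ * (Complex.exp (2 * Real.pi * Complex.I * ξ * c) *
        (Complex.exp (Complex.I * (2 * Real.pi * ξ * (v - c) : ℝ)) - 1)) := by
    rw [mul_sub, mul_one, ← Complex.exp_add, ← mul_sub]
    congr 3
    push_cast
    ring
  rw [e, norm_mul, norm_mul, norm_exp_two_pi, one_mul]
  have h2 := norm_exp_sub_one_le (2 * Real.pi * ξ * (v - c)) h0 h1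
  rw [abs_mul, abs_mul, abs_of_pos Real.two_pi_pos, Real.mul_rpow (by positivity) (abs_nonneg _),
    Real.mul_rpow (by positivity) (abs_nonneg _)] at h2
  calc _ ≤ ‖φ ξ‖ * (2 * ((2 * Real.pi) ^ α * |ξ| ^ α * |v - c| ^ α)) := by gcongr
    _ = _ := by ring

/-- Parseval's formula on `L¹ ∩ L²`. -/
theorem integral_conj_fourier_mul_fourier {a b : ℝ → ℂ} (ha : Integrable a) (ha2 : MemLp a 2 volume)
    (hb : Integrable b) (hb2 : MemLp b 2 volume) :
    ∫ v, (starRingEnd ℂ) (𝓕 a v) * 𝓕 b v = ∫ ξ, (starRingEnd ℂ) (a ξ) * b ξ := by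
  have h := Lp.inner_fourier_eq (ha2.toLp a) (hb2.toLp b)
  rw [L2.inner_def, L2.inner_def] at h
  have e1 : ∫ v, (starRingEnd ℂ) (𝓕 a v) * 𝓕 b v =
      ∫ v, inner ℂ ((𝓕 (ha2.toLp a) : Lp ℂ 2 (volume : Measure ℝ)) v)
        ((𝓕 (hb2.toLp b) : Lp ℂ 2 (volume : Measure ℝ)) v) := by
    refine integral_congr_ae ?_
    filter_upwards [coeFn_fourier_toLp ha ha2, coeFn_fourier_toLp hb hb2] with v h1 h2
    rw [h1, h2, RCLike.inner_apply, mul_comm]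
  rw [e1, h]
  refine integral_congr_ae ?_
  filter_upwards [ha2.coeFn_toLp, hb2.coeFn_toLp] with v h1 h2
  rw [h1, h2, RCLike.inner_apply, mul_comm]

/-- The pairing of `F = 𝓕⁻ φ` with a Cauchy kernel whose pole is in the upper half-plane. -/
theorem integral_div_sub_complex {φ : ℝ → ℂ} (hφ : Integrable φ) (hφ2 : MemLp φ 2 volume)
    {F : ℝ → ℝ} (hF : ∀ v, (F v : ℂ) = 𝓕⁻ φ v) {z : ℂ} (hz : 0 < z.im) :
    ∫ v, (F v : ℂ) / (v - z) = 2 * Real.pi * Complex.I *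
      ∫ ξ in Ioi 0, φ ξ * Complex.exp (2 * Real.pi * Complex.I * ξ * z) := by
  -- The Cauchy kernel with pole z in the upper half-plane is, up to 2πi, the Fourier transform of
  -- this one-sided exponential, so Parseval's formula turns the Cauchy integral into a half-line
  -- integral of φ.
  set h : ℝ → ℂ := (Ioi (0 : ℝ)).indicator
    fun ξ => Complex.exp (2 * Real.pi * Complex.I * z * ξ) with hh
  have hre : ∀ v : ℝ, (2 * Real.pi * Complex.I * (z - v)).re < 0 := fun v => by
    have : (2 * Real.pi * Complex.I * (z - v)).re = -(2 * Real.pi * z.im) := by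
      simp
    rw [this]
    have := Real.pi_pos
    simp only [Left.neg_neg_iff]
    positivity
  have hi : Integrable h := by
    rw [hh, integrable_indicator_iff measurableSet_Ioi]
    have := integrableOn_exp_mul_complex_Ioi (hre 0) 0
    simpa using this
  have h2 : MemLp h 2 volume := by
    rw [memLp_two_iff_integrable_sq_norm hi.aestronglyMeasurable]
    refine hi.norm.mono' (hi.aestronglyMeasurable.norm.pow 2) (Eventually.of_forall fun ξ => ?_)
    have h1 : ‖h ξ‖ ≤ 1 := by
      by_cases hξ : ξ ∈ Ioi (0 : ℝ)
      · rw [hh, indicator_of_mem hξ, Complex.norm_exp]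
        have h3 := hre 0
        rw [Complex.ofReal_zero, sub_zero] at h3
        rw [Complex.re_mul_ofReal]
        exact Real.exp_le_one_iff.2 (mul_nonpos_of_nonpos_of_nonneg h3.le (le_of_lt hξ))
      · rw [hh, indicator_of_notMem hξ, norm_zero]
        exact zero_le_one
    rw [Real.norm_eq_abs, abs_of_nonneg (by positivity), pow_two]
    exact mul_le_of_le_one_left (norm_nonneg _) h1
  have hFh : ∀ v : ℝ, 𝓕 h v = 1 / (2 * Real.pi * Complex.I * (v - z)) := by
    intro v
    rw [Real.fourier_real_eq_integral_exp_smul]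
    have e : ∀ ξ : ℝ, Complex.exp (((-2 * Real.pi * ξ * v : ℝ) : ℂ) * Complex.I) • h ξ =
        (Ioi (0 : ℝ)).indicator
          (fun ξ : ℝ => Complex.exp (2 * Real.pi * Complex.I * (z - v) * ξ)) ξ := by
      intro ξ
      by_cases hξ : ξ ∈ Ioi (0 : ℝ)
      · rw [hh, indicator_of_mem hξ, indicator_of_mem hξ, smul_eq_mul, ← Complex.exp_add]
        congr 1
        push_cast
        ring
      · rw [hh, indicator_of_notMem hξ, indicator_of_notMem hξ, smul_zero]
    simp only [e]
    rw [integral_indicator measurableSet_Ioi, integral_exp_mul_complex_Ioi (hre v),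
      Complex.ofReal_zero, mul_zero, Complex.exp_zero, neg_div, ← div_neg]
    congr 1
    ring
  set ψ : ℝ → ℂ := fun ξ => (starRingEnd ℂ) (φ ξ) with hψ
  have hψm : AEStronglyMeasurable ψ :=
    Complex.continuous_conj.comp_aestronglyMeasurable hφ.aestronglyMeasurable
  have hψi : Integrable ψ := hφ.norm.mono' hψm (Eventually.of_forall fun x => by simp [hψ])
  have hψ2 : MemLp ψ 2 volume := hφ2.of_le hψm (Eventually.of_forall fun x => by simp [hψ])
  have hFψ : ∀ v, (starRingEnd ℂ) (𝓕 ψ v) = F v := by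
    intro v
    rw [hF, Real.fourierInv_eq_fourier_neg, Real.fourier_real_eq_integral_exp_smul,
      Real.fourier_real_eq_integral_exp_smul, ← integral_conj]
    refine integral_congr_ae (Eventually.of_forall fun ξ => ?_)
    simp only [smul_eq_mul, map_mul, hψ, Complex.conj_conj, ← Complex.exp_conj, Complex.conj_ofReal,
      Complex.conj_I]
    congr 2
    push_cast
    ring
  have hP := integral_conj_fourier_mul_fourier hψi hψ2 hi h2
  simp only [hFψ, hFh] at hP
  simp only [hψ, Complex.conj_conj] at hP
  have hI : (2 * Real.pi * Complex.I : ℂ) ≠ 0 := by simp [Real.pi_ne_zero]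
  have e1 : ∫ v, (F v : ℂ) / (v - z) =
      2 * Real.pi * Complex.I * ∫ v, (F v : ℂ) * (1 / (2 * Real.pi * Complex.I * (v - z))) := by
    rw [← integral_const_mul]
    refine integral_congr_ae (Eventually.of_forall fun v => ?_)
    simp only
    rw [one_div, mul_inv (2 * Real.pi * Complex.I : ℂ), mul_left_comm, mul_inv_cancel_left₀ hI,
      div_eq_mul_inv]
  rw [e1, hP, ← integral_indicator measurableSet_Ioi]
  congr 2
  ext ξ
  by_cases hξ : ξ ∈ Ioi (0 : ℝ)
  · rw [hh, indicator_of_mem hξ, indicator_of_mem hξ]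
    congr 2
    ring
  · rw [hh, indicator_of_notMem hξ, indicator_of_notMem hξ, mul_zero]

theorem norm_exp_upper_le {ξ c ε : ℝ} (hξ : 0 ≤ ξ) (hε : 0 ≤ ε) :
    ‖Complex.exp (2 * Real.pi * Complex.I * ξ * (c + ε * Complex.I))‖ ≤ 1 := by
  rw [Complex.norm_exp]
  refine Real.exp_le_one_iff.2 ?_
  have : (2 * Real.pi * Complex.I * ξ * (c + ε * Complex.I)).re = -(2 * Real.pi * ξ * ε) := by
    simp
  rw [this]
  have := Real.pi_pos
  simp only [Left.neg_nonpos_iff]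
  positivity

/-- The boundary value of the Cauchy transform of `F = 𝓕⁻ φ` at a zero of `F`. -/
theorem integral_div_sub_eq {m : ℝ} (hm : 1 / 2 < m) {φ : ℝ → ℂ} (hφm : Measurable φ)
    (hφw : MemLp (besselWeighted m φ) 2 volume) {F : ℝ → ℝ} (hF : ∀ v, (F v : ℂ) = 𝓕⁻ φ v)
    {c : ℝ} (hc : F c = 0) :
    ((∫ v, F v / (v - c) : ℝ) : ℂ) = 2 * Real.pi * Complex.I *
      ∫ ξ in Ioi 0, φ ξ * Complex.exp (2 * Real.pi * Complex.I * ξ * c) := by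
  have hφ : Integrable φ := integrable_of_besselWeighted hm hφw
  have hφ2 : MemLp φ 2 volume := memLp_of_besselWeighted (by linarith) hφm hφw
  have hFι : (fun v => (F v : ℂ)) = 𝓕 φ ∘ Neg.neg := by
    funext v
    rw [hF]
    exact Real.fourierInv_eq_fourier_neg φ v
  have hFc : Continuous F := by
    have : Continuous fun v => (F v : ℂ) := by
      rw [hFι]
      exact (continuous_fourier hφ).comp continuous_neg
    exact Complex.continuous_re.comp this
  have hF2 : MemLp F 2 volume := by
    have h1 : MemLp (fun v => (F v : ℂ)) 2 volume := by
      rw [hFι]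
      exact (memLp_fourier hφ hφ2).comp_measurePreserving
        (Measure.measurePreserving_neg (volume : Measure ℝ))
    exact h1.re
  -- α uses at most half of the excess m - 1/2, so |ξ|^α φ is still integrable and F is α-Hölder.
  -- Together with F(c) = 0 this makes the real integral absolutely convergent.
  set α : ℝ := min 1 ((m - 1 / 2) / 2) with hα
  have hα0 : 0 < α := lt_min one_pos (by linarith)
  have hα1 : α ≤ 1 := min_le_left _ _
  have hαm : 1 / 2 < m - α := by
    have : α ≤ (m - 1 / 2) / 2 := min_le_right _ _
    linarith
  have hmom : Integrable fun ξ => |ξ| ^ α * ‖φ ξ‖ := by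
    have h1 : Integrable (besselWeighted α φ) := by
      refine integrable_of_besselWeighted hαm ?_
      convert hφw using 1
      funext ξ
      simp only [besselWeighted]
      rw [← mul_assoc, ← Complex.ofReal_mul, ← Real.rpow_add (by positivity)]
      congr 3
      ring
    refine h1.norm.mono' ?_ (Eventually.of_forall fun ξ => ?_)
    · exact ((by fun_prop : Measurable fun ξ : ℝ => |ξ| ^ α).mul hφm.norm).aestronglyMeasurable
    · have h2 : |ξ| ^ α ≤ (1 + ξ ^ 2) ^ (α / 2) := by
        rw [show |ξ| ^ α = (ξ ^ 2) ^ (α / 2) by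
          rw [← sq_abs, ← Real.rpow_natCast, ← Real.rpow_mul (abs_nonneg ξ)]
          congr 1
          push_cast
          ring]
        exact Real.rpow_le_rpow (by positivity) (by linarith) (by positivity)
      simp only [norm_mul, Complex.norm_real, Real.norm_eq_abs, abs_norm]
      rw [abs_of_nonneg (by positivity : 0 ≤ |ξ| ^ α)]
      gcongr
      exact h2.trans (le_abs_self _)
  obtain ⟨C, hC0, hC⟩ := exists_holder_fourierInv hφ hα0 hα1 hmom
  have hint : Integrable fun v => F v / (v - c) := by
    refine integrable_div_sub hFc hF2 hα0 hC0 fun v => ?_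
    have h1 := hC v c
    rw [← hF, ← hF, hc, Complex.ofReal_zero, sub_zero, Complex.norm_real, Real.norm_eq_abs] at h1
    exact h1
  -- The pole descends to c from above. Because |v - c - iε| ≥ |v - c|, the limiting integrand
  -- dominates, and no residue term appears in the limit.
  set ε : ℕ → ℝ := fun n => 1 / ((n : ℝ) + 1) with hε
  have hεp : ∀ n, 0 < ε n := fun n => by simp only [hε]; positivity
  have hεl : Tendsto (fun n => (c : ℂ) + ε n * Complex.I) atTop (𝓝 c) := by
    have h1 : Tendsto ε atTop (𝓝 0) := tendsto_one_div_add_atTop_nhds_zero_nat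
    have h2 : Continuous fun e : ℝ => (c : ℂ) + e * Complex.I := by fun_prop
    have h3 := (h2.tendsto 0).comp h1
    simp only [Complex.ofReal_zero, zero_mul, add_zero] at h3
    exact h3
  have hL : Tendsto (fun n => ∫ v, (F v : ℂ) / (v - (c + ε n * Complex.I))) atTop
      (𝓝 (∫ v, (F v : ℂ) / (v - c))) := by
    have hae : ∀ᵐ v : ℝ, v ≠ c := by simp [ae_iff]
    refine tendsto_integral_of_dominated_convergence (fun v => ‖F v / (v - c)‖) (fun n => ?_)
      hint.norm (fun n => ?_) ?_
    · have : Measurable fun v : ℝ => (F v : ℂ) := Complex.measurable_ofReal.comp hFc.measurable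
      exact (this.div (by fun_prop)).aestronglyMeasurable
    · filter_upwards [hae] with v hv
      simp only [norm_div, Complex.norm_real]
      have h0 : 0 < ‖v - c‖ := norm_pos_iff.2 (sub_ne_zero.2 hv)
      refine div_le_div_of_nonneg_left (norm_nonneg _) h0 ?_
      have h1 := Complex.abs_re_le_norm ((v : ℂ) - (c + ε n * Complex.I))
      simpa using h1
    · filter_upwards [hae] with v hv
      refine Tendsto.div tendsto_const_nhds (tendsto_const_nhds.sub hεl) ?_
      rw [← Complex.ofReal_sub]
      exact_mod_cast sub_ne_zero.2 hv
  have hR : Tendsto (fun n => 2 * Real.pi * Complex.I *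
      ∫ ξ in Ioi 0, φ ξ * Complex.exp (2 * Real.pi * Complex.I * ξ * (c + ε n * Complex.I))) atTop
      (𝓝 (2 * Real.pi * Complex.I *
        ∫ ξ in Ioi 0, φ ξ * Complex.exp (2 * Real.pi * Complex.I * ξ * c))) := by
    refine Tendsto.const_mul _ ?_
    refine tendsto_integral_of_dominated_convergence (fun ξ => ‖φ ξ‖) (fun n => ?_)
      hφ.norm.restrict (fun n => ?_) ?_
    · exact (hφm.mul (by fun_prop)).aestronglyMeasurable
    · filter_upwards [ae_restrict_mem measurableSet_Ioi] with ξ hξ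
      rw [norm_mul]
      exact mul_le_of_le_one_right (norm_nonneg _) (norm_exp_upper_le (le_of_lt hξ) (hεp n).le)
    · refine Eventually.of_forall fun ξ => ?_
      refine Tendsto.const_mul _ ?_
      exact (Complex.continuous_exp.tendsto _).comp (hεl.const_mul _)
  have heq : ∀ n, ∫ v, (F v : ℂ) / (v - (c + ε n * Complex.I)) = 2 * Real.pi * Complex.I *
      ∫ ξ in Ioi 0, φ ξ * Complex.exp (2 * Real.pi * Complex.I * ξ * (c + ε n * Complex.I)) :=
    fun n => integral_div_sub_complex hφ hφ2 hF (by simpa using hεp n)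
  simp only [heq] at hL
  rw [← tendsto_nhds_unique hL hR, ← integral_complex_ofReal]
  refine integral_congr_ae (Eventually.of_forall fun v => ?_)
  simp only [Complex.ofReal_div, Complex.ofReal_sub]

/-- By the Hermitian symmetry the negative half-line contributes the conjugate of the positive one.
Hence F(c) is twice the real part of the half-line integral. -/
theorem fourierInv_eq_add_conj {φ : ℝ → ℂ} (hφ : Integrable φ)
    (hsymm : ∀ ξ, φ (-ξ) = (starRingEnd ℂ) (φ ξ)) (c : ℝ) :
    𝓕⁻ φ c = (∫ ξ in Ioi 0, φ ξ * Complex.exp (2 * Real.pi * Complex.I * ξ * c)) +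
      (starRingEnd ℂ) (∫ ξ in Ioi 0, φ ξ * Complex.exp (2 * Real.pi * Complex.I * ξ * c)) := by
  have hi := integrable_mul_exp hφ c
  rw [fourierInv_eq_integral_exp, ← integral_conj, ← integral_add_compl measurableSet_Ioi hi]
  congr 1
  rw [compl_Ioi]
  have h1 := integral_comp_neg_Ioi 0
    (fun ξ : ℝ => φ ξ * Complex.exp (2 * Real.pi * Complex.I * ξ * c))
  rw [neg_zero] at h1
  rw [← h1]
  refine integral_congr_ae (Eventually.of_forall fun ξ => ?_)
  simp only [hsymm, map_mul, ← Complex.exp_conj, Complex.conj_ofReal, Complex.conj_I,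
    Complex.conj_ofNat]
  congr 2
  push_cast
  ring

/-- The Penrose stability condition. -/
theorem penrose_ne_zero {m : ℝ} (hm : 1 / 2 < m) {φ : ℝ → ℂ} (hφm : Measurable φ)
    (hφw : MemLp (besselWeighted m φ) 2 volume) (hsymm : ∀ ξ, φ (-ξ) = (starRingEnd ℂ) (φ ξ))
    {F : ℝ → ℝ} (hF : ∀ v, (F v : ℂ) = 𝓕⁻ φ v) {l : ℝ}
    (hl : ∀ c, F c = 0 → l * ∫ v, F v / (v - c) ≠ (2 * Real.pi) ^ 2) (c : ℝ) :
    1 - (l : ℂ) * (Complex.I / (2 * Real.pi) *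
      ∫ ξ in Ioi 0, φ ξ * Complex.exp (2 * Real.pi * Complex.I * ξ * c)) ≠ 0 := by
  intro h
  set B := ∫ ξ in Ioi 0, φ ξ * Complex.exp (2 * Real.pi * Complex.I * ξ * c) with hB
  have hpi : (Real.pi : ℂ) ≠ 0 := by exact_mod_cast Real.pi_ne_zero
  -- Since l is real, lB is purely imaginary. This forces its real part, and with it F(c), to
  -- vanish, and then the Cauchy integral at c gives the forbidden value (2π)².
  have h1 : (l : ℂ) * B = -(2 * Real.pi * Complex.I) := by
    have h2 : (l : ℂ) * (Complex.I / (2 * Real.pi) * B) = 1 := (sub_eq_zero.1 h).symm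
    field_simp at h2
    linear_combination -Complex.I * h2 + (l : ℂ) * B * Complex.I_sq
  have hl0 : (l : ℂ) ≠ 0 := by
    intro h0
    rw [h0, zero_mul] at h1
    have : (2 * Real.pi * Complex.I : ℂ) ≠ 0 := by simp [Real.pi_ne_zero]
    exact this (neg_eq_zero.1 h1.symm)
  have h3 : (l : ℂ) * (starRingEnd ℂ) B = 2 * Real.pi * Complex.I := by
    have := congrArg (starRingEnd ℂ) h1
    rw [map_mul, Complex.conj_ofReal] at this
    rw [this]
    simp only [map_neg, map_mul, Complex.conj_ofReal, Complex.conj_I, Complex.conj_ofNat]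
    ring
  have h4 : F c = 0 := by
    have h5 := fourierInv_eq_add_conj (integrable_of_besselWeighted hm hφw) hsymm c
    rw [← hF, ← hB] at h5
    have h6 : (l : ℂ) * F c = 0 := by rw [h5, mul_add, h1, h3]; ring
    exact_mod_cast (mul_eq_zero.1 h6).resolve_left hl0
  refine hl c h4 ?_
  have h7 := integral_div_sub_eq hm hφm hφw hF h4
  rw [← hB] at h7
  have h8 : ((l * ∫ v, F v / (v - c) : ℝ) : ℂ) = (((2 * Real.pi) ^ 2 : ℝ) : ℂ) := by
    rw [Complex.ofReal_mul, h7]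
    push_cast
    linear_combination (2 * Real.pi * Complex.I) * h1 - 4 * Real.pi ^ 2 * Complex.I_sq
  exact_mod_cast h8

/-! ### Estimates for a single mode, uniform in the wave number -/

/-- The kernel of the Volterra equation for the modes of sign `σ`, in the rescaled time. -/
noncomputable def fieldKernel (φ : ℝ → ℂ) (σ : ℝ) : ℝ → ℂ :=
  fun y => σ * Complex.I / (2 * Real.pi) * φ (σ * y)

theorem memLp_fieldKernel {m : ℝ} {φ : ℝ → ℂ} (hφw : MemLp (besselWeighted m φ) 2 volume) {σ : ℝ}
    (hσ : σ = 1 ∨ σ = -1) : MemLp (weighted m (fieldKernel φ σ)) 2 halfLine := by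
  have h := (eLpNorm_weighted_le hφw hσ).1.const_mul (σ * Complex.I / (2 * Real.pi) : ℂ)
  refine h.ae_eq (Eventually.of_forall fun x => ?_)
  simp only [weighted, fieldKernel]
  ring

/-- For positive modes this is the Penrose condition at c = -η; for negative modes it is the complex
conjugate of the condition at c = η, by the Hermitian symmetry of φ. -/
theorem fieldKernel_ne_zero {m : ℝ} (hm : 1 / 2 < m) {φ : ℝ → ℂ} (hφm : Measurable φ)
    (hφw : MemLp (besselWeighted m φ) 2 volume) (hsymm : ∀ ξ, φ (-ξ) = (starRingEnd ℂ) (φ ξ))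
    {F : ℝ → ℝ} (hF : ∀ v, (F v : ℂ) = 𝓕⁻ φ v) {l : ℝ}
    (hl : ∀ c, F c = 0 → l * ∫ v, F v / (v - c) ≠ (2 * Real.pi) ^ 2) {σ : ℝ}
    (hσ : σ = 1 ∨ σ = -1) (η : ℝ) :
    1 - (l : ℂ) * 𝓕 ((Ioi 0).indicator (fieldKernel φ σ)) η ≠ 0 := by
  have e : 𝓕 ((Ioi 0).indicator (fieldKernel φ σ)) η =
      ∫ y in Ioi 0, Complex.exp (((-2 * Real.pi * y * η : ℝ) : ℂ) * Complex.I) *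
        (σ * Complex.I / (2 * Real.pi) * φ (σ * y)) := by
    rw [Real.fourier_real_eq_integral_exp_smul, ← integral_indicator measurableSet_Ioi]
    refine integral_congr_ae (Eventually.of_forall fun y => ?_)
    by_cases hy : y ∈ Ioi (0 : ℝ)
    · simp only [indicator_of_mem hy, fieldKernel, smul_eq_mul]
    · simp only [indicator_of_notMem hy, smul_zero]
  have hP := penrose_ne_zero hm hφm hφw hsymm hF hl
  rw [e]
  rcases hσ with rfl | rfl
  · convert hP (-η) using 3
    rw [← integral_const_mul]
    refine integral_congr_ae (Eventually.of_forall fun y => ?_)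
    simp only [one_mul, Complex.ofReal_one]
    rw [mul_comm, mul_assoc]
    congr 3
    push_cast
    ring
  · intro h0
    refine hP η ?_
    have h1 := congrArg (starRingEnd ℂ) h0
    rw [map_zero, map_sub, map_one, map_mul, Complex.conj_ofReal, ← integral_conj] at h1
    rw [← h1, ← integral_const_mul]
    congr 2
    refine integral_congr_ae (Eventually.of_forall fun y => ?_)
    simp only [neg_one_mul, hsymm, map_mul, map_div₀, ← Complex.exp_conj, Complex.conj_ofReal,
      Complex.conj_I, Complex.conj_ofNat, Complex.conj_conj]
    have e5 : Complex.exp (((-2 * Real.pi * y * η : ℝ) : ℂ) * -Complex.I) =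
        Complex.exp (2 * Real.pi * Complex.I * y * η) := by
      congr 1
      push_cast
      ring
    rw [e5]
    push_cast
    ring

/-- Equality with some l ≤ T² would make the integral at a critical point at least (2π/T)², hence T₀
≤ T. The whole interval of l is needed: it contains the couplings T²/k² of all modes and the segment
used by the continuity method. -/
theorem mul_integral_ne_of_lt_criticalPeriod {f₀ : ℝ → ℝ} {T : ℝ} (hT : 0 < T)
    (hT₀ : ENNReal.ofReal T < criticalPeriod f₀) {l : ℝ} (hl : l ∈ Icc 0 (T ^ 2)) {c : ℝ}
    (hc : deriv f₀ c = 0) : l * ∫ v, deriv f₀ v / (v - c) ≠ (2 * Real.pi) ^ 2 := by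
  intro h
  refine not_le.2 hT₀ ?_
  have hpi := Real.two_pi_pos
  set I := ∫ v, deriv f₀ v / (v - c) with hI
  have hl0 : 0 < l := by
    rcases hl.1.eq_or_lt with h0 | h0
    · rw [← h0, zero_mul] at h
      have : 0 < (2 * Real.pi) ^ 2 := by positivity
      linarith
    · exact h0
  have hIge : (2 * Real.pi / T) ^ 2 ≤ I := by
    rw [div_pow, div_le_iff₀ (by positivity), ← h, mul_comm]
    have hI0 : 0 ≤ I := by
      by_contra hneg
      have : l * I < 0 := mul_neg_of_pos_of_neg hl0 (not_le.1 hneg)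
      have : 0 < (2 * Real.pi) ^ 2 := by positivity
      linarith
    exact mul_le_mul_of_nonneg_left hl.2 hI0
  have hS : ENNReal.ofReal (2 * Real.pi / T) ≤
      (⨆ (c : ℝ) (_ : deriv f₀ c = 0), ENNReal.ofReal (∫ v, deriv f₀ v / (v - c))) ^
        (1 / 2 : ℝ) := by
    have h1 : ENNReal.ofReal (2 * Real.pi / T) =
        (ENNReal.ofReal ((2 * Real.pi / T) ^ 2)) ^ (1 / 2 : ℝ) := by
      rw [ENNReal.ofReal_rpow_of_nonneg (by positivity) (by norm_num), ← Real.sqrt_eq_rpow,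
        Real.sqrt_sq (by positivity)]
    rw [h1]
    refine ENNReal.rpow_le_rpow ?_ (by norm_num)
    exact (ENNReal.ofReal_le_ofReal hIge).trans
      (le_iSup₂ (f := fun (c : ℝ) (_ : deriv f₀ c = 0) =>
        ENNReal.ofReal (∫ v, deriv f₀ v / (v - c))) c hc)
  rw [criticalPeriod]
  refine (ENNReal.div_le_div_left hS _).trans ?_
  rw [← ENNReal.ofReal_div_of_pos (by positivity), div_div_cancel₀ hpi.ne']

/-- The Volterra equation of a single mode in the rescaled time `y = |k| t / T`. -/
theorem IsSolution.rescaled_volterra {f₀ : ℝ → ℝ} {T : ℝ} (hT : 0 < T)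
    {f : ℝ → PeriodicDistribution T 𝓢'(ℝ, ℂ)} {E : ℝ → PeriodicDistribution T ℂ}
    (hsol : IsSolution f₀ f E) {φ : ℝ → ℂ} (hφ : Integrable φ)
    (hf₀ : ∀ v, ((deriv f₀ v : ℝ) : ℂ) = 𝓕⁻ φ v) {k : ℤ} (hk : k ≠ 0) {σ : ℝ}
    (hσ : σ = 1 ∨ σ = -1) (hkσ : (k : ℝ) = σ * |(k : ℝ)|) {G : ℝ → ℂ}
    (hGc : Continuous G)
    (hG : ∀ θ : 𝓢(ℝ, ℂ), HasCompactSupport θ →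
      f 0 (PeriodicTest.mode T (-k)) (𝓕 θ) = ∫ x, G x * θ x) {x : ℝ} (hx : 0 ≤ x) :
    E (x * (T / |(k : ℝ)|)) (PeriodicTest.mode T (-k)) =
      σ * Complex.I * T / (2 * Real.pi * |(k : ℝ)|) * G (σ * x) +
        ((T ^ 2 / |(k : ℝ)| ^ 2 : ℝ) : ℂ) * ∫ y in Ioo 0 x, fieldKernel φ σ (x - y) *
          E (y * (T / |(k : ℝ)|)) (PeriodicTest.mode T (-k)) := by
  set n : ℝ := |(k : ℝ)| with hn
  have hn0 : 0 < n := abs_pos.2 (by exact_mod_cast hk)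
  have hσ2 : (σ : ℂ) * σ = 1 := by
    rcases hσ with rfl | rfl <;> norm_num
  set ε : ℝ → ℂ := fun t => E t (PeriodicTest.mode T (-k)) with hε
  have hc : 0 < T / n := by positivity
  have h := hsol.volterra hT hφ hf₀ hk hGc hG (t := x * (T / n)) (by positivity)
  have e1 : (k : ℝ) / T * (x * (T / n)) = σ * x := by
    rw [hkσ]
    field_simp
  have e2 : ∫ τ in 0..(x * (T / n)), ε τ * φ (k / T * (x * (T / n) - τ)) =
      ((T / n : ℝ) : ℂ) * ∫ y in Ioo 0 x, φ (σ * (x - y)) * ε (y * (T / n)) := by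
    have h1 := intervalIntegral.integral_comp_mul_right (a := 0) (b := x)
      (fun τ => ε τ * φ (k / T * (x * (T / n) - τ))) hc.ne'
    rw [zero_mul, eq_inv_smul_iff₀ hc.ne', Complex.real_smul] at h1
    rw [← h1, intervalIntegral.integral_of_le hx, integral_Ioc_eq_integral_Ioo]
    congr 1
    refine integral_congr_ae (Eventually.of_forall fun y => ?_)
    have e3 : (k : ℝ) / T * (x * (T / n) - y * (T / n)) = σ * (x - y) := by
      rw [hkσ]
      field_simp
    simp only [e3]
    rw [mul_comm]
  have e4 : ∫ y in Ioo 0 x, fieldKernel φ σ (x - y) * ε (y * (T / n)) =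
      σ * Complex.I / (2 * Real.pi) * ∫ y in Ioo 0 x, φ (σ * (x - y)) * ε (y * (T / n)) := by
    rw [← integral_const_mul]
    refine integral_congr_ae (Eventually.of_forall fun y => ?_)
    simp only [fieldKernel]
    ring
  rw [e1, e2, hkσ] at h
  rw [e4]
  set J := ∫ y in Ioo 0 x, φ (σ * (x - y)) * ε (y * (T / n)) with hJ
  set z := ε (x * (T / n)) with hz
  change z = _
  have hTc : (T : ℂ) ≠ 0 := by exact_mod_cast hT.ne'
  have hnc : (n : ℂ) ≠ 0 := by exact_mod_cast hn0.ne'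
  have hpi : (Real.pi : ℂ) ≠ 0 := by exact_mod_cast Real.pi_ne_zero
  replace h : -(2 * Real.pi * Complex.I * ((σ * n / T : ℝ) : ℂ)) * z =
      G (σ * x) + ((T / n : ℝ) : ℂ) * J := h
  push_cast at h ⊢
  have h5 : z = (σ * Complex.I * T / (2 * Real.pi * n)) * (G (σ * x) + T / n * J) := by
    have h6 : (σ * Complex.I * T / (2 * Real.pi * n)) *
        (-(2 * Real.pi * Complex.I * (σ * n / T)) * z) = -(Complex.I ^ 2 * (σ * σ)) * z := by
      field_simp
    rw [← h, h6, hσ2, Complex.I_sq]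
    ring
  rw [h5]
  field_simp

/-- Removing the spatial average does not affect the nonzero modes, so g may replace the initial
datum there. -/
theorem integral_mode_eq_zero {T : ℝ} (hT : 0 < T) {k : ℤ} (hk : k ≠ 0) :
    ∫ x in (0 : ℝ)..T, (PeriodicTest.mode T k).1 x = 0 := by
  set c : ℂ := 2 * Real.pi * Complex.I * (k / T : ℝ) with hc
  have hTc : (T : ℂ) ≠ 0 := by exact_mod_cast hT.ne'
  have hkc : (k : ℂ) ≠ 0 := by exact_mod_cast hk
  have hc0 : c ≠ 0 := by
    rw [hc]
    push_cast
    have : (2 * Real.pi * Complex.I : ℂ) ≠ 0 := by simp [Real.pi_ne_zero]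
    exact mul_ne_zero this (div_ne_zero hkc hTc)
  have e : ∀ x : ℝ, (PeriodicTest.mode T k).1 x = Complex.exp (c * x) := by
    intro x
    change Complex.exp _ = _
    congr 1
    rw [hc]
    push_cast
    ring
  simp only [e]
  rw [integral_exp_mul_complex hc0, Complex.ofReal_zero, mul_zero, Complex.exp_zero]
  have : c * T = k * (2 * Real.pi * Complex.I) := by
    rw [hc]
    push_cast
    field_simp
  rw [this, Complex.exp_int_mul_two_pi_mul_I, sub_self, zero_div]

/-- Decay in the rescaled time nt/T is decay in t together with a gain of n^{-r}. -/
theorem rpow_mul_one_add_rpow_neg_le {t n T r : ℝ} (ht : 0 < t) (hn : 0 < n) (hT : 0 < T)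
    (hr : 0 ≤ r) : t ^ r * (1 + n * t / T) ^ (-r) ≤ T ^ r * n ^ (-r) := by
  have h1 : (1 + n * t / T) ^ (-r) ≤ (n * t / T) ^ (-r) :=
    Real.rpow_le_rpow_of_nonpos (by positivity) (by linarith) (by linarith)
  calc t ^ r * (1 + n * t / T) ^ (-r) ≤ t ^ r * (n * t / T) ^ (-r) := by gcongr
    _ = T ^ r * n ^ (-r) := by
      rw [Real.div_rpow (by positivity) hT.le, Real.mul_rpow hn.le ht.le, Real.rpow_neg ht.le,
        Real.rpow_neg hT.le]
      have : t ^ r ≠ 0 := (Real.rpow_pos_of_pos ht r).ne'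
      field_simp

theorem ofReal_rpow_mul_ofReal_rpow {n : ℝ} (hn : 0 < n) (x y : ℝ) :
    ENNReal.ofReal (n ^ x) * ENNReal.ofReal (n ^ y) = ENNReal.ofReal (n ^ (x + y)) := by
  rw [← ENNReal.ofReal_mul (by positivity), ← Real.rpow_add hn]

/-- The decay estimate for the modes of a given sign, uniformly in the mode. -/
theorem exists_mode_bound_sign {f₀ : ℝ → ℝ} {m : ℝ} (hm : 1 / 2 < m) {T : ℝ} (hT : 0 < T)
    (hT₀ : ENNReal.ofReal T < criticalPeriod f₀)
    {f : ℝ → PeriodicDistribution T 𝓢'(ℝ, ℂ)} {E : ℝ → PeriodicDistribution T ℂ}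
    (hsol : IsSolution f₀ f E) {g : PeriodicDistribution T 𝓢'(ℝ, ℂ)}
    (hg : ∀ a : PeriodicTest T, g a = f 0 a - (∫ x in (0 : ℝ)..T, a.1 x) •
      ((T : ℂ)⁻¹ • f 0 (PeriodicTest.one T)))
    {φ : ℝ → ℂ} (hφm : Measurable φ) (hφw : MemLp (besselWeighted m φ) 2 volume)
    (hsymm : ∀ ξ, φ (-ξ) = (starRingEnd ℂ) (φ ξ))
    (hf₀ : ∀ v, ((deriv f₀ v : ℝ) : ℂ) = 𝓕⁻ φ v)
    {r r' : ℝ} (hr : -(1 / 2) ≤ r) (hrm : |r| ≤ m) (hrm' : |r'| ≤ m) (hrr : 0 ≤ r + r')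
    {σ : ℝ} (hσ : σ = 1 ∨ σ = -1) :
    ∃ C : ℝ≥0∞, C ≠ ⊤ ∧ ∀ k : ℤ, k ≠ 0 → (k : ℝ) = σ * |(k : ℝ)| →
      sobolevNorm r (g.coeff k) < ⊤ → sobolevNorm r' ((vMul g).coeff k) < ⊤ →
      ∃ τ : ℝ → ℝ≥0∞, Tendsto τ atTop (𝓝 0) ∧
        (∀ t, 0 ≤ t → τ t ≤
          C * (ENNReal.ofReal (|(k : ℝ)| ^ (-1 : ℝ)) * sobolevNorm r (g.coeff k))) ∧
        ∀ t, 1 ≤ t → ENNReal.ofReal (t ^ (r + r')) * ‖(E t).coeff k‖ₑ ^ 2 ≤ C * τ t *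
          (ENNReal.ofReal (|(k : ℝ)| ^ (-(r + r') - 1)) * sobolevNorm r' ((vMul g).coeff k) +
            ENNReal.ofReal (|(k : ℝ)| ^ (-(r + m) - 3)) *
              (sobolevNorm r (g.coeff k) * sobolevNorm r' ((vMul g).coeff k)) ^ (1 / 2 : ℝ)) := by
  have hφ : Integrable φ := integrable_of_besselWeighted hm hφw
  have hKm : Measurable (fieldKernel φ σ) :=
    (hφm.comp (measurable_const_mul σ)).const_mul _
  obtain ⟨C, hC⟩ := exists_decay_bound (Λ := T ^ 2) hm hKm (memLp_fieldKernel hφw hσ)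
    (fun l hl η => fieldKernel_ne_zero hm hφm hφw hsymm hf₀
      (fun c hc => mul_integral_ne_of_lt_criticalPeriod hT hT₀ hl hc) hσ η)
    hr ((le_abs_self r).trans hrm) ((le_abs_self r').trans hrm') hrr
  have hrm0 : 0 ≤ r + m := by linarith [neg_abs_le r]
  set D₁ : ℝ≥0∞ := ENNReal.ofReal (T ^ 2 / (2 * Real.pi) * 2 ^ (|r| / 2)) with hD₁
  set D₂ : ℝ≥0∞ := ENNReal.ofReal (T ^ 2 / (2 * Real.pi) * 2 ^ (|r'| / 2) * (2 * Real.pi)) with hD₂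
  set V₁ : ℝ≥0∞ := ENNReal.ofReal (T ^ (r + r')) with hV₁
  set V₂ : ℝ≥0∞ := ENNReal.ofReal (T ^ (r + m)) with hV₂
  set V₃ : ℝ≥0∞ := ENNReal.ofReal (T ^ 2) with hV₃
  set S : ℝ≥0∞ := ENNReal.ofReal T⁻¹ ^ 2 with hS
  set Z : ℝ≥0∞ := (D₁ * D₂) ^ (1 / 2 : ℝ) with hZ
  have hZt : Z ≠ ⊤ := ENNReal.rpow_ne_top_of_nonneg (by norm_num)
    (ENNReal.mul_ne_top ENNReal.ofReal_ne_top ENNReal.ofReal_ne_top)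
  refine ⟨C * D₁ + S * C * (V₁ * D₂ + V₃ * V₂ * Z), by finiteness, fun k hk hkσ ha hb => ?_⟩
  set a := sobolevNorm r (g.coeff k) with had
  set b := sobolevNorm r' ((vMul g).coeff k) with hbd
  set n : ℝ := |(k : ℝ)| with hn
  have hn1 : 1 ≤ n := by
    rw [hn, ← Int.cast_abs]
    exact_mod_cast Int.one_le_abs hk
  have hn0 : 0 < n := by linarith
  have hvc : (vMul g).coeff k =
      TemperedDistribution.smulLeftCLM ℂ (fun v : ℝ => (v : ℂ)) (g.coeff k) := by
    change _ • TemperedDistribution.smulLeftCLM ℂ (fun v : ℝ => (v : ℂ)) _ =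
      TemperedDistribution.smulLeftCLM ℂ (fun v : ℝ => (v : ℂ)) (_ • _)
    rw [map_smul]
  have hb' := hb
  rw [hbd, hvc] at hb'
  obtain ⟨G, H, hGc, hGH, hGp, hG2, hGn, hH2, hHn⟩ := exists_continuous_fourier_repr ha hb'
  rw [← hvc, ← hbd] at hHn
  have hTc : (T : ℂ) ≠ 0 := by exact_mod_cast hT.ne'
  have hGT : ∀ θ : 𝓢(ℝ, ℂ), HasCompactSupport θ →
      f 0 (PeriodicTest.mode T (-k)) (𝓕 θ) = ∫ x, T * G x * θ x := by
    intro θ _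
    have h1 := hGp θ
    have h2 : g.coeff k = (T : ℂ)⁻¹ • f 0 (PeriodicTest.mode T (-k)) := by
      ext ψ
      change (T : ℂ)⁻¹ * g (PeriodicTest.mode T (-k)) ψ =
        (T : ℂ)⁻¹ * f 0 (PeriodicTest.mode T (-k)) ψ
      rw [hg, integral_mode_eq_zero hT (neg_ne_zero.2 hk)]
      change (T : ℂ)⁻¹ * (f 0 (PeriodicTest.mode T (-k)) ψ - 0 * _) = _
      rw [zero_mul, sub_zero]
    rw [h2] at h1
    change (T : ℂ)⁻¹ • f 0 (PeriodicTest.mode T (-k)) (𝓕 θ) = _ at h1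
    rw [smul_eq_mul, inv_mul_eq_iff_eq_mul₀ hTc, ← integral_const_mul] at h1
    rw [h1]
    refine integral_congr_ae (Eventually.of_forall fun x => ?_)
    simp only
    ring
  -- The first factor comes from Poisson's equation. The extra T undoes the normalisation of the
  -- Fourier coefficient, since G represents `g.coeff k`.
  set c : ℂ := σ * Complex.I * T / (2 * Real.pi * n) * T with hc
  have hσn : ‖(σ : ℂ)‖ = 1 := by rcases hσ with rfl | rfl <;> simp
  have hcn : ‖c‖ₑ = ENNReal.ofReal (T ^ 2 / (2 * Real.pi) * n ^ (-1 : ℝ)) := by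
    rw [← ofReal_norm]
    congr 1
    rw [hc, Real.rpow_neg_one]
    simp only [norm_mul, norm_div, hσn, Complex.norm_I, Complex.norm_real, Real.norm_eq_abs,
      abs_of_pos hT, abs_of_pos Real.pi_pos, abs_of_pos hn0, Complex.norm_ofNat]
    field_simp
  set l : ℝ := T ^ 2 / n ^ 2 with hl
  have hlm : l ∈ Icc 0 (T ^ 2) :=
    ⟨by positivity, div_le_self (by positivity) (one_le_pow₀ hn1)⟩
  have hTn : 0 < T / n := by positivity
  set e : ℝ → ℂ := fun x => E (max x 0 * (T / n)) (PeriodicTest.mode T (-k)) with he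
  have hec : Continuous e := (hsol.continuous_field _).comp_continuous (by fun_prop)
    fun x => mem_Ici.2 (by positivity)
  set G' : ℝ → ℂ := fun x => c * G (σ * x) with hG'
  set H' : ℝ → ℂ := fun x => c * σ * H (σ * x) with hH'
  have hσ0 : σ ≠ 0 := by rcases hσ with rfl | rfl <;> norm_num
  have hprim : ∀ x y, 0 ≤ x → x ≤ y → G' y = G' x + ∫ t in x..y, H' t := by
    intro x y _ _
    have h1 := intervalIntegral.integral_comp_mul_left (a := x) (b := y) H hσ0
    rw [eq_inv_smul_iff₀ hσ0, Complex.real_smul] at h1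
    simp only [hG', hH']
    rw [intervalIntegral.integral_const_mul, hGH (σ * x) (σ * y), ← h1]
    ring
  have wG : weighted r G' = c • weighted r fun x => G (σ * x) := by
    funext x
    simp only [weighted, hG', Pi.smul_apply, smul_eq_mul]
    ring
  have wH : weighted r' H' = (c * σ) • weighted r' fun x => H (σ * x) := by
    funext x
    simp only [weighted, hH', Pi.smul_apply, smul_eq_mul]
    ring
  obtain ⟨mG, bG⟩ := eLpNorm_weighted_le hG2 hσ
  obtain ⟨mH, bH⟩ := eLpNorm_weighted_le hH2 hσ
  set N : ℝ → ℝ≥0∞ := fun x => ENNReal.ofReal (n ^ x) with hN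
  have hNN : ∀ x y, N x * N y = N (x + y) := fun x y => ofReal_rpow_mul_ofReal_rpow hn0 x y
  have hA : eLpNorm (weighted r G') 2 halfLine ≤ D₁ * (N (-1) * a) := by
    rw [wG, eLpNorm_const_smul, hcn]
    calc _ ≤ ENNReal.ofReal (T ^ 2 / (2 * Real.pi) * n ^ (-1 : ℝ)) *
          (ENNReal.ofReal (2 ^ (|r| / 2)) * a) := by gcongr; exact bG.trans (by gcongr)
      _ = D₁ * (N (-1) * a) := by
        simp only [hN]
        rw [hD₁, ENNReal.ofReal_mul (by positivity), ENNReal.ofReal_mul (by positivity)]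
        ring
  have hB : eLpNorm (weighted r' H') 2 halfLine ≤ D₂ * (N (-1) * b) := by
    have : ‖c * (σ : ℂ)‖ₑ = ‖c‖ₑ := by
      rw [← ofReal_norm, norm_mul, hσn, mul_one, ofReal_norm]
    rw [wH, eLpNorm_const_smul, this, hcn]
    calc _ ≤ ENNReal.ofReal (T ^ 2 / (2 * Real.pi) * n ^ (-1 : ℝ)) *
          (ENNReal.ofReal (2 ^ (|r'| / 2)) * (ENNReal.ofReal (2 * Real.pi) * b)) := by
            gcongr; exact bH.trans (by gcongr)
      _ = D₂ * (N (-1) * b) := by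
        simp only [hN]
        rw [hD₂, ENNReal.ofReal_mul (p := T ^ 2 / (2 * Real.pi)) (by positivity),
          ENNReal.ofReal_mul (p := T ^ 2 / (2 * Real.pi) * 2 ^ (|r'| / 2)) (by positivity),
          ENNReal.ofReal_mul (p := T ^ 2 / (2 * Real.pi)) (by positivity)]
        ring
  have hvol : ∀ x, 0 ≤ x → e x = G' x + (l : ℂ) * ∫ y in Ioo 0 x, fieldKernel φ σ (x - y) * e y := by
    intro x hx
    have h1 := hsol.rescaled_volterra hT hφ hf₀ hk hσ hkσ (continuous_const.mul hGc) hGT hx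
    have h2 : ∫ y in Ioo 0 x, fieldKernel φ σ (x - y) * e y = ∫ y in Ioo 0 x,
        fieldKernel φ σ (x - y) * E (y * (T / n)) (PeriodicTest.mode T (-k)) := by
      refine setIntegral_congr_fun measurableSet_Ioo fun y hy => ?_
      simp only [he, max_eq_left hy.1.le]
    rw [h2]
    simp only [he, max_eq_left hx]
    rw [h1]
    refine congrArg₂ (· + ·) ?_ rfl
    change σ * Complex.I * T / (2 * Real.pi * n) * (T * G (σ * x)) = c * G (σ * x)
    rw [hc]
    ring
  obtain ⟨τ, hτ0, hτ1, hτ2⟩ := hC l hlm G' H' e hprim (by rw [wG]; exact mG.const_smul c)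
    (by rw [wH]; exact mH.const_smul (c * σ)) hec hvol
  refine ⟨fun t => τ (n * t / T), ?_, fun t ht => ?_, fun t ht => ?_⟩
  · refine hτ0.comp ?_
    have : (fun t => n * t / T) = fun t => n / T * t := by
      funext t
      ring
    rw [this]
    exact tendsto_id.const_mul_atTop (by positivity)
  · refine (hτ1 _ (by positivity)).trans ?_
    calc C * eLpNorm (weighted r G') 2 halfLine ≤ C * (D₁ * (N (-1) * a)) := by gcongr
      _ = C * D₁ * (N (-1) * a) := by ring
      _ ≤ _ := by gcongr; exact le_self_add
  · have ht0 : 0 < t := by linarith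
    set y := n * t / T with hy
    have hy0 : 0 ≤ y := by positivity
    have h1 := hτ2 y hy0
    have hey : (E t).coeff k = (T : ℂ)⁻¹ * e y := by
      have e1 : max y 0 * (T / n) = t := by
        rw [max_eq_left hy0, hy]
        field_simp
      simp only [he, e1]
      rfl
    have hen : ‖(E t).coeff k‖ₑ ^ 2 = S * ‖e y‖ₑ ^ 2 := by
      rw [hey, ← ofReal_norm, norm_mul, ENNReal.ofReal_mul (norm_nonneg _), mul_pow, ofReal_norm (e y),
        hS, norm_inv, Complex.norm_real, Real.norm_eq_abs, abs_of_pos hT]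
    have p1 : ENNReal.ofReal (t ^ (r + r')) * ENNReal.ofReal ((1 + y) ^ (-(r + r'))) ≤
        V₁ * N (-(r + r')) := by
      rw [hV₁, hN, ← ENNReal.ofReal_mul (by positivity), ← ENNReal.ofReal_mul (by positivity)]
      exact ENNReal.ofReal_le_ofReal (rpow_mul_one_add_rpow_neg_le ht0 hn0 hT hrr)
    -- Here t ≥ 1 is used: r' ≤ m gives t^{r+r'} ≤ t^{r+m}.
    have p2 : ENNReal.ofReal (t ^ (r + r')) * ENNReal.ofReal ((1 + y) ^ (-(r + m))) ≤
        V₂ * N (-(r + m)) := by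
      rw [hV₂, hN, ← ENNReal.ofReal_mul (by positivity), ← ENNReal.ofReal_mul (by positivity)]
      refine ENNReal.ofReal_le_ofReal
        (le_trans ?_ (rpow_mul_one_add_rpow_neg_le ht0 hn0 hT hrm0))
      refine mul_le_mul_of_nonneg_right ?_ (by positivity)
      exact Real.rpow_le_rpow_of_exponent_le ht (by linarith [le_abs_self r'])
    -- The coupling l contributes two more powers of 1/n, which absorb the loss from the term with
    -- G(0) when the modes are summed.
    have p3 : ENNReal.ofReal l = V₃ * N (-2) := by
      rw [hV₃, hN, ← ENNReal.ofReal_mul (by positivity), hl, div_eq_mul_inv, Real.rpow_neg hn0.le]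
      norm_num
    have p4 : (eLpNorm (weighted r G') 2 halfLine * eLpNorm (weighted r' H') 2 halfLine) ^
        (1 / 2 : ℝ) ≤ Z * (N (-1) * (a * b) ^ (1 / 2 : ℝ)) := by
      calc _ ≤ ((D₁ * (N (-1) * a)) * (D₂ * (N (-1) * b))) ^ (1 / 2 : ℝ) := by gcongr
        _ = ((D₁ * D₂) * (N (-1) ^ 2 * (a * b))) ^ (1 / 2 : ℝ) := by
          congr 1
          ring
        _ = Z * (N (-1) * (a * b) ^ (1 / 2 : ℝ)) := by
          rw [ENNReal.mul_rpow_of_nonneg (D₁ * D₂) _ (by norm_num : (0 : ℝ) ≤ 1 / 2),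
            ENNReal.mul_rpow_of_nonneg (N (-1) ^ 2) _ (by norm_num : (0 : ℝ) ≤ 1 / 2),
            ← ENNReal.rpow_natCast (N (-1)) 2, ← ENNReal.rpow_mul, ← hZ]
          norm_num
    rw [hen]
    calc _ ≤ ENNReal.ofReal (t ^ (r + r')) * (S * (C * τ y *
          (ENNReal.ofReal ((1 + y) ^ (-(r + r'))) * eLpNorm (weighted r' H') 2 halfLine +
            ENNReal.ofReal l * ENNReal.ofReal ((1 + y) ^ (-(r + m))) *
              (eLpNorm (weighted r G') 2 halfLine * eLpNorm (weighted r' H') 2 halfLine) ^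
                (1 / 2 : ℝ)))) := by gcongr
      _ = S * C * τ y * ((ENNReal.ofReal (t ^ (r + r')) * ENNReal.ofReal ((1 + y) ^ (-(r + r')))) *
            eLpNorm (weighted r' H') 2 halfLine + ENNReal.ofReal l *
            (ENNReal.ofReal (t ^ (r + r')) * ENNReal.ofReal ((1 + y) ^ (-(r + m)))) *
              (eLpNorm (weighted r G') 2 halfLine * eLpNorm (weighted r' H') 2 halfLine) ^
                (1 / 2 : ℝ)) := by ring
      _ ≤ S * C * τ y * ((V₁ * N (-(r + r'))) * (D₂ * (N (-1) * b)) + V₃ * N (-2) *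
            (V₂ * N (-(r + m))) * (Z * (N (-1) * (a * b) ^ (1 / 2 : ℝ)))) := by
          rw [p3]
          gcongr
      _ = S * C * τ y * ((V₁ * D₂) * (N (-(r + r') + -1) * b) + (V₃ * V₂ * Z) *
            (N (-2 + (-(r + m) + -1)) * (a * b) ^ (1 / 2 : ℝ))) := by
          rw [← hNN, ← hNN, ← hNN]
          ring
      _ ≤ S * C * τ y * ((V₁ * D₂ + V₃ * V₂ * Z) * (N (-(r + r') + -1) * b) +
            (V₁ * D₂ + V₃ * V₂ * Z) * (N (-2 + (-(r + m) + -1)) * (a * b) ^ (1 / 2 : ℝ))) := by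
          gcongr
          · exact le_self_add
          · exact le_add_self
      _ = S * C * (V₁ * D₂ + V₃ * V₂ * Z) * τ y * (N (-(r + r') - 1) * b +
            N (-(r + m) - 3) * (a * b) ^ (1 / 2 : ℝ)) := by
          have e1 : -(r + r') + -1 = -(r + r') - 1 := by ring
          have e2 : -2 + (-(r + m) + -1) = -(r + m) - 3 := by ring
          rw [e1, e2]
          ring
      _ ≤ _ := by
          gcongr
          exact le_add_self

/-- The decay estimate for a single mode, uniformly in the mode. -/
theorem exists_mode_bound {f₀ : ℝ → ℝ} {m : ℝ} (hm : 1 / 2 < m) {T : ℝ} (hT : 0 < T)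
    (hT₀ : ENNReal.ofReal T < criticalPeriod f₀)
    {f : ℝ → PeriodicDistribution T 𝓢'(ℝ, ℂ)} {E : ℝ → PeriodicDistribution T ℂ}
    (hsol : IsSolution f₀ f E) {g : PeriodicDistribution T 𝓢'(ℝ, ℂ)}
    (hg : ∀ a : PeriodicTest T, g a = f 0 a - (∫ x in (0 : ℝ)..T, a.1 x) •
      ((T : ℂ)⁻¹ • f 0 (PeriodicTest.one T)))
    {φ : ℝ → ℂ} (hφm : Measurable φ) (hφw : MemLp (besselWeighted m φ) 2 volume)
    (hsymm : ∀ ξ, φ (-ξ) = (starRingEnd ℂ) (φ ξ))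
    (hf₀ : ∀ v, ((deriv f₀ v : ℝ) : ℂ) = 𝓕⁻ φ v)
    {r r' : ℝ} (hr : -(1 / 2) ≤ r) (hrm : |r| ≤ m) (hrm' : |r'| ≤ m) (hrr : 0 ≤ r + r') :
    ∃ C : ℝ≥0∞, C ≠ ⊤ ∧ ∀ k : ℤ, k ≠ 0 →
      sobolevNorm r (g.coeff k) < ⊤ → sobolevNorm r' ((vMul g).coeff k) < ⊤ →
      ∃ τ : ℝ → ℝ≥0∞, Tendsto τ atTop (𝓝 0) ∧
        (∀ t, 0 ≤ t → τ t ≤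
          C * (ENNReal.ofReal (|(k : ℝ)| ^ (-1 : ℝ)) * sobolevNorm r (g.coeff k))) ∧
        ∀ t, 1 ≤ t → ENNReal.ofReal (t ^ (r + r')) * ‖(E t).coeff k‖ₑ ^ 2 ≤ C * τ t *
          (ENNReal.ofReal (|(k : ℝ)| ^ (-(r + r') - 1)) * sobolevNorm r' ((vMul g).coeff k) +
            ENNReal.ofReal (|(k : ℝ)| ^ (-(r + m) - 3)) *
              (sobolevNorm r (g.coeff k) * sobolevNorm r' ((vMul g).coeff k)) ^ (1 / 2 : ℝ)) := by
  obtain ⟨C₁, h₁, H₁⟩ := exists_mode_bound_sign hm hT hT₀ hsol hg hφm hφw hsymm hf₀ hr hrm hrm' hrr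
    (Or.inl rfl)
  obtain ⟨C₂, h₂, H₂⟩ := exists_mode_bound_sign hm hT hT₀ hsol hg hφm hφw hsymm hf₀ hr hrm hrm' hrr
    (Or.inr rfl)
  refine ⟨C₁ + C₂, by finiteness, fun k hk ha hb => ?_⟩
  rcases le_total 0 (k : ℝ) with h0 | h0
  · obtain ⟨τ, a1, a2, a3⟩ := H₁ k hk (by rw [abs_of_nonneg h0, one_mul]) ha hb
    exact ⟨τ, a1, fun t ht => (a2 t ht).trans (by gcongr; exact le_self_add),
      fun t ht => (a3 t ht).trans (by gcongr; exact le_self_add)⟩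
  · obtain ⟨τ, a1, a2, a3⟩ := H₂ k hk (by rw [abs_of_nonpos h0]; ring) ha hb
    exact ⟨τ, a1, fun t ht => (a2 t ht).trans (by gcongr; exact le_add_self),
      fun t ht => (a3 t ht).trans (by gcongr; exact le_add_self)⟩

/-! ### Summation over the modes -/

theorem mul_le_sq_add_sq (X Y : ℝ≥0∞) : X * Y ≤ X ^ 2 + Y ^ 2 := by
  rcases le_total X Y with h | h
  · calc X * Y ≤ Y * Y := by gcongr
      _ = Y ^ 2 := (sq Y).symm
      _ ≤ _ := le_add_self
  · calc X * Y ≤ X * X := by gcongr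
      _ = X ^ 2 := (sq X).symm
      _ ≤ _ := le_self_add

theorem mul_sqrt_le_sq_add_sq (X Y : ℝ≥0∞) : X * (X * Y) ^ (1 / 2 : ℝ) ≤ X ^ 2 + Y ^ 2 := by
  have hsq : ∀ Z : ℝ≥0∞, (Z * Z) ^ (1 / 2 : ℝ) = Z := fun Z => by
    rw [← sq, ← ENNReal.rpow_natCast, ← ENNReal.rpow_mul]
    norm_num
  rcases le_total X Y with h | h
  · calc X * (X * Y) ^ (1 / 2 : ℝ) ≤ Y * (Y * Y) ^ (1 / 2 : ℝ) := by gcongr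
      _ = Y ^ 2 := by rw [hsq, sq]
      _ ≤ _ := le_add_self
  · calc X * (X * Y) ^ (1 / 2 : ℝ) ≤ X * (X * X) ^ (1 / 2 : ℝ) := by gcongr
      _ = X ^ 2 := by rw [hsq, sq]
      _ ≤ _ := le_self_add

/-- Combination of the powers of the wave number `n ≥ 1`. -/
theorem power_weights_le {n : ℝ} (hn : 1 ≤ n) {s sx sx' r r' m : ℝ} (hrm : |r| ≤ m)
    (hrm' : |r'| ≤ m) (h1 : s ≤ 3 / 2 + sx + r) (h2 : s ≤ 1 / 2 + sx' + r') (a b : ℝ≥0∞) :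
    ENNReal.ofReal (n ^ (2 * s)) * ((ENNReal.ofReal (n ^ (-1 : ℝ)) * a) *
      (ENNReal.ofReal (n ^ (-(r + r') - 1)) * b +
        ENNReal.ofReal (n ^ (-(r + m) - 3)) * (a * b) ^ (1 / 2 : ℝ))) ≤
    2 * (ENNReal.ofReal (n ^ (2 * sx)) * a ^ 2 + ENNReal.ofReal (n ^ (2 * sx')) * b ^ 2) := by
  have hn0 : 0 < n := by linarith
  set N : ℝ → ℝ≥0∞ := fun x => ENNReal.ofReal (n ^ x) with hN
  have hNN : ∀ x y, N x * N y = N (x + y) := fun x y => ofReal_rpow_mul_ofReal_rpow hn0 x y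
  have hmono : ∀ {x y : ℝ}, x ≤ y → N x ≤ N y := fun h =>
    ENNReal.ofReal_le_ofReal (Real.rpow_le_rpow_of_exponent_le hn h)
  have hsq : ∀ x, N x ^ 2 = N (2 * x) := fun x => by rw [sq, hNN, two_mul]
  have hhalf : ∀ x, N x ^ (1 / 2 : ℝ) = N (x / 2) := fun x => by
    rw [hN]
    simp only
    rw [ENNReal.ofReal_rpow_of_nonneg (by positivity) (by norm_num), ← Real.rpow_mul hn0.le]
    congr 2
    ring
  have b1 := le_abs_self r
  have b2 := le_abs_self r'
  -- Adding the two bounds on s gives 2s ≤ 2 + sx + sx' + r + r', exactly the required inequality of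
  -- exponents; this product determines the admissible s.
  have e1 : N (2 * s) * ((N (-1) * a) * (N (-(r + r') - 1) * b)) ≤ (N sx * a) * (N sx' * b) := by
    calc _ = (N (2 * s) * (N (-1) * N (-(r + r') - 1))) * (a * b) := by ring
      _ ≤ N (sx + sx') * (a * b) := by
        rw [hNN, hNN]
        gcongr
        exact hmono (by linarith)
      _ = _ := by
        rw [← hNN]
        ring
  -- Three halves of the first bound on s plus one half of the second suffice, with r, r' ≤ m and a
  -- margin of 3/2 in the exponent.
  have e2 : N (2 * s) * ((N (-1) * a) * (N (-(r + m) - 3) * (a * b) ^ (1 / 2 : ℝ))) ≤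
      (N sx * a) * ((N sx * a) * (N sx' * b)) ^ (1 / 2 : ℝ) := by
    calc _ = (N (2 * s) * (N (-1) * N (-(r + m) - 3))) * (a * (a * b) ^ (1 / 2 : ℝ)) := by ring
      _ ≤ N (sx + (sx + sx') / 2) * (a * (a * b) ^ (1 / 2 : ℝ)) := by
        rw [hNN, hNN]
        gcongr
        exact hmono (by linarith)
      _ = (N sx * a) * (N (sx + sx') * (a * b)) ^ (1 / 2 : ℝ) := by
        rw [ENNReal.mul_rpow_of_nonneg (N (sx + sx')) _ (by norm_num : (0 : ℝ) ≤ 1 / 2), hhalf, ← hNN]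
        ring
      _ = _ := by
        rw [← hNN]
        congr 2
        ring
  calc _ = N (2 * s) * ((N (-1) * a) * (N (-(r + r') - 1) * b)) +
        N (2 * s) * ((N (-1) * a) * (N (-(r + m) - 3) * (a * b) ^ (1 / 2 : ℝ))) := by ring
    _ ≤ ((N sx * a) ^ 2 + (N sx' * b) ^ 2) + ((N sx * a) ^ 2 + (N sx' * b) ^ 2) :=
      add_le_add (e1.trans (mul_le_sq_add_sq _ _)) (e2.trans (mul_sqrt_le_sq_add_sq _ _))
    _ = _ := by
      rw [mul_pow, mul_pow, hsq, hsq]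
      exact (two_mul _).symm

theorem tsum_lt_top_of_rpow {ι : Type*} {F : ι → ℝ≥0∞} (h : (∑' k, F k) ^ (1 / 2 : ℝ) < ⊤) :
    ∑' k, F k < ⊤ := by
  rwa [ENNReal.rpow_lt_top_iff_of_pos (by norm_num)] at h

/-- Dominated convergence for series in `[0, ∞]`. -/
theorem tendsto_tsum_enn {ι : Type*} [Countable ι] {F : ℝ → ι → ℝ≥0∞} {bound : ι → ℝ≥0∞}
    (hb : ∑' k, bound k < ⊤) (hF : ∀ᶠ t in atTop, ∀ k, F t k ≤ bound k)
    (hlim : ∀ k, Tendsto (fun t => F t k) atTop (𝓝 0)) :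
    Tendsto (fun t => ∑' k, F t k) atTop (𝓝 0) := by
  let _ : MeasurableSpace ι := ⊤
  have := tendsto_lintegral_filter_of_dominated_convergence (μ := Measure.count) (l := atTop)
    (F := F) (f := fun _ => 0) bound
    (Eventually.of_forall fun t => measurable_from_top)
    (hF.mono fun t ht => Eventually.of_forall ht)
    (by rw [lintegral_count]; exact hb.ne) (Eventually.of_forall hlim)
  simpa only [lintegral_count, lintegral_zero] using this

theorem isLittleO_of_tendsto_weighted {P : ℝ → ℝ≥0∞} {q : ℝ}
    (h : Tendsto (fun t => ENNReal.ofReal (t ^ q) * P t) atTop (𝓝 0)) :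
    (∀ᶠ t in atTop, P t ^ (1 / 2 : ℝ) < ⊤) ∧
      (fun t => (P t ^ (1 / 2 : ℝ)).toReal) =o[atTop] fun t : ℝ => t ^ (-(q / 2)) := by
  constructor
  · filter_upwards [h.eventually_lt_const zero_lt_one, eventually_gt_atTop 0] with t h1 h2
    refine ENNReal.rpow_lt_top_of_nonneg (by norm_num) fun h3 => ?_
    rw [h3, ENNReal.mul_top] at h1
    · exact absurd h1 (by simp)
    · exact (ENNReal.ofReal_pos.2 (Real.rpow_pos_of_pos h2 q)).ne'
  · have h4 : Tendsto (fun t => ((ENNReal.ofReal (t ^ q) * P t) ^ (1 / 2 : ℝ)).toReal) atTop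
        (𝓝 0) := by
      have h5 := (ENNReal.continuous_rpow_const (y := (1 / 2 : ℝ))).tendsto 0 |>.comp h
      rw [ENNReal.zero_rpow_of_pos (by norm_num)] at h5
      exact (ENNReal.tendsto_toReal ENNReal.zero_ne_top).comp h5
    refine (isLittleO_iff_tendsto' ?_).2 ?_
    · filter_upwards [eventually_gt_atTop 0] with t ht h6
      exact absurd h6 (Real.rpow_pos_of_pos ht _).ne'
    · refine h4.congr' ?_
      filter_upwards [eventually_gt_atTop 0] with t ht
      rw [ENNReal.mul_rpow_of_nonneg _ _ (by norm_num : (0 : ℝ) ≤ 1 / 2),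
        ENNReal.ofReal_rpow_of_nonneg (by positivity) (by norm_num), ← Real.rpow_mul ht.le,
        ENNReal.toReal_mul, ENNReal.toReal_ofReal (by positivity), Real.rpow_neg ht.le, div_inv_eq_mul,
        mul_comm]
      congr 2
      ring

end LinearVlasov

theorem proposition5
    (f₀ : ℝ → ℝ) (s₀ : ℝ) (hs₀ : 3 / 2 < s₀)
    (hf₀ : LinearVlasov.MemHs s₀ f₀) (hf₀c : Continuous f₀)
    (T : ℝ) (hT : 0 < T) (hT₀ : ENNReal.ofReal T < LinearVlasov.criticalPeriod f₀)
    (f : ℝ → LinearVlasov.PeriodicDistribution T 𝓢'(ℝ, ℂ))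
    (E : ℝ → LinearVlasov.PeriodicDistribution T ℂ)
    (hsol : LinearVlasov.IsSolution f₀ f E)
    (g : LinearVlasov.PeriodicDistribution T 𝓢'(ℝ, ℂ))
    (hg : ∀ a : LinearVlasov.PeriodicTest T,
      g a = f 0 a - (∫ x in (0 : ℝ)..T, a.1 x) •
        ((T : ℂ)⁻¹ • f 0 (LinearVlasov.PeriodicTest.one T)))
    (sx sv sx' sv' : ℝ)
    (hg_mem : LinearVlasov.mixedSobolevNorm sx sv g < ⊤)
    (hvg_mem : LinearVlasov.mixedSobolevNorm sx' sv' (LinearVlasov.vMul g) < ⊤)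
    (hsv : -(1 / 2) < sv) (hsum : 0 ≤ sv + sv')
    (hmax : max |sv| |sv'| ≤ s₀ - 1)
    (s : ℝ) (hs : s = min (3 / 2 + sx + sv) (1 / 2 + sx' + sv')) :
    (∀ᶠ t in atTop, LinearVlasov.periodicSobolevNorm s (E t) < ⊤) ∧
      (fun t : ℝ => (LinearVlasov.periodicSobolevNorm s (E t)).toReal)
        =o[atTop] (fun t : ℝ => t ^ (-((sv + sv') / 2))) := by
  obtain ⟨p, hpm, hpsymm, hpw, hpd⟩ := LinearVlasov.exists_fourier_profile hs₀ hf₀ hf₀c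
  have hrm : |sv| ≤ s₀ - 1 := (le_max_left _ _).trans hmax
  have hrm' : |sv'| ≤ s₀ - 1 := (le_max_right _ _).trans hmax
  -- Here φ(ξ) = 2πiξ p(ξ) is the transform of f₀'; its Hermitian symmetry follows from that of p,
  -- because iξ is itself Hermitian.
  obtain ⟨C, hC, H⟩ := LinearVlasov.exists_mode_bound (m := s₀ - 1) (by linarith) hT hT₀ hsol hg
    (by fun_prop) (LinearVlasov.besselWeighted_mul_id hpm hpw)
    (fun ξ => by
      simp only [hpsymm, map_mul, Complex.conj_ofReal, Complex.conj_I, Complex.conj_ofNat]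
      push_cast
      ring)
    (fun v => LinearVlasov.deriv_eq_of_hasDerivAt_ofReal (hpd v)) hsv.le hrm hrm' hsum
  have hga := LinearVlasov.tsum_lt_top_of_rpow hg_mem
  have hgb := LinearVlasov.tsum_lt_top_of_rpow hvg_mem
  have hfin : ∀ (q : ℝ) (k : {k : ℤ // k ≠ 0}) (z : ℝ≥0∞),
      ENNReal.ofReal (|((k : ℤ) : ℝ)| ^ (2 * q)) * z ^ 2 < ⊤ → z < ⊤ := by
    intro q k z hz
    refine lt_top_iff_ne_top.2 fun h => ?_
    have hk : 0 < |((k : ℤ) : ℝ)| := abs_pos.2 (by exact_mod_cast k.2)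
    rw [h, ENNReal.top_pow two_ne_zero, ENNReal.mul_top
      (ENNReal.ofReal_pos.2 (Real.rpow_pos_of_pos hk _)).ne'] at hz
    exact lt_irrefl _ hz
  have hak : ∀ k : {k : ℤ // k ≠ 0}, LinearVlasov.sobolevNorm sv (g.coeff k) < ⊤ := fun k =>
    hfin sx k _ ((ENNReal.le_tsum k).trans_lt hga)
  have hbk : ∀ k : {k : ℤ // k ≠ 0},
      LinearVlasov.sobolevNorm sv' ((LinearVlasov.vMul g).coeff k) < ⊤ := fun k =>
    hfin sx' k _ ((ENNReal.le_tsum k).trans_lt hgb)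
  choose τ hτ0 hτ1 hτ2 using fun k : {k : ℤ // k ≠ 0} => H k k.2 (hak k) (hbk k)
  refine LinearVlasov.isLittleO_of_tendsto_weighted ?_
  simp only [← ENNReal.tsum_mul_left]
  -- The tail factor τ plays two roles. Its uniform bound by the norm of the mode of g gives this
  -- summable majorant, with one factor C from each estimate, and its convergence to zero gives the
  -- limit of each term.
  refine LinearVlasov.tendsto_tsum_enn (bound := fun k : {k : ℤ // k ≠ 0} => C * C * (2 *
    (ENNReal.ofReal (|((k : ℤ) : ℝ)| ^ (2 * sx)) * LinearVlasov.sobolevNorm sv (g.coeff k) ^ 2 +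
      ENNReal.ofReal (|((k : ℤ) : ℝ)| ^ (2 * sx')) *
        LinearVlasov.sobolevNorm sv' ((LinearVlasov.vMul g).coeff k) ^ 2))) ?_ ?_ fun k => ?_
  · rw [ENNReal.tsum_mul_left, ENNReal.tsum_mul_left, ENNReal.tsum_add]
    exact (ENNReal.mul_ne_top (by finiteness)
      (ENNReal.mul_ne_top (by finiteness) (ENNReal.add_lt_top.2 ⟨hga, hgb⟩).ne)).lt_top
  · filter_upwards [eventually_ge_atTop 1] with t ht k
    have hn : 1 ≤ |((k : ℤ) : ℝ)| := by
      rw [← Int.cast_abs]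
      exact_mod_cast Int.one_le_abs k.2
    have h1 := hτ2 k t ht
    have h2 := hτ1 k t (by linarith)
    have h3 := LinearVlasov.power_weights_le hn (s := s) (sx := sx) (sx' := sx') hrm hrm'
      (hs.le.trans (min_le_left _ _)) (hs.le.trans (min_le_right _ _))
      (LinearVlasov.sobolevNorm sv (g.coeff k))
      (LinearVlasov.sobolevNorm sv' ((LinearVlasov.vMul g).coeff k))
    refine le_trans ?_ (mul_le_mul_right h3 (C * C))
    rw [mul_left_comm]
    refine (mul_le_mul_right (h1.trans (mul_le_mul_left (mul_le_mul_right h2 C) _)) _).trans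
      (le_of_eq ?_)
    ring
  · rw [← mul_zero (ENNReal.ofReal (|((k : ℤ) : ℝ)| ^ (2 * s)))]
    simp only [mul_left_comm (ENNReal.ofReal (_ ^ (sv + sv')))]
    refine ENNReal.Tendsto.const_mul ?_ (Or.inr ENNReal.ofReal_ne_top)
    have h1 : Tendsto (fun t => C * τ k t * (ENNReal.ofReal (|((k : ℤ) : ℝ)| ^ (-(sv + sv') - 1)) *
        LinearVlasov.sobolevNorm sv' ((LinearVlasov.vMul g).coeff k) +
        ENNReal.ofReal (|((k : ℤ) : ℝ)| ^ (-(sv + (s₀ - 1)) - 3)) *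
          (LinearVlasov.sobolevNorm sv (g.coeff k) *
            LinearVlasov.sobolevNorm sv' ((LinearVlasov.vMul g).coeff k)) ^ (1 / 2 : ℝ)))
        atTop (𝓝 0) := by
      have ha := (hak k).ne
      have hb := (hbk k).ne
      have h2 := ENNReal.Tendsto.mul_const (b := ENNReal.ofReal (|((k : ℤ) : ℝ)| ^ (-(sv + sv') - 1)) *
        LinearVlasov.sobolevNorm sv' ((LinearVlasov.vMul g).coeff k) +
        ENNReal.ofReal (|((k : ℤ) : ℝ)| ^ (-(sv + (s₀ - 1)) - 3)) *
          (LinearVlasov.sobolevNorm sv (g.coeff k) *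
            LinearVlasov.sobolevNorm sv' ((LinearVlasov.vMul g).coeff k)) ^ (1 / 2 : ℝ))
        (ENNReal.Tendsto.const_mul (a := C) (hτ0 k) (Or.inr hC)) (Or.inr (by finiteness))
      simpa only [mul_zero, zero_mul] using h2
    refine tendsto_of_tendsto_of_tendsto_of_le_of_le' tendsto_const_nhds h1
      (Eventually.of_forall fun t => zero_le) ?_
    filter_upwards [eventually_ge_atTop 1] with t ht
    exact hτ2 k t ht
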